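/- Call a positive integer $v$ admissible if $v\equiv 1$ or $3 \pmod 6$. A twofold triple system of order $v$, or TTS($v$), is a pair $(V,\mathcal B)$ where $V$ is a set of $v$ points and $\mathcal B$ is a set of $3$-subsets of $V$ (blocks) such that every $2$-subset of $V$ is contained in exactly two blocks. Its $2$-block intersection graph ($2$-BIG) has the blocks as vertices, two blocks being adjacent if they intersect in exactly two points. Theorem 2. Suppose $u$ and $v$ are admissible integers such that $v>2u$ and $u>13$. If there exists a TTS($u$) whose $2$-BIG is bipartite, connected and non-Hamiltonian, then there exists a TTS($v$) whose $2$-BIG is bipartite, connected and non-Hamiltonian. -/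

import Mathlib

/-- A positive integer is admissible if it is congruent to `1` or `3` modulo `6`. -/
def Admissible (v : ℕ) : Prop := v % 6 = 1 ∨ v % 6 = 3

/-- `(V, B)` is a `(v, k, l)`-BIBD: there are `v` points, `B` is a set of `k`-subsets of the point
set `V`, and each `2`-subset of `V` is contained in precisely `l` blocks of `B`. -/
structure IsBIBD {V : Type*} [Fintype V] [DecidableEq V] (v k l : ℕ)
    (B : Finset (Finset V)) : Prop where
  card_points : Fintype.card V = v
  card_block : ∀ b ∈ B, b.card = k
  card_pair : ∀ p : Finset V, p.card = 2 → (B.filter (fun b => p ⊆ b)).card = l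

/-- A twofold triple system of order `v`: a `(v, 3, 2)`-BIBD. -/
def IsTTS {V : Type*} [Fintype V] [DecidableEq V] (v : ℕ) (B : Finset (Finset V)) : Prop :=
  IsBIBD v 3 2 B

/-- The `i`-block intersection graph of a design with block set `B`: its vertices are the blocks,
and two (distinct) blocks are adjacent if they have exactly `i` points in common. -/
def blockIntersectionGraph {V : Type*} [DecidableEq V] (i : ℕ) (B : Finset (Finset V)) :
    SimpleGraph {b : Finset V // b ∈ B} where
  Adj b c := b ≠ c ∧ ((b : Finset V) ∩ (c : Finset V)).card = i
  symm := ⟨fun b c h => ⟨h.1.symm, by rw [Finset.inter_comm]; exact h.2⟩⟩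
  loopless := ⟨fun _ h => h.1 rfl⟩

/-! A bipartite `2`-BIG means that the blocks form two disjoint Steiner triple systems `S₁`, `S₂` on
the same points, and any two disjoint Steiner triple systems give such a graph. So both systems have
to be enlarged, keeping them disjoint and the graph connected, in a way that cannot create a
Hamiltonian cycle.

Non-Hamiltonicity is inherited through a 3-edge cut. All old blocks are kept except one block `{a,
b, c}` of `S₁`. It is removed by a Pasch switch, which trades `abc, ayz, bxz, cxy` for `xyz, abz,
acy, bcx`, with `x, y, z` new points. Now each pair of `{a, b, c}` lies in a different new block, so
the old blocks are tied to the rest of the graph by exactly the edges that used to end at `{a, b,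
c}`. Contracting everything new to one vertex restores the old graph. A Hamiltonian cycle crosses a
3-edge cut exactly twice, so it would contract to a Hamiltonian cycle of the old graph
(`IsHamiltonian.of_contraction`, `isHamiltonian_of_extension`).

The enlargement comes from a frame: the complete graph on the new points is split into one perfect
matching for each old point, together with triangles. Joining each old point to the edges of its
matching completes a triple system. The two systems use nearly the same matchings, but the second
one assigns them to the old points with a cyclic shift. This makes the mixed blocks disjoint, and it
also links the block of index `s` at a new point to the block of index `s + 1`, which yields
connectedness (`IsFramePair.glue`).

Frame pairs are built on two copies of `ZMod h`, or on three copies of `ZMod m` with `m` even,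
according to the residue of `v - u` modulo `6`. In both cases the second frame arises by shifting an
interval of sums or differences by one. With two copies, the remaining edges form a prism over a
regular graph; Vizing's theorem factorizes it, since the one colour left over at each vertex serves
for the rung. The constructions reach `v ≤ 4 * u + 2`; larger `v` are reached by first passing from
`u` to `2 * u + 1`. -/

namespace SimpleGraph

/-! ### Hamiltonian cycles as connected 2-regular subgraphs, and 3-edge cuts. -/

theorem IsHamiltonian.exists_two_regular {V : Type*} [Fintype V] [DecidableEq V] [Nontrivial V]
    {G : SimpleGraph V} (h : G.IsHamiltonian) :
    ∃ H ≤ G, H.Connected ∧ ∀ v, (H.neighborSet v).ncard = 2 := by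
  obtain ⟨a, p, hp⟩ := h Fintype.one_lt_card.ne'
  refine ⟨p.toSubgraph.spanningCoe, p.toSubgraph.spanningCoe_le, ?_, ?_⟩
  · have hc := p.toSubgraph_connected
    have hs : p.toSubgraph.IsSpanning := fun v => by
      rw [Walk.mem_verts_toSubgraph]; exact hp.mem_support v
    exact ((Subgraph.spanningCoeEquivCoeOfSpanning _ hs).connected_iff).2 hc.coe
  · intro v
    exact hp.isCycle.ncard_neighborSet_toSubgraph_eq_two (hp.mem_support v)

/-- A component in which all degrees are two is a cycle, and here the only component is the whole
graph. -/
theorem Connected.isHamiltonian_of_two_regular {V : Type*} [Fintype V] [DecidableEq V]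
    {H : SimpleGraph V} (hc : H.Connected) (h2 : ∀ v, (H.neighborSet v).ncard = 2) :
    H.IsHamiltonian := by
  intro _
  obtain ⟨v⟩ := hc.nonempty
  have hn : (H.neighborSet v).Nonempty := Set.nonempty_of_ncard_ne_zero (by rw [h2]; norm_num)
  obtain ⟨p, hp, hs⟩ := IsCycles.exists_cycle_toSubgraph_verts_eq_connectedComponentSupp
    (c := H.connectedComponentMk v) (fun w _ => h2 w) rfl hn
  have hm : ∀ w, w ∈ p.support := fun w => by
    rw [← Walk.mem_verts_toSubgraph, hs, ConnectedComponent.mem_supp_iff, ConnectedComponent.eq]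
    exact hc.preconnected w v
  refine ⟨v, p, hp, ?_⟩
  refine (Walk.IsPath.isHamiltonian_iff hp.isPath_tail).2 fun w => ?_
  rw [Walk.support_tail_of_not_nil _ hp.not_nil]
  rcases eq_or_ne w v with rfl | hw
  · exact Walk.end_mem_tail_support hp.not_nil
  · have := hm w
    rw [Walk.mem_support_iff] at this
    exact this.resolve_left hw

/-- A Hamiltonian cycle survives the contraction of one side of a `3`-edge cut to a vertex. -/
theorem IsHamiltonian.of_contraction {V W : Type*} [Fintype V] [DecidableEq V] [Fintype W]
    [DecidableEq W] [Nontrivial W] {Γ : SimpleGraph V} {G : SimpleGraph W} (hΓ : Γ.IsHamiltonian)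
    (f : V → W) (o : W) (hf : Function.Surjective f)
    (hadj : ∀ b c, Γ.Adj b c → f b ≠ f c → G.Adj (f b) (f c))
    (hone : ∀ b c, f b = f c → f b ≠ o → b = c)
    (hinj : ∀ a b c, f a ≠ o → Γ.Adj a b → Γ.Adj a c → f b = f c → b = c)
    (hdeg : (G.neighborSet o).ncard ≤ 3) : G.IsHamiltonian := by
  classical
  have : Nontrivial V := hf.nontrivial
  obtain ⟨H, hH, hHc, hH2⟩ := hΓ.exists_two_regular
  -- The image of the cycle `H`: connected, and of degree two away from `o` because `f` is injective
  -- there and on neighbourhoods.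
  let K : SimpleGraph W :=
    { Adj := fun p q => p ≠ q ∧ ∃ b c, H.Adj b c ∧ f b = p ∧ f c = q
      symm := ⟨fun p q ⟨h, b, c, hbc, hb, hc⟩ => ⟨h.symm, c, b, hbc.symm, hc, hb⟩⟩
      loopless := ⟨fun p h => h.1 rfl⟩ }
  have hKG : K ≤ G := by
    rintro p q ⟨h, b, c, hbc, rfl, rfl⟩
    exact hadj b c (hH hbc) h
  have hreach : ∀ b c, H.Reachable b c → K.Reachable (f b) (f c) := by
    rintro b c ⟨w⟩
    induction w with
    | nil => exact Reachable.refl _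
    | @cons x y z hxy _ ih =>
      by_cases hxy' : f x = f y
      · rw [hxy']; exact ih
      · have hK : K.Adj (f x) (f y) := ⟨hxy', x, y, hxy, rfl, rfl⟩
        exact hK.reachable.trans ih
  have hKc : K.Connected :=
    { preconnected := fun p q => by
        obtain ⟨b, rfl⟩ := hf p
        obtain ⟨c, rfl⟩ := hf q
        exact hreach b c (hHc.preconnected b c)
      nonempty := inferInstance }
  have hK2 : ∀ p, p ≠ o → (K.neighborSet p).ncard = 2 := by
    intro p hp
    obtain ⟨a, rfl⟩ := hf p
    have : K.neighborSet (f a) = f '' H.neighborSet a := by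
      ext q
      constructor
      · rintro ⟨-, b, c, hbc, hb, rfl⟩
        have := hone b a hb (hb ▸ hp)
        subst this
        exact ⟨c, hbc, rfl⟩
      · rintro ⟨c, hc, rfl⟩
        refine ⟨fun h => ?_, a, c, hc, rfl, rfl⟩
        exact hc.ne (hone a c h hp)
    rw [this, Set.InjOn.ncard_image, hH2]
    intro b hb c hc h
    exact hinj a b c hp (hH hb) (hH hc) h
  refine IsHamiltonian.mono hKG (hKc.isHamiltonian_of_two_regular fun p => ?_)
  by_cases hp : p = o
  · subst hp
    have h3 : (K.neighborSet p).ncard ≤ 3 :=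
      (Set.ncard_le_ncard (fun q hq => hKG hq) (Set.toFinite _)).trans hdeg
    have hpos : 0 < (K.neighborSet p).ncard := by
      rw [Set.ncard_pos (Set.toFinite _)]
      obtain ⟨q, hq⟩ := exists_ne p
      obtain ⟨w⟩ := hKc.preconnected p q
      cases w with
      | nil => exact (hq rfl).elim
      | cons h _ => exact ⟨_, h⟩
    have hdegree : ∀ q, K.degree q = (K.neighborSet q).ncard := fun q => by
      rw [← card_neighborSet_eq_degree, ← Nat.card_eq_fintype_card, Nat.card_coe_set_eq]
    -- All other degrees are two, so by the handshake identity the degree of `o` is even; lying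
    -- between 1 and 3, it is two.
    have hsum := K.sum_degrees_eq_twice_card_edges
    rw [← Finset.add_sum_erase _ _ (Finset.mem_univ p),
      Finset.sum_congr rfl (g := fun _ => 2)
        (fun q hq => by rw [hdegree, hK2 q (Finset.ne_of_mem_erase hq)]), hdegree,
      Finset.sum_const, smul_eq_mul] at hsum
    omega
  · exact hK2 p hp

end SimpleGraph

/-! ### Disjoint Steiner triple systems and bipartite 2-block intersection graphs. -/

/-- A Steiner triple system on the whole type `P`. -/
structure IsSTS {P : Type*} [DecidableEq P] (S : Finset (Finset P)) : Prop where
  card_block : ∀ b ∈ S, b.card = 3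
  exists_block : ∀ x y, x ≠ y → ∃ b ∈ S, x ∈ b ∧ y ∈ b
  block_unique : ∀ x y, x ≠ y → ∀ b ∈ S, ∀ c ∈ S, x ∈ b → y ∈ b → x ∈ c → y ∈ c → b = c

theorem Finset.card_inter_eq_two_of_triples {P : Type*} [DecidableEq P] {b c : Finset P}
    (hb : b.card = 3) (hc : c.card = 3) (hbc : b ≠ c) {x y : P} (hxy : x ≠ y) (hxb : x ∈ b)
    (hyb : y ∈ b) (hxc : x ∈ c) (hyc : y ∈ c) : (b ∩ c).card = 2 := by
  have h1 : 2 ≤ (b ∩ c).card := by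
    rw [← Finset.card_pair hxy]
    refine Finset.card_le_card fun z hz => ?_
    rcases Finset.mem_insert.1 hz with rfl | hz
    · exact Finset.mem_inter.2 ⟨hxb, hxc⟩
    · rw [Finset.mem_singleton.1 hz]; exact Finset.mem_inter.2 ⟨hyb, hyc⟩
  have h2 : (b ∩ c).card < 3 := by
    by_contra! h
    have hb' : b ∩ c = b := Finset.eq_of_subset_of_card_le Finset.inter_subset_left (by omega)
    have hc' : b ∩ c = c := Finset.eq_of_subset_of_card_le Finset.inter_subset_right (by omega)
    exact hbc (hb'.symm.trans hc')
  omega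

theorem Finset.exists_pair_of_card_inter {P : Type*} [DecidableEq P] {b c : Finset P}
    (h : (b ∩ c).card = 2) : ∃ x y, x ≠ y ∧ x ∈ b ∧ y ∈ b ∧ x ∈ c ∧ y ∈ c := by
  obtain ⟨x, y, hxy, he⟩ := Finset.card_eq_two.1 h
  have hx : x ∈ b ∩ c := by rw [he]; simp
  have hy : y ∈ b ∩ c := by rw [he]; simp
  rw [Finset.mem_inter] at hx hy
  exact ⟨x, y, hxy, hx.1, hy.1, hx.2, hy.2⟩

section Union

variable {P : Type*} [DecidableEq P] {S₁ S₂ : Finset (Finset P)}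

theorem IsSTS.isTTS_union [Fintype P] (h₁ : IsSTS S₁) (h₂ : IsSTS S₂) (hd : Disjoint S₁ S₂) {v : ℕ}
    (hv : Fintype.card P = v) : IsTTS v (S₁ ∪ S₂) where
  card_points := hv
  card_block b hb := (Finset.mem_union.1 hb).elim (h₁.card_block b) (h₂.card_block b)
  card_pair p hp := by
    obtain ⟨x, y, hxy, rfl⟩ := Finset.card_eq_two.1 hp
    have key : ∀ S : Finset (Finset P), IsSTS S →
        (S.filter fun b => {x, y} ⊆ b).card = 1 := by
      intro S hS
      obtain ⟨b, hb, hx, hy⟩ := hS.exists_block x y hxy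
      rw [Finset.card_eq_one]
      refine ⟨b, Finset.ext fun c => ?_⟩
      simp only [Finset.mem_filter, Finset.mem_singleton, Finset.insert_subset_iff,
        Finset.singleton_subset_iff]
      constructor
      · rintro ⟨hc, hxc, hyc⟩
        exact hS.block_unique x y hxy c hc b hb hxc hyc hx hy
      · rintro rfl
        exact ⟨hb, hx, hy⟩
    rw [Finset.filter_union, Finset.card_union_of_disjoint, key S₁ h₁, key S₂ h₂]
    exact Finset.disjoint_filter_filter hd

theorem IsSTS.not_adj_of_mem {B S : Finset (Finset P)} (h : IsSTS S)
    {b c : {b : Finset P // b ∈ B}} (hb : (b : Finset P) ∈ S) (hc : (c : Finset P) ∈ S) :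
    ¬ (blockIntersectionGraph 2 B).Adj b c := by
  rintro ⟨hne, hcard⟩
  obtain ⟨x, y, hxy, hx, hy, hx', hy'⟩ := Finset.exists_pair_of_card_inter hcard
  exact hne (Subtype.ext (h.block_unique x y hxy _ hb _ hc hx hy hx' hy'))

theorem IsSTS.isBipartite_union (h₁ : IsSTS S₁) (h₂ : IsSTS S₂) :
    (blockIntersectionGraph 2 (S₁ ∪ S₂)).IsBipartite := by
  refine ⟨SimpleGraph.Coloring.mk (fun b => if (b : Finset P) ∈ S₁ then 0 else 1) ?_⟩
  intro b c hbc
  by_cases hb : (b : Finset P) ∈ S₁ <;> by_cases hc : (c : Finset P) ∈ S₁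
  · exact (h₁.not_adj_of_mem hb hc hbc).elim
  · simp [hb, hc]
  · simp [hb, hc]
  · have hb' := (Finset.mem_union.1 b.2).resolve_left hb
    have hc' := (Finset.mem_union.1 c.2).resolve_left hc
    exact (h₂.not_adj_of_mem hb' hc' hbc).elim

theorem IsSTS.adj_union (h₁ : IsSTS S₁) (h₂ : IsSTS S₂) (hd : Disjoint S₁ S₂)
    {b c : {b : Finset P // b ∈ S₁ ∪ S₂}} (hb : (b : Finset P) ∈ S₁) (hc : (c : Finset P) ∈ S₂)
    {x y : P} (hxy : x ≠ y) (hxb : x ∈ (b : Finset P)) (hyb : y ∈ (b : Finset P))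
    (hxc : x ∈ (c : Finset P)) (hyc : y ∈ (c : Finset P)) :
    (blockIntersectionGraph 2 (S₁ ∪ S₂)).Adj b c := by
  have hne : (b : Finset P) ≠ c := fun h => Finset.disjoint_left.1 hd hb (h ▸ hc)
  exact ⟨fun h => hne (congrArg _ h), Finset.card_inter_eq_two_of_triples (h₁.card_block _ hb)
    (h₂.card_block _ hc) hne hxy hxb hyb hxc hyc⟩

/-- A bipartite `2`-block intersection graph splits a twofold triple system into two disjoint
Steiner triple systems. -/
theorem IsTTS.exists_isSTS_union [Fintype P] {v : ℕ} {B : Finset (Finset P)} (hB : IsTTS v B)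
    (hbip : (blockIntersectionGraph 2 B).IsBipartite) :
    ∃ S₁ S₂ : Finset (Finset P), IsSTS S₁ ∧ IsSTS S₂ ∧ Disjoint S₁ S₂ ∧ B = S₁ ∪ S₂ := by
  classical
  obtain ⟨col⟩ := hbip
  let S : Fin 2 → Finset (Finset P) := fun i => B.filter fun b => ∃ h : b ∈ B, col ⟨b, h⟩ = i
  have hmem : ∀ i b, b ∈ S i ↔ ∃ h : b ∈ B, col ⟨b, h⟩ = i := fun i b => by
    simp only [S, Finset.mem_filter]
    exact ⟨fun h => h.2, fun h => ⟨h.1, h⟩⟩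
  -- The two blocks on a pair meet in exactly that pair, so they are adjacent and get different
  -- colours. Hence each colour class covers every pair exactly once.
  have hpair : ∀ x y, x ≠ y → ∃ b c, b ≠ c ∧ ∃ (hb : b ∈ B) (hc : c ∈ B),
      x ∈ b ∧ y ∈ b ∧ x ∈ c ∧ y ∈ c ∧ col ⟨b, hb⟩ ≠ col ⟨c, hc⟩ ∧
      ∀ d ∈ B, x ∈ d → y ∈ d → d = b ∨ d = c := by
    intro x y hxy
    have h2 := hB.card_pair {x, y} (Finset.card_pair hxy)
    obtain ⟨b, c, hbc, he⟩ := Finset.card_eq_two.1 h2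
    have hall : ∀ d, (d ∈ B ∧ x ∈ d ∧ y ∈ d) ↔ d = b ∨ d = c := by
      intro d
      have : d ∈ B.filter (fun b => {x, y} ⊆ b) ↔ d ∈ ({b, c} : Finset (Finset P)) := by rw [he]
      simpa [Finset.insert_subset_iff] using this
    obtain ⟨hb, hxb, hyb⟩ := (hall b).2 (Or.inl rfl)
    obtain ⟨hc, hxc, hyc⟩ := (hall c).2 (Or.inr rfl)
    refine ⟨b, c, hbc, hb, hc, hxb, hyb, hxc, hyc, ?_, fun d hd hx hy => (hall d).1 ⟨hd, hx, hy⟩⟩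
    apply col.valid
    exact ⟨fun h => hbc (congrArg Subtype.val h), Finset.card_inter_eq_two_of_triples
      (hB.card_block b hb) (hB.card_block c hc) hbc hxy hxb hyb hxc hyc⟩
  have hS : ∀ i, IsSTS (S i) := by
    intro i
    refine ⟨fun b hb => ?_, fun x y hxy => ?_, fun x y hxy b hb c hc h1 h2 h3 h4 => ?_⟩
    · exact hB.card_block b ((hmem i b).1 hb).1
    · obtain ⟨b, c, -, hb, hc, h1, h2, h3, h4, hcol, -⟩ := hpair x y hxy
      have : col ⟨b, hb⟩ = i ∨ col ⟨c, hc⟩ = i := by omega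
      rcases this with h | h
      · exact ⟨b, (hmem i b).2 ⟨hb, h⟩, h1, h2⟩
      · exact ⟨c, (hmem i c).2 ⟨hc, h⟩, h3, h4⟩
    · obtain ⟨b', c', -, hb', hc', -, -, -, -, hcol, hall⟩ := hpair x y hxy
      obtain ⟨hbB, hbi⟩ := (hmem i b).1 hb
      obtain ⟨hcB, hci⟩ := (hmem i c).1 hc
      rcases hall b hbB h1 h2 with rfl | rfl <;> rcases hall c hcB h3 h4 with rfl | rfl
      · rfl
      · exact (hcol (hbi.trans hci.symm)).elim
      · exact (hcol (hci.trans hbi.symm)).elim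
      · rfl
  refine ⟨S 0, S 1, hS 0, hS 1, ?_, ?_⟩
  · rw [Finset.disjoint_left]
    intro b h0 h1
    obtain ⟨_, h⟩ := (hmem 0 b).1 h0
    obtain ⟨_, h'⟩ := (hmem 1 b).1 h1
    rw [h] at h'
    exact absurd h' (by decide)
  · ext b
    rw [Finset.mem_union, hmem, hmem]
    constructor
    · intro hb
      have : col ⟨b, hb⟩ = 0 ∨ col ⟨b, hb⟩ = 1 := by omega
      exact this.imp (fun h => ⟨hb, h⟩) fun h => ⟨hb, h⟩
    · rintro (⟨h, _⟩ | ⟨h, _⟩) <;> exact h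

end Union

/-! ### Relabelling of points. -/

section Transport

variable {P Q : Type*} [DecidableEq P] [DecidableEq Q]

/-- The image of a family of blocks under a relabelling of the points. -/
def relabel (e : P ≃ Q) (B : Finset (Finset P)) : Finset (Finset Q) :=
  B.map (Equiv.finsetCongr e).toEmbedding

theorem mem_relabel {e : P ≃ Q} {B : Finset (Finset P)} {c : Finset Q} :
    c ∈ relabel e B ↔ ∃ b ∈ B, b.map e.toEmbedding = c := by
  simp only [relabel, Finset.mem_map, Equiv.coe_toEmbedding, Equiv.finsetCongr_apply]

theorem IsTTS.relabel [Fintype P] [Fintype Q] {v : ℕ} {B : Finset (Finset P)} (h : IsTTS v B)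
    (e : P ≃ Q) : IsTTS v (relabel e B) where
  card_points := by rw [← Fintype.card_congr e]; exact h.card_points
  card_block c hc := by
    obtain ⟨b, hb, rfl⟩ := mem_relabel.1 hc
    rw [Finset.card_map]; exact h.card_block b hb
  card_pair p hp := by
    rw [← h.card_pair (p.map e.symm.toEmbedding) (by rw [Finset.card_map, hp]), _root_.relabel,
      Finset.filter_map, Finset.card_map]
    congr 1
    refine Finset.filter_congr fun b _ => ?_
    simp only [Function.comp_apply, Equiv.coe_toEmbedding, Equiv.finsetCongr_apply]
    constructor
    · intro hs x hx
      obtain ⟨y, hy, rfl⟩ := Finset.mem_map.1 hx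
      obtain ⟨z, hz, hz'⟩ := Finset.mem_map.1 (hs hy)
      simpa [← hz'] using hz
    · intro hs x hx
      exact Finset.mem_map.2 ⟨e.symm x, hs (Finset.mem_map_of_mem _ hx), by simp⟩

/-- Relabelling the points induces an isomorphism of block intersection graphs. -/
def relabelIso (e : P ≃ Q) (i : ℕ) (B : Finset (Finset P)) :
    blockIntersectionGraph i B ≃g blockIntersectionGraph i (relabel e B) where
  toEquiv := (Equiv.finsetCongr e).subtypeEquiv fun b => by
    rw [relabel]
    exact (Finset.mem_map' (Equiv.finsetCongr e).toEmbedding).symm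
  map_rel_iff' := by
    intro b c
    simp only [blockIntersectionGraph, Equiv.subtypeEquiv_apply, Equiv.finsetCongr_apply, ne_eq,
      Finset.map_inj, Subtype.ext_iff, ← Finset.map_inter, Finset.card_map]

theorem SimpleGraph.Iso.isHamiltonian {V W : Type*} [Fintype V] [DecidableEq V] [Fintype W]
    [DecidableEq W] {G : SimpleGraph V} {H : SimpleGraph W} (e : G ≃g H) (h : G.IsHamiltonian) :
    H.IsHamiltonian := by
  intro hc
  obtain ⟨a, p, hp⟩ := h (by rwa [Fintype.card_congr e.toEquiv])
  exact ⟨_, p.map e.toHom, hp.map e.bijective⟩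

theorem relabel_properties [Fintype P] [Fintype Q] {v : ℕ} {B : Finset (Finset P)} (e : P ≃ Q)
    (h : IsTTS v B ∧ (blockIntersectionGraph 2 B).IsBipartite ∧
      (blockIntersectionGraph 2 B).Connected ∧ ¬ (blockIntersectionGraph 2 B).IsHamiltonian) :
    IsTTS v (relabel e B) ∧ (blockIntersectionGraph 2 (relabel e B)).IsBipartite ∧
      (blockIntersectionGraph 2 (relabel e B)).Connected ∧
      ¬ (blockIntersectionGraph 2 (relabel e B)).IsHamiltonian := by
  have i := relabelIso e 2 B
  obtain ⟨h1, h2, h3, h4⟩ := h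
  refine ⟨h1.relabel e, ?_, ?_, fun hc => h4 (i.symm.isHamiltonian hc)⟩
  · exact h2.of_hom i.symm.toHom
  · exact i.connected_iff.1 h3

end Transport

/-! ### Frames and their completion to triple systems. -/

/-- The blocks `b` and `c` share a pair of points. -/
def SharePair {P : Type*} (b c : Finset P) : Prop :=
  ∃ x y, x ≠ y ∧ x ∈ b ∧ y ∈ b ∧ x ∈ c ∧ y ∈ c

/-- `F` is a family of edge-disjoint perfect matchings on `X`, and `T` a family of triangles, which
together partition the edges of the complete graph on `X`. -/
structure IsFrame {J X : Type*} (F : J → X → X) (T : Finset (Finset X)) : Prop where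
  ne : ∀ s x, F s x ≠ x
  invol : ∀ s x, F s (F s x) = x
  inj : ∀ s t x, F s x = F t x → s = t
  card_block : ∀ b ∈ T, b.card = 3
  cover : ∀ x y, x ≠ y → (∃ s, F s x = y) ∨ ∃ b ∈ T, x ∈ b ∧ y ∈ b
  block_unique : ∀ x y, x ≠ y → ∀ b ∈ T, ∀ c ∈ T, x ∈ b → y ∈ b → x ∈ c → y ∈ c → b = c
  not_mem : ∀ b ∈ T, ∀ x ∈ b, ∀ s, F s x ∉ b

theorem IsFrame.reindex {J K X : Type*} {F : J → X → X} {T : Finset (Finset X)}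
    (h : IsFrame F T) (e : K ≃ J) : IsFrame (fun s => F (e s)) T where
  ne s := h.ne (e s)
  invol s := h.invol (e s)
  inj s t x hst := e.injective (h.inj _ _ x hst)
  card_block := h.card_block
  cover x y hxy := (h.cover x y hxy).imp (fun ⟨s, hs⟩ => ⟨e.symm s, by simpa using hs⟩) id
  block_unique := h.block_unique
  not_mem b hb x hx s := h.not_mem b hb x hx (e s)

section Complete

variable {J X : Type*} [DecidableEq J] [DecidableEq X]

/-- The block joining the infinite point `s` to the edge `{x, y}`. -/
def coneBlock (s : J) (x y : X) : Finset (J ⊕ X) := {Sum.inl s, Sum.inr x, Sum.inr y}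

theorem coneBlock_comm (s : J) (x y : X) :
    coneBlock s x y = coneBlock s y x := by
  unfold coneBlock; ext; simp; tauto

@[simp] theorem inl_mem_coneBlock {s t : J} {x y : X} : Sum.inl t ∈ coneBlock s x y ↔ t = s := by
  simp [coneBlock]

@[simp] theorem inr_mem_coneBlock {s : J} {x y z : X} :
    Sum.inr z ∈ coneBlock s x y ↔ z = x ∨ z = y := by
  simp [coneBlock]

variable [Fintype J] [Fintype X]

/-- The triple system on `J ⊕ X` which fills the hole `J` of a frame with the blocks `S`. -/
def complete (S : Finset (Finset J)) (F : J → X → X) (T : Finset (Finset X)) :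
    Finset (Finset (J ⊕ X)) :=
  S.image (fun b => b.map Function.Embedding.inl) ∪
    Finset.univ.image (fun p : J × X => coneBlock p.1 p.2 (F p.1 p.2)) ∪
    T.image (fun b => b.map Function.Embedding.inr)

variable {S : Finset (Finset J)} {F : J → X → X} {T : Finset (Finset X)}

theorem mem_complete {b : Finset (J ⊕ X)} : b ∈ complete S F T ↔
    (∃ c ∈ S, b = c.map Function.Embedding.inl) ∨ (∃ s x, b = coneBlock s x (F s x)) ∨
      ∃ c ∈ T, b = c.map Function.Embedding.inr := by
  simp only [complete, Finset.mem_union, Finset.mem_image, Finset.mem_univ, true_and, Prod.exists,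
    or_assoc, eq_comm (b := b)]

/-- Pairs inside `J` are left to `S`. A mixed pair `s, x` determines the third point `F s x`. A pair
inside `X` is an edge of a unique matching or lies in a unique triangle. -/
theorem IsFrame.isSTS_complete (h : IsFrame F T) (hS : IsSTS S) : IsSTS (complete S F T) where
  card_block b hb := by
    rcases mem_complete.1 hb with ⟨c, hc, rfl⟩ | ⟨s, x, rfl⟩ | ⟨c, hc, rfl⟩
    · rw [Finset.card_map]; exact hS.card_block c hc
    · rw [coneBlock, Finset.card_eq_three]
      exact ⟨_, _, _, by simp, by simp, by simpa using (h.ne s x).symm, rfl⟩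
    · rw [Finset.card_map]; exact h.card_block c hc
  exists_block := by
    rintro (s | x) (t | y) hxy
    · obtain ⟨c, hc, hs, ht⟩ := hS.exists_block s t fun h => hxy (congrArg _ h)
      exact ⟨_, mem_complete.2 (Or.inl ⟨c, hc, rfl⟩), by simpa using hs, by simpa using ht⟩
    · exact ⟨_, mem_complete.2 (Or.inr (Or.inl ⟨s, y, rfl⟩)), by simp, by simp⟩
    · exact ⟨_, mem_complete.2 (Or.inr (Or.inl ⟨t, x, rfl⟩)), by simp, by simp⟩
    · rcases h.cover x y fun h => hxy (congrArg _ h) with ⟨s, rfl⟩ | ⟨c, hc, hx, hy⟩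
      · exact ⟨_, mem_complete.2 (Or.inr (Or.inl ⟨s, x, rfl⟩)), by simp, by simp⟩
      · exact ⟨_, mem_complete.2 (Or.inr (Or.inr ⟨c, hc, rfl⟩)), by simpa using hx,
          by simpa using hy⟩
  block_unique := by
    -- The same cone block is named by either end of its edge.
    have hcone : ∀ s x y, x = y ∨ x = F s y → coneBlock s x (F s x) = coneBlock s y (F s y) := by
      rintro s x y (rfl | rfl)
      · rfl
      · rw [h.invol, coneBlock_comm]
    intro p q hpq b hb c hc hpb hqb hpc hqc
    rw [mem_complete] at hb hc
    rcases hb with ⟨b, hb, rfl⟩ | ⟨s, z, rfl⟩ | ⟨b, hb, rfl⟩ <;>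
    rcases hc with ⟨c, hc, rfl⟩ | ⟨t, w, rfl⟩ | ⟨c, hc, rfl⟩ <;>
    rcases p with p | p <;> rcases q with q | q <;>
    simp only [Finset.mem_map, Function.Embedding.inl_apply, Function.Embedding.inr_apply,
      reduceCtorEq, and_false, exists_false, Sum.inl.injEq, Sum.inr.injEq, exists_eq_right,
      inl_mem_coneBlock, inr_mem_coneBlock] at hpb hqb hpc hqc
    · rw [hS.block_unique p q (fun h => hpq (congrArg _ h)) b hb c hc hpb hqb hpc hqc]
    · exact (hpq (by rw [hpc, hqc])).elim
    · exact (hpq (by rw [hpb, hqb])).elim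
    · exact (hpq (by rw [hpb, hqb])).elim
    · subst hpb; subst hpc
      apply hcone
      rcases hqb with rfl | rfl <;> rcases hqc with rfl | hqc
      · exact Or.inl rfl
      · exact Or.inr hqc
      · exact Or.inr (h.invol _ _).symm
      · left; rw [← h.invol p z, hqc, h.invol]
    · subst hqb; subst hqc
      apply hcone
      rcases hpb with rfl | rfl <;> rcases hpc with rfl | hpc
      · exact Or.inl rfl
      · exact Or.inr hpc
      · exact Or.inr (h.invol _ _).symm
      · left; rw [← h.invol q z, hpc, h.invol]
    · have hq : q ≠ p := fun h => hpq (by rw [h])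
      have key : ∀ r u, (p = u ∨ p = F r u) → (q = u ∨ q = F r u) → F r p = q ∧
          coneBlock r u (F r u) = coneBlock r p (F r p) := by
        rintro r u (rfl | rfl) (rfl | rfl)
        · exact (hq rfl).elim
        · exact ⟨rfl, rfl⟩
        · exact ⟨h.invol _ _, by rw [h.invol, coneBlock_comm]⟩
        · exact (hq rfl).elim
      obtain ⟨h1, h2⟩ := key s z hpb hqb
      obtain ⟨h3, h4⟩ := key t w hpc hqc
      rw [h2, h4, h.inj s t p (h1.trans h3.symm)]
    · rcases hpb with rfl | rfl <;> rcases hqb with rfl | rfl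
      · exact (hpq rfl).elim
      · exact (h.not_mem c hc _ hpc s hqc).elim
      · exact (h.not_mem c hc _ hqc s hpc).elim
      · exact (hpq rfl).elim
    · rcases hpc with rfl | rfl <;> rcases hqc with rfl | rfl
      · exact (hpq rfl).elim
      · exact (h.not_mem b hb _ hpb t hqb).elim
      · exact (h.not_mem b hb _ hqb t hpb).elim
      · exact (hpq rfl).elim
    · rw [h.block_unique p q (fun h => hpq (congrArg _ h)) b hb c hc hpb hqb hpc hqc]

end Complete

/-! ### The Pasch switch. -/

section Pasch

variable {P : Type*} [DecidableEq P]

/-- The system obtained from `S` by switching a Pasch configuration. -/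
def paschSwitch (S : Finset (Finset P)) (a b c x y z : P) : Finset (Finset P) :=
  (S \ {{a, b, c}, {a, y, z}, {b, x, z}, {c, x, y}}) ∪
    {{x, y, z}, {a, b, z}, {a, c, y}, {b, c, x}}

theorem mem_paschSwitch {S : Finset (Finset P)} {a b c x y z : P} {d : Finset P} :
    d ∈ paschSwitch S a b c x y z ↔
      (d ∈ S ∧ d ≠ {a, b, c} ∧ d ≠ {a, y, z} ∧ d ≠ {b, x, z} ∧ d ≠ {c, x, y}) ∨
      d = {x, y, z} ∨ d = {a, b, z} ∨ d = {a, c, y} ∨ d = {b, c, x} := by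
  simp only [paschSwitch, Finset.mem_union, Finset.mem_sdiff, Finset.mem_insert,
    Finset.mem_singleton, not_or, ne_eq]

/-- The four old and the four new blocks cover the same twelve pairs, once each; `hpair` and
`hpair'` are the two inclusions. -/
theorem IsSTS.paschSwitch {S : Finset (Finset P)} (hS : IsSTS S) {a b c x y z : P}
    (hn : [a, b, c, x, y, z].Nodup) (h₁ : {a, b, c} ∈ S) (h₂ : {a, y, z} ∈ S)
    (h₃ : {b, x, z} ∈ S) (h₄ : {c, x, y} ∈ S) : IsSTS (paschSwitch S a b c x y z) := by
  have hd := hn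
  simp only [List.nodup_cons, List.mem_cons, List.not_mem_nil, or_false, not_or, not_false_eq_true,
    List.nodup_nil, and_true] at hd
  obtain ⟨⟨hab, hac, hax, hay, haz⟩, ⟨hbc, hbx, hby, hbz⟩, ⟨hcx, hcy, hcz⟩, ⟨hxy, hxz⟩, hyz⟩ := hd
  have hpair : ∀ p q, p ≠ q →
      (∃ d : Finset P, (d = {x, y, z} ∨ d = {a, b, z} ∨ d = {a, c, y} ∨ d = {b, c, x}) ∧
        p ∈ d ∧ q ∈ d) →
      ∃ d : Finset P, (d = {a, b, c} ∨ d = {a, y, z} ∨ d = {b, x, z} ∨ d = {c, x, y}) ∧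
        p ∈ d ∧ q ∈ d := by
    rintro p q hpq ⟨d, rfl | rfl | rfl | rfl, hp, hq⟩ <;>
    simp only [Finset.mem_insert, Finset.mem_singleton] at hp hq <;>
    simp only [or_and_right, exists_or, exists_eq_left, Finset.mem_insert, Finset.mem_singleton] <;>
    rcases hp with rfl | rfl | rfl <;> rcases hq with rfl | rfl | rfl <;>
    first | exact absurd rfl hpq | simp
  have hpair' : ∀ p q, p ≠ q →
      (∃ d : Finset P, (d = {a, b, c} ∨ d = {a, y, z} ∨ d = {b, x, z} ∨ d = {c, x, y}) ∧
        p ∈ d ∧ q ∈ d) →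
      ∃ d : Finset P, (d = {x, y, z} ∨ d = {a, b, z} ∨ d = {a, c, y} ∨ d = {b, c, x}) ∧
        p ∈ d ∧ q ∈ d := by
    rintro p q hpq ⟨d, rfl | rfl | rfl | rfl, hp, hq⟩ <;>
    simp only [Finset.mem_insert, Finset.mem_singleton] at hp hq <;>
    simp only [or_and_right, exists_or, exists_eq_left, Finset.mem_insert, Finset.mem_singleton] <;>
    rcases hp with rfl | rfl | rfl <;> rcases hq with rfl | rfl | rfl <;>
    first | exact absurd rfl hpq | simp
  have hold : ∀ d : Finset P, (d = {a, b, c} ∨ d = {a, y, z} ∨ d = {b, x, z} ∨ d = {c, x, y}) →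
      d ∈ S := by
    rintro d (rfl | rfl | rfl | rfl) <;> assumption
  have hnew : ∀ p q, p ≠ q → ∀ d e : Finset P,
      (d = {x, y, z} ∨ d = {a, b, z} ∨ d = {a, c, y} ∨ d = {b, c, x}) →
      (e = {x, y, z} ∨ e = {a, b, z} ∨ e = {a, c, y} ∨ e = {b, c, x}) →
      p ∈ d → q ∈ d → p ∈ e → q ∈ e → d = e := by
    rintro p q hpq d e (rfl | rfl | rfl | rfl) (rfl | rfl | rfl | rfl) hp hq hp' hq' <;>
    first
    | rfl
    | (exfalso
       simp only [Finset.mem_insert, Finset.mem_singleton] at hp hq hp' hq'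
       clear hpair hpair' hold hS h₁ h₂ h₃ h₄ hn
       grind)
  refine ⟨fun d hd => ?_, fun p q hpq => ?_, fun p q hpq d hd e he hpd hqd hpe hqe => ?_⟩
  · rcases mem_paschSwitch.1 hd with ⟨h, -⟩ | rfl | rfl | rfl | rfl
    · exact hS.card_block d h
    all_goals
      rw [Finset.card_eq_three]
      exact ⟨_, _, _, by assumption, by assumption, by assumption, rfl⟩
  · obtain ⟨d, hd, hp, hq⟩ := hS.exists_block p q hpq
    by_cases h : d = {a, b, c} ∨ d = {a, y, z} ∨ d = {b, x, z} ∨ d = {c, x, y}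
    · obtain ⟨e, he, hpe, hqe⟩ := hpair' p q hpq ⟨d, h, hp, hq⟩
      exact ⟨e, mem_paschSwitch.2 (Or.inr he), hpe, hqe⟩
    · simp only [not_or] at h
      exact ⟨d, mem_paschSwitch.2 (Or.inl ⟨hd, h⟩), hp, hq⟩
  · have cross : ∀ d e : Finset P,
        (d ∈ S ∧ d ≠ {a, b, c} ∧ d ≠ {a, y, z} ∧ d ≠ {b, x, z} ∧ d ≠ {c, x, y}) →
        (e = {x, y, z} ∨ e = {a, b, z} ∨ e = {a, c, y} ∨ e = {b, c, x}) →
        p ∈ d → q ∈ d → p ∈ e → q ∈ e → False := by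
      rintro d e ⟨hd, h1, h2, h3, h4⟩ he hpd hqd hpe hqe
      obtain ⟨o, ho, hpo, hqo⟩ := hpair p q hpq ⟨e, he, hpe, hqe⟩
      have := hS.block_unique p q hpq d hd o (hold o ho) hpd hqd hpo hqo
      subst this
      tauto
    rcases mem_paschSwitch.1 hd with hd | hd <;> rcases mem_paschSwitch.1 he with he | he
    · exact hS.block_unique p q hpq d hd.1 e he.1 hpd hqd hpe hqe
    · exact (cross d e hd he hpd hqd hpe hqe).elim
    · exact (cross e d he hd hpe hqe hpd hqd).elim
    · exact hnew p q hpq d e hd he hpd hqd hpe hqe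

end Pasch

/-! ### Frame pairs and auxiliary facts for the gluing. -/

/-- Two frames on the same hole, whose matchings agree outside the first and the last index, with
what is needed to complete them to two disjoint triple systems with a connected block intersection
graph after a cyclic shift of the indices of `G`. -/
structure IsFramePair {u : ℕ} {X : Type*} (F G : Fin (u + 1) → X → X)
    (T₁ T₂ : Finset (Finset X)) : Prop where
  left : IsFrame F T₁
  right : IsFrame G T₂
  disjoint : Disjoint T₁ T₂
  common : ∀ s, s ≠ 0 → s ≠ Fin.last u → F s = G s
  -- After the shift the infinite point `0` carries `F 0` in one system and `G (Fin.last u)` in the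
  -- other; this keeps their blocks apart.
  ends : ∀ x, F 0 x ≠ G (Fin.last u) x
  -- Used to link the blocks of the second system at the infinite point `0` to the others.
  zero : ∀ x, ∃ y, (y = x ∨ y = F 0 x ∨ y = G (Fin.last u) x) ∧
    (F 0 y = G 0 y ∨ G (Fin.last u) y = F (Fin.last u) y)
  conn : ∀ x y, Relation.EqvGen (fun x y => ∃ s, s ≠ Fin.last u ∧ y = G s x) x y
  -- An induction principle: every triangle of `T₁` leads, through shared pairs, to one containing
  -- an edge of a matching of `G`.
  descent : ∀ p : Finset X → Prop, (∀ b ∈ T₁, ∀ x ∈ b, ∀ s, G s x ∈ b → p b) →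
    (∀ b ∈ T₁, ∀ c ∈ T₂, ∀ d ∈ T₁, SharePair b c → SharePair d c → p d → p b) → ∀ b ∈ T₁, p b
  back : ∀ c ∈ T₂, ∃ b ∈ T₁, SharePair b c
  -- The new points of the Pasch configuration and the infinite points of its three edges.
  triangle : ∃ x y z a b c, a ≠ 0 ∧ a ≠ Fin.last u ∧ b ≠ 0 ∧ b ≠ Fin.last u ∧ c ≠ 0 ∧
    c ≠ Fin.last u ∧ F a y = z ∧ F b x = z ∧ F c x = y ∧ y ≠ z

namespace Equivalence

theorem chain {r : ℕ → ℕ → Prop} (hr : Equivalence r) {m : ℕ}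
    (h : ∀ i, 1 ≤ i → i < m → r i (i + 1)) : ∀ i j, 1 ≤ i → i ≤ j → j ≤ m → r i j := by
  intro i j hi hij hj
  induction j, hij using Nat.le_induction with
  | base => exact hr.refl i
  | succ k hk ih => exact hr.trans (ih (by omega)) (h k (by omega) (by omega))

/-- Without the links at `a` and `b` the chain falls into three pieces. The middle one, from `a + 1`
to `b`, is tied to the lower piece by `h1` and to the upper piece by `h2`. -/
theorem chain_repair_of_lt {r : ℕ → ℕ → Prop} (hr : Equivalence r) {m a b : ℕ} (hab : a < b)
    (h : ∀ i, 1 ≤ i → i < m → i ≠ a → i ≠ b → r i (i + 1)) (hbm : b < m)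
    (h1 : r a b) (h2 : r (a + 1) (b + 1)) : ∀ i, 1 ≤ i → i < m → r i (i + 1) := by
  have hmid : ∀ j, a + 1 ≤ j → j ≤ b → r (a + 1) j := by
    intro j hj
    induction j, hj using Nat.le_induction with
    | base => exact fun _ => hr.refl _
    | succ k hk ih =>
      intro hkb
      exact hr.trans (ih (by omega)) (h k (by omega) (by omega) (by omega) (by omega))
  have hb := hmid b (by omega) le_rfl
  intro i hi him
  by_cases hia : i = a
  · subst hia
    exact hr.trans h1 (hr.symm hb)
  by_cases hib : i = b
  · subst hib
    exact hr.trans (hr.symm hb) h2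
  exact h i hi him hia hib

theorem chain_repair {r : ℕ → ℕ → Prop} (hr : Equivalence r) {m a b : ℕ} (hab : a ≠ b)
    (h : ∀ i, 1 ≤ i → i < m → i ≠ a → i ≠ b → r i (i + 1)) (ham : a < m) (hbm : b < m)
    (h1 : r a b) (h2 : r (a + 1) (b + 1)) : ∀ i, 1 ≤ i → i < m → r i (i + 1) := by
  rcases lt_or_gt_of_ne hab with hlt | hlt
  · exact chain_repair_of_lt hr hlt h hbm h1 h2
  · exact chain_repair_of_lt hr hlt (fun i h1 h2 h3 h4 => h i h1 h2 h4 h3) ham (hr.symm h1)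
      (hr.symm h2)

end Equivalence

/-- Neighbours of a block of `S₁` lie in `S₂`, and each of its three pairs is in only one block of
`S₂`. -/
theorem IsSTS.ncard_neighborSet_le {P : Type*} [DecidableEq P] {S₁ S₂ : Finset (Finset P)}
    (h₁ : IsSTS S₁) (h₂ : IsSTS S₂) (b : {b : Finset P // b ∈ S₁ ∪ S₂})
    (hb : (b : Finset P) ∈ S₁) :
    ((blockIntersectionGraph 2 (S₁ ∪ S₂)).neighborSet b).ncard ≤ 3 := by
  have hcard : (Finset.powersetCard 2 (b : Finset P)).card = 3 := by
    rw [Finset.card_powersetCard, h₁.card_block _ hb]; rfl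
  rw [← hcard, ← Set.ncard_coe_finset]
  refine Set.ncard_le_ncard_of_injOn (fun c => (b : Finset P) ∩ c) ?_ ?_ (Finset.finite_toSet _)
  · intro c hc
    exact Finset.mem_coe.2 (Finset.mem_powersetCard.2 ⟨Finset.inter_subset_left, hc.2⟩)
  · intro c hc d hd hcd
    have hS : ∀ c ∈ (blockIntersectionGraph 2 (S₁ ∪ S₂)).neighborSet b, (c : Finset P) ∈ S₂ :=
      fun c hc => (Finset.mem_union.1 c.2).resolve_left fun h => h₁.not_adj_of_mem hb h hc
    obtain ⟨x, y, hxy, hxb, hyb, hxc, hyc⟩ := Finset.exists_pair_of_card_inter hc.2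
    have hx : x ∈ (b : Finset P) ∩ d := by
      have : x ∈ (b : Finset P) ∩ c := Finset.mem_inter.2 ⟨hxb, hxc⟩
      have hcd' : (b : Finset P) ∩ c = (b : Finset P) ∩ d := hcd
      rwa [hcd'] at this
    have hy : y ∈ (b : Finset P) ∩ d := by
      have : y ∈ (b : Finset P) ∩ c := Finset.mem_inter.2 ⟨hyb, hyc⟩
      have hcd' : (b : Finset P) ∩ c = (b : Finset P) ∩ d := hcd
      rwa [hcd'] at this
    exact Subtype.ext (h₂.block_unique x y hxy _ (hS c hc) _ (hS d hd) hxc hyc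
      (Finset.mem_inter.1 hx).2 (Finset.mem_inter.1 hy).2)

/-! ### Descent of Hamiltonicity from an extension. -/

section Contract

variable {J X : Type*} [DecidableEq J] [DecidableEq X] {S₁ S₂ : Finset (Finset J)}
  {C R : Finset (Finset (J ⊕ X))} {o : Finset J}

/-- If all blocks of a twofold triple system on `J` but `o` extend to a larger system whose other
blocks meet `J` in at most one point or in a pair of points of `o`, then Hamiltonicity descends. -/
theorem isHamiltonian_of_extension (h₁ : IsSTS S₁) (h₂ : IsSTS S₂)
    (hC : IsSTS C) (hR : IsSTS R) (ho : o ∈ S₁)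
    (hmem : ∀ d ∈ S₁ ∪ S₂, d ≠ o → d.map Function.Embedding.inl ∈ C ∪ R)
    (hnot : o.map Function.Embedding.inl ∉ C ∪ R)
    (hout : ∀ b ∈ C ∪ R, b.toLeft ∉ S₁ ∪ S₂ → ∀ p q, p ≠ q → Sum.inl p ∈ b → Sum.inl q ∈ b →
      b ∈ C ∧ p ∈ o ∧ q ∈ o)
    (hex : ∃ b ∈ C ∪ R, b.toLeft ∉ S₁ ∪ S₂)
    (hn : Nontrivial {b : Finset J // b ∈ S₁ ∪ S₂})
    (hH : (blockIntersectionGraph 2 (C ∪ R)).IsHamiltonian) :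
    (blockIntersectionGraph 2 (S₁ ∪ S₂)).IsHamiltonian := by
  classical
  have hoS : o ∈ S₁ ∪ S₂ := Finset.mem_union_left _ ho
  have hcS : ∀ d ∈ S₁ ∪ S₂, d.card = 3 := fun d hd =>
    (Finset.mem_union.1 hd).elim (h₁.card_block d) (h₂.card_block d)
  have hcB : ∀ b ∈ C ∪ R, b.card = 3 := fun d hd =>
    (Finset.mem_union.1 hd).elim (hC.card_block d) (hR.card_block d)
  have hin : ∀ b ∈ C ∪ R, b.toLeft ∈ S₁ ∪ S₂ → b = b.toLeft.map Function.Embedding.inl := by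
    intro b hb hl
    have h := Finset.card_toLeft_add_card_toRight (u := b)
    rw [hcS _ hl, hcB _ hb] at h
    have hr : b.toRight = ∅ := Finset.card_eq_zero.1 (by omega)
    ext (p | p)
    · simp
    · have : p ∉ b.toRight := by simp [hr]
      simpa using this
  have hleft : ∀ d : Finset J,
      (d.map (Function.Embedding.inl : J ↪ J ⊕ X)).toLeft = d := fun d => by ext; simp
  -- The contraction: old blocks stay, everything else collapses to `o`.
  let f : {b : Finset (J ⊕ X) // b ∈ C ∪ R} → {b : Finset J // b ∈ S₁ ∪ S₂} := fun b =>
    if h : (b : Finset (J ⊕ X)).toLeft ∈ S₁ ∪ S₂ then ⟨_, h⟩ else ⟨o, hoS⟩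
  have hf_in : ∀ b : {b : Finset (J ⊕ X) // b ∈ C ∪ R}, (b : Finset (J ⊕ X)).toLeft ∈ S₁ ∪ S₂ →
      (f b : Finset J) = (b : Finset (J ⊕ X)).toLeft := fun b h => by simp only [f, dif_pos h]
  have hf_out : ∀ b : {b : Finset (J ⊕ X) // b ∈ C ∪ R},
      (b : Finset (J ⊕ X)).toLeft ∉ S₁ ∪ S₂ → f b = ⟨o, hoS⟩ := fun b h => by
    simp only [f, dif_neg h]
  have hf_ne : ∀ b, f b ≠ ⟨o, hoS⟩ → (b : Finset (J ⊕ X)).toLeft ∈ S₁ ∪ S₂ := fun b h => by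
    by_contra hb; exact h (hf_out b hb)
  have hf_o : ∀ b, f b = ⟨o, hoS⟩ → (b : Finset (J ⊕ X)).toLeft ∉ S₁ ∪ S₂ := fun b h hb => by
    have h' : (b : Finset (J ⊕ X)).toLeft = o := by rw [← hf_in b hb, h]
    apply hnot
    rw [← h', ← hin b b.2 hb]
    exact b.2
  have hshare : ∀ b : {b : Finset (J ⊕ X) // b ∈ C ∪ R}, f b ≠ ⟨o, hoS⟩ →
      ∀ c, (blockIntersectionGraph 2 (C ∪ R)).Adj b c →
      ∃ p q, p ≠ q ∧ p ∈ (f b : Finset J) ∧ q ∈ (f b : Finset J) ∧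
        Sum.inl p ∈ (c : Finset (J ⊕ X)) ∧ Sum.inl q ∈ (c : Finset (J ⊕ X)) := by
    intro b hb c hbc
    have hl := hf_ne b hb
    obtain ⟨x, y, hxy, hxb, hyb, hxc, hyc⟩ := Finset.exists_pair_of_card_inter hbc.2
    rw [hin b b.2 hl] at hxb hyb
    obtain ⟨p, hp, rfl⟩ := Finset.mem_map.1 hxb
    obtain ⟨q, hq, rfl⟩ := Finset.mem_map.1 hyb
    rw [← hf_in b hl] at hp hq
    exact ⟨p, q, fun h => hxy (congrArg _ h), hp, hq, hxc, hyc⟩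
  have hadj_o : ∀ b, f b ≠ ⟨o, hoS⟩ → ∀ c, (blockIntersectionGraph 2 (C ∪ R)).Adj b c →
      (blockIntersectionGraph 2 (S₁ ∪ S₂)).Adj (f b) (f c) ∨ f b = f c := by
    intro b hb c hbc
    by_cases hfe : f b = f c
    · exact Or.inr hfe
    left
    obtain ⟨p, q, hpq, hp, hq, hpc, hqc⟩ := hshare b hb c hbc
    have hpqc : p ∈ (f c : Finset J) ∧ q ∈ (f c : Finset J) := by
      by_cases hc : (c : Finset (J ⊕ X)).toLeft ∈ S₁ ∪ S₂
      · rw [hf_in c hc]; simpa using ⟨hpc, hqc⟩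
      · rw [hf_out c hc]; exact (hout c c.2 hc p q hpq hpc hqc).2
    exact ⟨hfe, Finset.card_inter_eq_two_of_triples (hcS _ (f b).2) (hcS _ (f c).2)
      (fun h => hfe (Subtype.ext h)) hpq hp hq hpqc.1 hpqc.2⟩
  have hone : ∀ b c, f b = f c → f b ≠ ⟨o, hoS⟩ → b = c := by
    intro b c hbc hb
    have hb' := hf_ne b hb
    have hc' := hf_ne c (hbc ▸ hb)
    apply Subtype.ext
    rw [hin b b.2 hb', hin c c.2 hc', ← hf_in b hb', ← hf_in c hc', hbc]
  refine hH.of_contraction f ⟨o, hoS⟩ ?_ ?_ hone ?_ (h₁.ncard_neighborSet_le h₂ _ ho)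
  · intro d
    by_cases hdo : (d : Finset J) = o
    · obtain ⟨b, hb, hbl⟩ := hex
      refine ⟨⟨b, hb⟩, ?_⟩
      rw [hf_out _ hbl]
      exact Subtype.ext hdo.symm
    · refine ⟨⟨_, hmem d d.2 hdo⟩, Subtype.ext ?_⟩
      rw [hf_in _ (by rw [hleft]; exact d.2), hleft]
  · intro b c hbc hne
    by_cases hb : f b = ⟨o, hoS⟩
    · have hc : f c ≠ ⟨o, hoS⟩ := fun h => hne (hb.trans h.symm)
      exact ((hadj_o c hc b hbc.symm).resolve_right hne.symm).symm
    · exact (hadj_o b hb c hbc).resolve_right hne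
  -- Two outer neighbours of the old block `f a` both contain the pair `f a ∩ o`. Since `hout` puts
  -- both of them in the single system `C`, they coincide.
  · intro a b c ha hab hac hbc
    by_cases hb : f b = ⟨o, hoS⟩
    · obtain ⟨p, q, hpq, hpa, hqa, hpb, hqb⟩ := hshare a ha b hab
      obtain ⟨r, s, hrs, hra, hsa, hrc, hsc⟩ := hshare a ha c hac
      obtain ⟨hbC, hpo, hqo⟩ := hout b b.2 (hf_o b hb) p q hpq hpb hqb
      obtain ⟨hcC, hro, hso⟩ := hout c c.2 (hf_o c (hbc ▸ hb)) r s hrs hrc hsc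
      have h2 := Finset.card_inter_eq_two_of_triples (hcS _ (f a).2) (hcS _ hoS)
        (fun h => ha (Subtype.ext h)) hpq hpa hqa hpo hqo
      have hpair : ({r, s} : Finset J) = (f a : Finset J) ∩ o :=
        Finset.eq_of_subset_of_card_le (by
          intro t ht
          rcases Finset.mem_insert.1 ht with rfl | ht
          · exact Finset.mem_inter.2 ⟨hra, hro⟩
          · rw [Finset.mem_singleton.1 ht]; exact Finset.mem_inter.2 ⟨hsa, hso⟩)
          (by rw [h2, Finset.card_pair hrs])
      have hsub : ∀ t, t ∈ (f a : Finset J) ∩ o → Sum.inl t ∈ (c : Finset (J ⊕ X)) := by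
        intro t ht
        rw [← hpair] at ht
        rcases Finset.mem_insert.1 ht with rfl | ht
        · exact hrc
        · rw [Finset.mem_singleton.1 ht]; exact hsc
      exact Subtype.ext (hC.block_unique _ _ (fun h => hpq (Sum.inl_injective h)) _ hbC _ hcC
        hpb hqb (hsub p (Finset.mem_inter.2 ⟨hpa, hpo⟩)) (hsub q (Finset.mem_inter.2 ⟨hqa, hqo⟩)))
    · exact hone b c hbc hb

end Contract

/-! ### Gluing a frame pair onto two disjoint Steiner triple systems. -/

section Glue

variable {u : ℕ} {X : Type*} {F G : Fin (u + 1) → X → X}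
  {T₁ T₂ : Finset (Finset X)}

/-- Either `F s` or `G (s - 1)` can be moved to the other frame by `common`, where different indices
never agree; the exception `s = 0` is `ends`. For `s = Fin.last u`, the bound `2 ≤ u` makes `s - 1`
an inner index. -/
theorem IsFramePair.ne_shift (hP : IsFramePair F G T₁ T₂) (hu : 2 ≤ u) (s : Fin (u + 1)) (x : X) :
    F s x ≠ G (s - 1) x := by
  obtain ⟨k, rfl⟩ := Nat.exists_eq_add_of_le' hu
  have h1 : (1 : Fin (k + 2 + 1)) ≠ 0 := by simp
  have hs : s ≠ s - 1 := fun h => h1 (by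
    have := congrArg (fun t => s - t) h
    simpa using this.symm)
  have h0 : (0 : Fin (k + 2 + 1)) - 1 = Fin.last (k + 2) := by
    rw [sub_eq_iff_eq_add]; simp
  by_cases hs0 : s = 0
  · subst hs0; rw [h0]; exact hP.ends x
  by_cases hsl : s = Fin.last (k + 2)
  · have h3 : s - 1 ≠ 0 := by
      intro h
      rw [sub_eq_zero] at h
      have := congrArg Fin.val (hsl.symm.trans h)
      simp at this
    have h4 : s - 1 ≠ Fin.last (k + 2) := fun h => hs (hsl.trans h.symm)
    rw [← hP.common _ h3 h4]
    exact fun h => hs (hP.left.inj _ _ x h)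
  · rw [hP.common s hs0 hsl]
    exact fun h => hs (hP.right.inj _ _ x h)

set_option maxHeartbeats 2000000 in
/-- Gluing a frame pair onto two disjoint Steiner triple systems on the hole, the block
`{a, b, c}` being switched away. -/
theorem IsFramePair.glue [Fintype X] [DecidableEq X] (hP : IsFramePair F G T₁ T₂) (hu : 2 ≤ u)
    {S₁ S₂ : Finset (Finset (Fin (u + 1)))} (h₁ : IsSTS S₁) (h₂ : IsSTS S₂)
    (hd : Disjoint S₁ S₂) {a b c : Fin (u + 1)} {x y z : X} (ha0 : a ≠ 0) (hal : a ≠ Fin.last u)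
    (hb0 : b ≠ 0) (hbl : b ≠ Fin.last u) (hc0 : c ≠ 0) (hcl : c ≠ Fin.last u)
    (hayz : F a y = z) (hbxz : F b x = z) (hcxy : F c x = y) (hyz : y ≠ z)
    (habc : {a, b, c} ∈ S₁)
    (hconn : (blockIntersectionGraph 2 (S₁ ∪ S₂)).Connected)
    (hham : ¬ (blockIntersectionGraph 2 (S₁ ∪ S₂)).IsHamiltonian) :
    ∃ B : Finset (Finset (Fin (u + 1) ⊕ X)), IsTTS (u + 1 + Fintype.card X) B ∧
      (blockIntersectionGraph 2 B).IsBipartite ∧ (blockIntersectionGraph 2 B).Connected ∧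
      ¬ (blockIntersectionGraph 2 B).IsHamiltonian := by
  classical
  have hFG : ∀ s, s ≠ 0 → s ≠ Fin.last u → ∀ w, G s w = F s w := fun s h h' w => by
    rw [hP.common s h h']
  have hxy : x ≠ y := fun h => hP.left.ne c x (hcxy.trans h.symm)
  have hxz : x ≠ z := fun h => hP.left.ne b x (hbxz.trans h.symm)
  have hazy : F a z = y := by rw [← hayz, hP.left.invol]
  have hbzx : F b z = x := by rw [← hbxz, hP.left.invol]
  have hcyx : F c y = x := by rw [← hcxy, hP.left.invol]
  have hab : a ≠ b := fun h => hxy (by rw [← hbzx, ← h, hazy])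
  have hac : a ≠ c := fun h => hxz (by rw [← hcyx, ← h, hayz])
  have hbc : b ≠ c := fun h => hyz (by rw [← hcxy, ← h, hbxz])
  -- the two triple systems before the switch
  set R₁ := complete S₁ F T₁ with hR₁
  set R₂ := complete S₂ (fun s => G (s - 1)) T₂ with hR₂
  have hSR₁ : IsSTS R₁ := hP.left.isSTS_complete h₁
  have hSR₂ : IsSTS R₂ := (hP.right.reindex (Equiv.subRight 1)).isSTS_complete h₂
  have eqabc : ({Sum.inl a, Sum.inl b, Sum.inl c} : Finset (Fin (u + 1) ⊕ X)) =
      ({a, b, c} : Finset (Fin (u + 1))).map Function.Embedding.inl := by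
    simp [Finset.map_insert]
  have eqc : ∀ (s : Fin (u + 1)) (v w : X),
      ({Sum.inl s, Sum.inr v, Sum.inr w} : Finset (Fin (u + 1) ⊕ X)) = coneBlock s v w :=
    fun _ _ _ => rfl
  have hold₁ : ({Sum.inl a, Sum.inl b, Sum.inl c} : Finset (Fin (u + 1) ⊕ X)) ∈ R₁ := by
    rw [eqabc]; exact mem_complete.2 (Or.inl ⟨_, habc, rfl⟩)
  have hM₁ : ∀ s w, coneBlock s w (F s w) ∈ R₁ := fun s w =>
    mem_complete.2 (Or.inr (Or.inl ⟨s, w, rfl⟩))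
  set C := paschSwitch R₁ (Sum.inl a) (Sum.inl b) (Sum.inl c) (Sum.inr x) (Sum.inr y)
    (Sum.inr z) with hC
  have hSC : IsSTS C := by
    refine hSR₁.paschSwitch ?_ hold₁ ?_ ?_ ?_
    · simp [hab, hac, hbc, hxy, hxz, hyz]
    · rw [eqc, ← hayz]; exact hM₁ a y
    · rw [eqc, ← hbxz]; exact hM₁ b x
    · rw [eqc, ← hcxy]; exact hM₁ c x
  have hCmem : ∀ {d}, d ∈ C ↔ (d ∈ R₁ ∧
      d ≠ ({a, b, c} : Finset (Fin (u + 1))).map Function.Embedding.inl ∧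
      d ≠ coneBlock a y z ∧ d ≠ coneBlock b x z ∧ d ≠ coneBlock c x y) ∨
      d = {Sum.inr x, Sum.inr y, Sum.inr z} ∨ d = {Sum.inl a, Sum.inl b, Sum.inr z} ∨
      d = {Sum.inl a, Sum.inl c, Sum.inr y} ∨ d = {Sum.inl b, Sum.inl c, Sum.inr x} := by
    intro d
    rw [hC, mem_paschSwitch, eqabc, eqc, eqc, eqc]
  have hxyz : ({Sum.inr x, Sum.inr y, Sum.inr z} : Finset (Fin (u + 1) ⊕ X)) ∈ C :=
    hCmem.2 (Or.inr (Or.inl rfl))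
  have habz : ({Sum.inl a, Sum.inl b, Sum.inr z} : Finset (Fin (u + 1) ⊕ X)) ∈ C :=
    hCmem.2 (Or.inr (Or.inr (Or.inl rfl)))
  have hacy : ({Sum.inl a, Sum.inl c, Sum.inr y} : Finset (Fin (u + 1) ⊕ X)) ∈ C :=
    hCmem.2 (Or.inr (Or.inr (Or.inr (Or.inl rfl))))
  have hbcx : ({Sum.inl b, Sum.inl c, Sum.inr x} : Finset (Fin (u + 1) ⊕ X)) ∈ C :=
    hCmem.2 (Or.inr (Or.inr (Or.inr (Or.inr rfl))))
  -- blocks of the switched system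
  have hU₁ : ∀ d ∈ S₁, d ≠ {a, b, c} → d.map Function.Embedding.inl ∈ C := by
    intro d hdS hne
    refine hCmem.2 (Or.inl ⟨mem_complete.2 (Or.inl ⟨d, hdS, rfl⟩), ?_, ?_, ?_, ?_⟩)
    · exact fun h => hne (Finset.map_injective _ h)
    all_goals
      intro h
      have h' := Finset.ext_iff.1 h (Sum.inr x)
      have h'' := Finset.ext_iff.1 h (Sum.inr y)
      simp at h' h''
      try simp_all
  have hU₂ : ∀ d ∈ S₂, d.map Function.Embedding.inl ∈ R₂ := fun d hdS =>
    mem_complete.2 (Or.inl ⟨d, hdS, rfl⟩)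
  -- The cone blocks surviving the switch; each of the three lost ones is excluded under both ends
  -- of its edge.
  have hM : ∀ s w, ¬ (s = a ∧ (w = y ∨ w = z)) → ¬ (s = b ∧ (w = x ∨ w = z)) →
      ¬ (s = c ∧ (w = x ∨ w = y)) → coneBlock s w (F s w) ∈ C := by
    intro s w h1 h2 h3
    refine hCmem.2 (Or.inl ⟨hM₁ s w, ?_, ?_, ?_, ?_⟩)
    · intro h
      have h' := Finset.ext_iff.1 h (Sum.inr w)
      simp at h'
    · intro h
      have e1 := Finset.ext_iff.1 h (Sum.inl s)
      have e2 := Finset.ext_iff.1 h (Sum.inr w)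
      simp only [inl_mem_coneBlock, inr_mem_coneBlock, true_or, true_iff] at e1 e2
      exact h1 ⟨e1, e2⟩
    · intro h
      have e1 := Finset.ext_iff.1 h (Sum.inl s)
      have e2 := Finset.ext_iff.1 h (Sum.inr w)
      simp only [inl_mem_coneBlock, inr_mem_coneBlock, true_or, true_iff] at e1 e2
      exact h2 ⟨e1, e2⟩
    · intro h
      have e1 := Finset.ext_iff.1 h (Sum.inl s)
      have e2 := Finset.ext_iff.1 h (Sum.inr w)
      simp only [inl_mem_coneBlock, inr_mem_coneBlock, true_or, true_iff] at e1 e2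
      exact h3 ⟨e1, e2⟩
  have hM' : ∀ s w, s ≠ a → s ≠ b → s ≠ c → coneBlock s w (F s w) ∈ C := fun s w h1 h2 h3 =>
    hM s w (fun h => h1 h.1) (fun h => h2 h.1) fun h => h3 h.1
  have hN : ∀ s w, coneBlock s w (G (s - 1) w) ∈ R₂ := fun s w =>
    mem_complete.2 (Or.inr (Or.inl ⟨s, w, rfl⟩))
  have hN' : ∀ s w, coneBlock (s + 1) w (G s w) ∈ R₂ := fun s w => by
    have := hN (s + 1) w
    rwa [add_sub_cancel_right] at this
  have hT₁ : ∀ d ∈ T₁, d.map Function.Embedding.inr ∈ C := by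
    intro d hdT
    refine hCmem.2 (Or.inl ⟨mem_complete.2 (Or.inr (Or.inr ⟨d, hdT, rfl⟩)), ?_, ?_, ?_, ?_⟩)
    · intro h
      have h' := Finset.ext_iff.1 h (Sum.inl a)
      simp at h'
    · intro h
      have h' := Finset.ext_iff.1 h (Sum.inl a)
      simp at h'
    · intro h
      have h' := Finset.ext_iff.1 h (Sum.inl b)
      simp at h'
    · intro h
      have h' := Finset.ext_iff.1 h (Sum.inl c)
      simp at h'
  have hT₂ : ∀ d ∈ T₂, d.map Function.Embedding.inr ∈ R₂ := fun d hdT =>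
    mem_complete.2 (Or.inr (Or.inr ⟨d, hdT, rfl⟩))
  have hCcases : ∀ d ∈ C, (∃ e ∈ S₁, e ≠ {a, b, c} ∧ d = e.map Function.Embedding.inl) ∨
      (∃ s w, d = coneBlock s w (F s w)) ∨ (∃ e ∈ T₁, d = e.map Function.Embedding.inr) ∨
      d = {Sum.inr x, Sum.inr y, Sum.inr z} ∨ d = {Sum.inl a, Sum.inl b, Sum.inr z} ∨
      d = {Sum.inl a, Sum.inl c, Sum.inr y} ∨ d = {Sum.inl b, Sum.inl c, Sum.inr x} := by
    intro d hdC
    rcases hCmem.1 hdC with ⟨h, hne, -⟩ | h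
    · rcases mem_complete.1 h with ⟨e, he, rfl⟩ | h | h
      · exact Or.inl ⟨e, he, fun h => hne (by rw [h]), rfl⟩
      · exact Or.inr (Or.inl h)
      · exact Or.inr (Or.inr (Or.inl h))
    · exact Or.inr (Or.inr (Or.inr h))
  have hne_shift : ∀ s w, F s w ≠ G (s - 1) w := hP.ne_shift hu
  -- disjointness
  have hdisj : Disjoint C R₂ := by
    rw [Finset.disjoint_left]
    intro d hdC hdR
    rcases hCcases d hdC with ⟨e, he, -, rfl⟩ | ⟨s, w, rfl⟩ | ⟨e, he, rfl⟩ | rfl | rfl | rfl | rfl <;>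
    rcases mem_complete.1 hdR with ⟨e', he', h⟩ | ⟨t, v, h⟩ | ⟨e', he', h⟩
    · rw [Finset.map_injective _ h] at he
      exact Finset.disjoint_left.1 hd he he'
    · have h' := Finset.ext_iff.1 h (Sum.inr v); simp at h'
    · have h3 := h₁.card_block e he
      obtain ⟨p, hp⟩ := Finset.card_pos.1 (h3 ▸ (by norm_num : 0 < 3))
      have h' := Finset.ext_iff.1 h (Sum.inl p); simp [hp] at h'
    · have h' := Finset.ext_iff.1 h (Sum.inr w); simp at h'
    · have e1 := Finset.ext_iff.1 h (Sum.inl s)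
      have e2 := Finset.ext_iff.1 h (Sum.inr w)
      have e3 := Finset.ext_iff.1 h (Sum.inr (F s w))
      simp only [inl_mem_coneBlock, inr_mem_coneBlock, true_or, or_true, true_iff] at e1 e2 e3
      subst e1
      rcases e2 with rfl | e2
      · exact e3.elim (hP.left.ne s w) (hne_shift s w)
      · rcases e3 with e3 | e3
        · apply hne_shift s w
          rw [e3, e2, hP.right.invol]
        · exact hP.left.ne s w (e3.trans e2.symm)
    · have h' := Finset.ext_iff.1 h (Sum.inl s); simp at h'
    · have h3 := hP.left.card_block e he
      obtain ⟨p, hp⟩ := Finset.card_pos.1 (h3 ▸ (by norm_num : 0 < 3))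
      have h' := Finset.ext_iff.1 h (Sum.inr p); simp [hp] at h'
    · have h' := Finset.ext_iff.1 h (Sum.inl t); simp at h'
    · rw [Finset.map_injective _ h] at he
      exact Finset.disjoint_left.1 hP.disjoint he he'
    · have h' := Finset.ext_iff.1 h (Sum.inr x); simp at h'
    · have h' := Finset.ext_iff.1 h (Sum.inl t); simp at h'
    · have hy' := Finset.ext_iff.1 h (Sum.inr y)
      have hz' := Finset.ext_iff.1 h (Sum.inr z)
      simp at hy' hz'
      refine hP.right.not_mem e' he' y hy' a ?_
      rw [hFG a ha0 hal, hayz]; exact hz'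
    · have h' := Finset.ext_iff.1 h (Sum.inr z); simp at h'
    · have e1 := Finset.ext_iff.1 h (Sum.inl a)
      have e2 := Finset.ext_iff.1 h (Sum.inl b)
      simp at e1 e2
      exact hab (e1.trans e2.symm)
    · have h' := Finset.ext_iff.1 h (Sum.inl a); simp at h'
    · have h' := Finset.ext_iff.1 h (Sum.inr y); simp at h'
    · have e1 := Finset.ext_iff.1 h (Sum.inl a)
      have e2 := Finset.ext_iff.1 h (Sum.inl c)
      simp at e1 e2
      exact hac (e1.trans e2.symm)
    · have h' := Finset.ext_iff.1 h (Sum.inl a); simp at h'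
    · have h' := Finset.ext_iff.1 h (Sum.inr x); simp at h'
    · have e1 := Finset.ext_iff.1 h (Sum.inl b)
      have e2 := Finset.ext_iff.1 h (Sum.inl c)
      simp at e1 e2
      exact hbc (e1.trans e2.symm)
    · have h' := Finset.ext_iff.1 h (Sum.inl b); simp at h'
  refine ⟨C ∪ R₂, hSC.isTTS_union hSR₂ hdisj (by simp), hSC.isBipartite_union hSR₂, ?_, ?_⟩
  · -- connectedness
    -- Connectedness is proved for a relation on arbitrary finite sets, which avoids carrying
    -- membership proofs; `toReach` returns to the graph.
    let Link : Finset (Fin (u + 1) ⊕ X) → Finset (Fin (u + 1) ⊕ X) → Prop := fun d e =>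
      d ∈ C ∧ e ∈ R₂ ∧ SharePair d e
    let E := Relation.EqvGen Link
    have hE : Equivalence E := Relation.EqvGen.is_equivalence Link
    have link : ∀ {d e}, d ∈ C → e ∈ R₂ → ∀ p q, p ≠ q → p ∈ d → q ∈ d → p ∈ e → q ∈ e → E d e :=
      fun hd he p q hpq h1 h2 h3 h4 => Relation.EqvGen.rel _ _ ⟨hd, he, p, q, hpq, h1, h2, h3, h4⟩
    let N : Fin (u + 1) → X → Finset (Fin (u + 1) ⊕ X) := fun s w => coneBlock s w (G (s - 1) w)
    have N_succ : ∀ s w, N (s + 1) w = coneBlock (s + 1) w (G s w) := fun s w => by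
      simp only [N, add_sub_cancel_right]
    have hNR : ∀ s w, N s w ∈ R₂ := hN
    -- a block of the first system meeting `N s w` and `N t w`
    have two : ∀ {d} s t w, d ∈ C → (∃ p, p ≠ Sum.inr w ∧ p ∈ d ∧ p ∈ N s w) →
        (∃ p, p ≠ Sum.inr w ∧ p ∈ d ∧ p ∈ N t w) → Sum.inr w ∈ d → E (N s w) (N t w) := by
      rintro d s t w hdC ⟨p, hp, hpd, hpN⟩ ⟨q, hq, hqd, hqN⟩ hw
      exact hE.trans (hE.symm (link hdC (hNR s w) p _ hp hpd hw hpN (by simp [N])))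
        (link hdC (hNR t w) q _ hq hqd hw hqN (by simp [N]))
    -- The block on `s, w, F s w` shares `s, w` with `N s w`, and shares `w, F s w = w, G s w` with
    -- `N (s + 1) w`: the effect of the shift.
    have step : ∀ s w, coneBlock s w (F s w) ∈ C → s ≠ 0 → s ≠ Fin.last u →
        E (N s w) (N (s + 1) w) := by
      intro s w hmem h0 hl
      refine two s (s + 1) w hmem ⟨Sum.inl s, by simp, by simp, by simp [N]⟩
        ⟨Sum.inr (F s w), by simpa using hP.left.ne s w, by simp, ?_⟩ (by simp)
      rw [N_succ, hFG s h0 hl]; simp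
    have infl : ∀ s t w, s ≠ t → ({Sum.inl s, Sum.inl t, Sum.inr w} : Finset (Fin (u + 1) ⊕ X)) ∈ C →
        E (N s w) (N t w) := by
      intro s t w _ hmem
      exact two s t w hmem ⟨Sum.inl s, by simp, by simp, by simp [N]⟩
        ⟨Sum.inl t, by simp, by simp, by simp [N]⟩ (by simp)
    have fin : ∀ s t w v r, s ≠ 0 → s ≠ Fin.last u → t ≠ 0 → t ≠ Fin.last u → F s w = v →
        F t w = r → v ≠ w → r ≠ w → ({Sum.inr x, Sum.inr y, Sum.inr z} : Finset (Fin (u + 1) ⊕ X)) =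
          {Sum.inr w, Sum.inr v, Sum.inr r} → E (N (s + 1) w) (N (t + 1) w) := by
      intro s t w v r hs0 hsl ht0 htl hv hr hvw hrw heq
      rw [heq] at hxyz
      refine two (s + 1) (t + 1) w hxyz ⟨Sum.inr v, by simpa using hvw, by simp, ?_⟩
        ⟨Sum.inr r, by simpa using hrw, by simp, ?_⟩ (by simp)
      · rw [N_succ, hFG s hs0 hsl, hv]; simp
      · rw [N_succ, hFG t ht0 htl, hr]; simp
    have hval : ∀ i : ℕ, 1 ≤ i → i < u → (Fin.ofNat (u + 1) i ≠ 0 ∧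
        Fin.ofNat (u + 1) i ≠ Fin.last u) := by
      intro i h1 h2
      constructor <;> intro h <;> have := congrArg Fin.val h <;>
      simp [Fin.ofNat, Nat.mod_eq_of_lt (show i < u + 1 by omega)] at this <;> omega
    have hsucc : ∀ i : ℕ, Fin.ofNat (u + 1) (i + 1) = Fin.ofNat (u + 1) i + 1 := by
      intro i
      apply Fin.ext; simp [Fin.ofNat, Fin.val_add, Nat.add_mod]
    have hof : ∀ s : Fin (u + 1), Fin.ofNat (u + 1) (s : ℕ) = s := fun s => by
      apply Fin.ext; simp [Fin.ofNat, Nat.mod_eq_of_lt s.2]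
    have hlt : ∀ s : Fin (u + 1), s ≠ Fin.last u → (s : ℕ) < u := fun s hs => by
      have h1 := s.2
      have h2 : (s : ℕ) ≠ u := fun h => hs (Fin.ext h)
      omega
    let r : X → ℕ → ℕ → Prop := fun w i j => E (N (Fin.ofNat (u + 1) i) w) (N (Fin.ofNat (u + 1) j) w)
    have hr : ∀ w, Equivalence (r w) := fun w =>
      ⟨fun _ => hE.refl _, fun h => hE.symm h, fun h h' => hE.trans h h'⟩
    -- At each of `x, y, z` the switch destroys two steps, `s` and `t`. A block such as `abz` joins
    -- `N s w` to `N t w`, while `xyz` joins `N (s + 1) w` to `N (t + 1) w`, and `chain_repair`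
    -- applies.
    have special : ∀ s t w, s ≠ t → s ≠ 0 → s ≠ Fin.last u → t ≠ 0 → t ≠ Fin.last u →
        (∀ p, p ≠ s → p ≠ t → coneBlock p w (F p w) ∈ C) → E (N s w) (N t w) →
        E (N (s + 1) w) (N (t + 1) w) → ∀ i, 1 ≤ i → i < u → r w i (i + 1) := by
      intro s t w hst hs0 hsl ht0 htl hp h1 h2
      refine Equivalence.chain_repair (hr w) (a := (s : ℕ)) (b := (t : ℕ))
        (fun h => hst (Fin.ext h)) ?_ (hlt s hsl) (hlt t htl) ?_ ?_
      · intro i hi1 hiu his hit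
        have hi : (Fin.ofNat (u + 1) i : ℕ) = i := by
          simp [Fin.ofNat, Nat.mod_eq_of_lt (show i < u + 1 by omega)]
        simp only [r, hsucc]
        exact step _ w (hp _ (fun h => his (by rw [← h, hi])) fun h => hit (by rw [← h, hi]))
          (hval i hi1 hiu).1 (hval i hi1 hiu).2
      · simpa only [r, hof] using h1
      · simpa only [r, hsucc, hof] using h2
    have steps : ∀ w i, 1 ≤ i → i < u → r w i (i + 1) := by
      intro w
      by_cases hwx : w = x
      · subst hwx
        refine special b c w hbc hb0 hbl hc0 hcl (fun p h1 h2 => ?_) (infl b c w hbc hbcx)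
          (fin b c w z y hb0 hbl hc0 hcl hbxz hcxy hxz.symm hxy.symm ?_)
        · exact hM p w (fun h => h.2.elim hxy hxz) (fun h => h1 h.1) fun h => h2 h.1
        · ext q; simp; tauto
      by_cases hwy : w = y
      · subst hwy
        refine special a c w hac ha0 hal hc0 hcl (fun p h1 h2 => ?_) (infl a c w hac hacy)
          (fin a c w z x ha0 hal hc0 hcl hayz hcyx hyz.symm hxy ?_)
        · exact hM p w (fun h => h1 h.1) (fun h => h.2.elim hwx hyz) fun h => h2 h.1
        · ext q; simp; tauto
      by_cases hwz : w = z
      · subst hwz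
        refine special a b w hab ha0 hal hb0 hbl (fun p h1 h2 => ?_) (infl a b w hab habz)
          (fin a b w y x ha0 hal hb0 hbl hazy hbzx hyz hxz ?_)
        · exact hM p w (fun h => h1 h.1) (fun h => h2 h.1) fun h => h.2.elim hwx hwy
        · ext q; simp; tauto
      intro i h1 h2
      simp only [r, hsucc]
      exact step _ w (hM _ w (fun h => h.2.elim hwy hwz) (fun h => h.2.elim hwx hwz)
        fun h => h.2.elim hwx hwy) (hval i h1 h2).1 (hval i h1 h2).2
    have same : ∀ w s, s ≠ 0 → E (N 1 w) (N s w) := by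
      intro w s hs
      have h := Equivalence.chain (hr w) (steps w) 1 (s : ℕ) le_rfl
        (Nat.one_le_iff_ne_zero.2 fun h => hs (Fin.ext h)) (by have := s.2; omega)
      have h1 : Fin.ofNat (u + 1) 1 = 1 := rfl
      simpa only [r, hof, h1] using h
    -- A cone block belongs to both ends of its edge, so the chain at `w` meets the chain at `G s
    -- w`.
    have N_swap : ∀ s w, N s w = N s (G (s - 1) w) := fun s w => by
      simp only [N]
      rw [hP.right.invol, coneBlock_comm]
    have conn1 : ∀ w v, E (N 1 w) (N 1 v) := by
      intro w v
      induction hP.conn w v with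
      | rel w v h =>
        obtain ⟨s, hs, rfl⟩ := h
        have hs1 : s + 1 ≠ 0 := fun h => hs (by
          rw [← eq_neg_iff_add_eq_zero] at h
          rw [h, neg_eq_iff_add_eq_zero]; simp [add_comm])
        have h1 := same w (s + 1) hs1
        rw [N_swap (s + 1) w, add_sub_cancel_right] at h1
        have h2 := same (G s w) (s + 1) hs1
        exact hE.trans h1 (hE.symm h2)
      | refl w => exact hE.refl _
      | symm _ _ _ ih => exact hE.symm ih
      | trans _ _ _ _ _ ih1 ih2 => exact hE.trans ih1 ih2
    have conn2 : ∀ w v s, s ≠ 0 → E (N 1 w) (N s v) := fun w v s hs =>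
      hE.trans (conn1 w v) (same v s hs)
    have h1ne : (1 : Fin (u + 1)) ≠ 0 := (hval 1 le_rfl (by omega)).1
    have hlast0 : Fin.last u ≠ 0 := fun h => by
      have := congrArg Fin.val h
      simp at this; omega
    have hzero1 : (0 : Fin (u + 1)) - 1 = Fin.last u := by
      rw [sub_eq_iff_eq_add]; simp
    -- Index `0` is not on the chain from `1` to `Fin.last u`; a point `t` supplied by `zero`
    -- attaches it to `N 1 t` or to `N (Fin.last u) t`.
    have conn0 : ∀ w v, E (N 1 w) (N 0 v) := by
      intro w v
      obtain ⟨t, ht, h⟩ := hP.zero v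
      have ht' : E (N 0 t) (N 0 v) := by
        rcases ht with rfl | rfl | rfl
        · exact hE.refl _
        · have hmem := hM' 0 v ha0.symm hb0.symm hc0.symm
          refine hE.trans (hE.symm (link hmem (hNR 0 (F 0 v)) (Sum.inl 0) (Sum.inr (F 0 v))
            (by simp) (by simp) (by simp) (by simp [N]) (by simp [N])))
            (link hmem (hNR 0 v) (Sum.inl 0) (Sum.inr v)
            (by simp) (by simp) (by simp) (by simp [N]) (by simp [N]))
        · rw [N_swap 0 v, hzero1]; exact hE.refl _
      refine hE.trans ?_ ht'
      rcases h with h | h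
      · refine hE.trans (conn2 w t 1 h1ne) (two 1 0 t (hM' 0 t ha0.symm hb0.symm hc0.symm)
          ⟨Sum.inr (F 0 t), by simpa using hP.left.ne 0 t, by simp, ?_⟩
          ⟨Sum.inl 0, by simp, by simp, by simp [N]⟩ (by simp))
        simp [N, h]
      · refine hE.trans (conn2 w t _ hlast0) (two (Fin.last u) 0 t
          (hM' (Fin.last u) t hal.symm hbl.symm hcl.symm)
          ⟨Sum.inl (Fin.last u), by simp, by simp, by simp [N]⟩
          ⟨Sum.inr (F (Fin.last u) t), by simpa using hP.left.ne _ t, by simp, ?_⟩ (by simp))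
        simp [N, hzero1, h]
    have connN : ∀ s w, E (N 1 x) (N s w) := by
      intro s w
      by_cases hs : s = 0
      · subst hs; exact conn0 x w
      · exact conn2 x w s hs
    have connC : ∀ d ∈ C, ∀ s w, Sum.inl s ∈ d → Sum.inr w ∈ d → E (N 1 x) d := by
      intro d hdC s w h1 h2
      exact hE.trans (connN s w) (hE.symm (link hdC (hNR s w) _ _ (by simp) h1 h2 (by simp [N])
        (by simp [N])))
    have connT₁ : ∀ d ∈ T₁, E (N 1 x) (d.map Function.Embedding.inr) := by
      refine hP.descent (fun d => E (N 1 x) (d.map Function.Embedding.inr)) ?_ ?_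
      · intro d hdT w hw s hs
        refine hE.trans (connN (s + 1) w) (hE.symm (link (hT₁ d hdT) (hNR (s + 1) w) (Sum.inr w)
          (Sum.inr (G s w)) ?_ (by simpa using hw) (by simpa using hs) ?_ ?_))
        · simpa using (hP.right.ne s w).symm
        · simp [N]
        · rw [N_succ]; simp
      · rintro d hdT e heT d' hdT' ⟨p, q, hpq, h1, h2, h3, h4⟩ ⟨p', q', hpq', h1', h2', h3', h4'⟩ h
        refine hE.trans h (hE.trans (link (hT₁ d' hdT') (hT₂ e heT) (Sum.inr p') (Sum.inr q') ?_ ?_ ?_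
          ?_ ?_) (hE.symm (link (hT₁ d hdT) (hT₂ e heT) (Sum.inr p) (Sum.inr q) ?_ ?_ ?_ ?_ ?_))) <;>
        simpa
    have connT₂ : ∀ e ∈ T₂, E (N 1 x) (e.map Function.Embedding.inr) := by
      intro e heT
      obtain ⟨d, hdT, p, q, hpq, h1, h2, h3, h4⟩ := hP.back e heT
      refine hE.trans (connT₁ d hdT) (link (hT₁ d hdT) (hT₂ e heT) (Sum.inr p) (Sum.inr q)
        ?_ ?_ ?_ ?_ ?_) <;> simpa
    have connxyz : E (N 1 x) {Sum.inr x, Sum.inr y, Sum.inr z} := by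
      refine hE.trans (connN (b + 1) x) (hE.symm (link hxyz (hNR (b + 1) x) (Sum.inr x) (Sum.inr z)
        (by simpa using hxz) (by simp) (by simp) (by simp [N]) ?_))
      rw [N_succ, hFG b hb0 hbl, hbxz]; simp
    have connabz := connC _ habz a z (by simp) (by simp)
    have connacy := connC _ hacy a y (by simp) (by simp)
    have connbcx := connC _ hbcx b x (by simp) (by simp)
    have habcU : ({a, b, c} : Finset (Fin (u + 1))) ∈ S₁ ∪ S₂ := Finset.mem_union_left _ habc
    -- an `S₂`-block through two points of `{a, b, c}`
    have connS₂ : ∀ e ∈ S₂, ∀ p q, p ≠ q → p ∈ e → q ∈ e → p ∈ ({a, b, c} : Finset _) →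
        q ∈ ({a, b, c} : Finset _) → E (N 1 x) (e.map Function.Embedding.inl) := by
      intro e he p q hpq hpe hqe hp hq
      have hnew : ∃ d ∈ C, E (N 1 x) d ∧ Sum.inl p ∈ d ∧ Sum.inl q ∈ d := by
        simp only [Finset.mem_insert, Finset.mem_singleton] at hp hq
        rcases hp with hp | hp | hp <;> rcases hq with hq | hq | hq <;>
        first
        | exact (hpq (hp.trans hq.symm)).elim
        | (refine ⟨_, habz, connabz, ?_, ?_⟩ <;> simp [hp, hq] <;> done)
        | (refine ⟨_, hacy, connacy, ?_, ?_⟩ <;> simp [hp, hq] <;> done)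
        | (refine ⟨_, hbcx, connbcx, ?_, ?_⟩ <;> simp [hp, hq])
      obtain ⟨d, hdC, hdE, hpd, hqd⟩ := hnew
      exact hE.trans hdE (link hdC (hU₂ e he) _ _ (by simpa using hpq) hpd hqd (by simpa using hpe)
        (by simpa using hqe))
    -- Walks in the old graph are followed from `{a, b, c}`. That block no longer exists, so it is
    -- excepted; leaving it is possible by `connS₂`, through `abz`, `acy` or `bcx`.
    have connU : ∀ d : {d : Finset (Fin (u + 1)) // d ∈ S₁ ∪ S₂}, (d : Finset _) = {a, b, c} ∨
        E (N 1 x) ((d : Finset (Fin (u + 1))).map Function.Embedding.inl) := by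
      have walk : ∀ d e : {d : Finset (Fin (u + 1)) // d ∈ S₁ ∪ S₂},
          (blockIntersectionGraph 2 (S₁ ∪ S₂)).Adj d e → ((d : Finset _) = {a, b, c} ∨
          E (N 1 x) ((d : Finset (Fin (u + 1))).map Function.Embedding.inl)) →
          ((e : Finset _) = {a, b, c} ∨
          E (N 1 x) ((e : Finset (Fin (u + 1))).map Function.Embedding.inl)) := by
        intro d e hde h
        by_cases heo : (e : Finset _) = {a, b, c}
        · exact Or.inl heo
        right
        obtain ⟨p, q, hpq, hpd, hqd, hpe, hqe⟩ := Finset.exists_pair_of_card_inter hde.2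
        have hopp : ∀ {S}, IsSTS S → (d : Finset _) ∈ S → (e : Finset _) ∉ S := fun hS hdS heS =>
          hS.not_adj_of_mem hdS heS hde
        by_cases hdo : (d : Finset _) = {a, b, c}
        · have heS : (e : Finset _) ∈ S₂ := (Finset.mem_union.1 e.2).resolve_left
            (hopp h₁ (by rw [hdo]; exact habc))
          exact connS₂ e heS p q hpq hpe hqe (hdo ▸ hpd) (hdo ▸ hqd)
        · have h := h.resolve_left hdo
          refine hE.trans h ?_
          rcases Finset.mem_union.1 d.2 with hdS | hdS
          · have heS := (Finset.mem_union.1 e.2).resolve_left (hopp h₁ hdS)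
            refine link (hU₁ d hdS hdo) (hU₂ e heS) (Sum.inl p) (Sum.inl q) ?_ ?_ ?_ ?_ ?_ <;> simpa
          · have heS := (Finset.mem_union.1 e.2).resolve_right (hopp h₂ hdS)
            refine hE.symm (link (hU₁ e heS heo) (hU₂ d hdS) (Sum.inl p) (Sum.inl q)
              ?_ ?_ ?_ ?_ ?_) <;> simpa
      intro d
      obtain ⟨w⟩ := hconn.preconnected ⟨_, habcU⟩ d
      have : ∀ p q, (w : (blockIntersectionGraph 2 (S₁ ∪ S₂)).Walk p q) → ((p : Finset _) =
          {a, b, c} ∨ E (N 1 x) ((p : Finset (Fin (u + 1))).map Function.Embedding.inl)) →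
          ((q : Finset _) = {a, b, c} ∨
          E (N 1 x) ((q : Finset (Fin (u + 1))).map Function.Embedding.inl)) := by
        intro p q w
        induction w with
        | nil => exact id
        | cons h _ ih => exact fun h' => ih (walk _ _ h h')
      exact this _ _ w (Or.inl rfl)
    have all : ∀ d ∈ C ∪ R₂, E (N 1 x) d := by
      intro d hdU
      rcases Finset.mem_union.1 hdU with hdC | hdR
      · rcases hCcases d hdC with ⟨e, he, hne, rfl⟩ | ⟨s, w, rfl⟩ | ⟨e, he, rfl⟩ | rfl | rfl | rfl | rfl
        · exact (connU ⟨e, Finset.mem_union_left _ he⟩).resolve_left hne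
        · exact connC _ hdC s w (by simp) (by simp)
        · exact connT₁ e he
        · exact connxyz
        · exact connabz
        · exact connacy
        · exact connbcx
      · rcases mem_complete.1 hdR with ⟨e, he, rfl⟩ | ⟨s, w, rfl⟩ | ⟨e, he, rfl⟩
        · refine (connU ⟨e, Finset.mem_union_right _ he⟩).resolve_left ?_
          rintro rfl
          exact Finset.disjoint_left.1 hd habc he
        · exact connN s w
        · exact connT₂ e he
    have toReach : ∀ d e, E d e → ∀ (hdm : d ∈ C ∪ R₂) (hem : e ∈ C ∪ R₂),
        (blockIntersectionGraph 2 (C ∪ R₂)).Reachable ⟨d, hdm⟩ ⟨e, hem⟩ := by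
      -- The case `d = e` is needed since `E` is reflexive also on sets that are not blocks.
      have aux : ∀ d e, E d e → (d = e ∨ ((d ∈ C ∪ R₂ ∧ e ∈ C ∪ R₂) ∧
          ∀ (hdm : d ∈ C ∪ R₂) (hem : e ∈ C ∪ R₂),
          (blockIntersectionGraph 2 (C ∪ R₂)).Reachable ⟨d, hdm⟩ ⟨e, hem⟩)) := by
        intro d e h
        induction h with
        | rel d e h =>
          obtain ⟨hdC, heR, p, q, hpq, h1, h2, h3, h4⟩ := h
          refine Or.inr ⟨⟨Finset.mem_union_left _ hdC, Finset.mem_union_right _ heR⟩,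
            fun hdm hem => ?_⟩
          exact (hSC.adj_union hSR₂ hdisj (b := ⟨d, hdm⟩) (c := ⟨e, hem⟩) hdC heR hpq h1 h2 h3
            h4).reachable
        | refl d => exact Or.inl rfl
        | symm d e _ ih =>
          exact ih.imp Eq.symm fun ⟨h, h'⟩ => ⟨h.symm, fun hdm hem => (h' hem hdm).symm⟩
        | trans d e f _ _ ih1 ih2 =>
          rcases ih1 with rfl | ⟨h1, h1'⟩
          · exact ih2
          · rcases ih2 with rfl | ⟨h2, h2'⟩
            · exact Or.inr ⟨h1, h1'⟩
            · exact Or.inr ⟨⟨h1.1, h2.2⟩, fun hdm hem => (h1' hdm h1.2).trans (h2' h1.2 hem)⟩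
      intro d e h hdm hem
      rcases aux d e h with rfl | ⟨-, h'⟩
      · exact SimpleGraph.Reachable.refl _
      · exact h' hdm hem
    exact
      { preconnected := fun d e => toReach _ _ (hE.trans (hE.symm (all d d.2)) (all e e.2)) d.2 e.2
        nonempty := ⟨⟨N 1 x, Finset.mem_union_right _ (hNR 1 x)⟩⟩ }
  · intro hH
    apply hham
    have hnontriv : Nontrivial {d : Finset (Fin (u + 1)) // d ∈ S₁ ∪ S₂} := by
      obtain ⟨e, he, -, -⟩ := h₂.exists_block a b hab
      refine ⟨⟨_, Finset.mem_union_left _ habc⟩, ⟨e, Finset.mem_union_right _ he⟩, fun h => ?_⟩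
      have h' : ({a, b, c} : Finset (Fin (u + 1))) = e := congrArg Subtype.val h
      exact Finset.disjoint_left.1 hd habc (h' ▸ he)
    have h3 : ∀ d ∈ S₁ ∪ S₂, d.card = 3 := fun d hdS =>
      (Finset.mem_union.1 hdS).elim (h₁.card_block d) (h₂.card_block d)
    have hleft : ∀ d : Finset (Fin (u + 1)),
      (d.map (Function.Embedding.inl : _ ↪ Fin (u + 1) ⊕ X)).toLeft = d := fun d => by ext; simp
    refine isHamiltonian_of_extension h₁ h₂ hSC hSR₂ habc ?_ ?_ ?_ ?_ hnontriv hH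
    · intro d hdS hne
      rcases Finset.mem_union.1 hdS with h | h
      · exact Finset.mem_union_left _ (hU₁ d h hne)
      · exact Finset.mem_union_right _ (hU₂ d h)
    · intro h
      rcases Finset.mem_union.1 h with h | h
      · rcases hCmem.1 h with ⟨-, h, -⟩ | h | h | h | h
        · exact h rfl
        · have h' := Finset.ext_iff.1 h (Sum.inr x); simp at h'
        · have h' := Finset.ext_iff.1 h (Sum.inr z); simp at h'
        · have h' := Finset.ext_iff.1 h (Sum.inr y); simp at h'
        · have h' := Finset.ext_iff.1 h (Sum.inr x); simp at h'
      · rcases mem_complete.1 h with ⟨e, he, h⟩ | ⟨s, w, h⟩ | ⟨e, he, h⟩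
        · rw [← Finset.map_injective _ h] at he
          exact Finset.disjoint_left.1 hd habc he
        · have h' := Finset.ext_iff.1 h (Sum.inr w); simp at h'
        · have h' := Finset.ext_iff.1 h (Sum.inl a); simp at h'
    · intro d hdU hdl p q hpq hp hq
      rcases Finset.mem_union.1 hdU with hdC | hdR
      · refine ⟨hdC, ?_⟩
        rcases hCcases d hdC with ⟨e, he, hne, rfl⟩ | ⟨s, w, rfl⟩ | ⟨e, he, rfl⟩ | rfl | rfl | rfl | rfl
        · rw [hleft] at hdl; exact (hdl (Finset.mem_union_left _ he)).elim
        · rw [inl_mem_coneBlock] at hp hq; exact (hpq (hp.trans hq.symm)).elim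
        · simp at hp
        all_goals
          simp at hp hq ⊢
        all_goals tauto
      · rcases mem_complete.1 hdR with ⟨e, he, rfl⟩ | ⟨s, w, rfl⟩ | ⟨e, he, rfl⟩
        · rw [hleft] at hdl; exact (hdl (Finset.mem_union_right _ he)).elim
        · rw [inl_mem_coneBlock] at hp hq; exact (hpq (hp.trans hq.symm)).elim
        · simp at hp
    · refine ⟨_, Finset.mem_union_left _ hxyz, fun h => ?_⟩
      have := h3 _ h
      rw [show ({Sum.inr x, Sum.inr y, Sum.inr z} : Finset (Fin (u + 1) ⊕ X)).toLeft = ∅ by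
        ext; simp] at this
      simp at this

end Glue

/-! ### Moving a block onto the three prescribed points. -/

theorem Equiv.Perm.exists_map_triple {α : Type*} [DecidableEq α] {a b c a' b' c' : α}
    (hab : a ≠ b) (hac : a ≠ c) (hbc : b ≠ c) (hab' : a' ≠ b') (hac' : a' ≠ c') (hbc' : b' ≠ c') :
    ∃ σ : Equiv.Perm α, σ a' = a ∧ σ b' = b ∧ σ c' = c := by
  let σ₁ : Equiv.Perm α := Equiv.swap a' a
  let σ₂ : Equiv.Perm α := Equiv.swap (σ₁ b') b
  let σ₃ : Equiv.Perm α := Equiv.swap (σ₂ (σ₁ c')) c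
  have h1 : σ₁ a' = a := Equiv.swap_apply_left _ _
  have h2 : σ₂ a = a := Equiv.swap_apply_of_ne_of_ne
    (by rw [← h1]; exact fun h => hab' (σ₁.injective h)) hab
  have h3 : σ₂ (σ₁ b') = b := Equiv.swap_apply_left _ _
  refine ⟨σ₃ * σ₂ * σ₁, ?_, ?_, ?_⟩
  · simp only [Equiv.Perm.mul_apply, h1, h2]
    refine Equiv.swap_apply_of_ne_of_ne (fun h => hac' ?_) hac
    exact σ₁.injective (σ₂.injective (by rw [← h, h1, h2]))
  · simp only [Equiv.Perm.mul_apply, h3]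
    refine Equiv.swap_apply_of_ne_of_ne (fun h => hbc' ?_) hbc
    exact σ₁.injective (σ₂.injective (by rw [← h, h3]))
  · exact Equiv.swap_apply_left _ _

/-- A twofold triple system of order `v` with a bipartite, connected, non-Hamiltonian `2`-block
intersection graph. -/
def HasNonHamiltonian (v : ℕ) : Prop :=
  ∃ B : Finset (Finset (Fin v)), IsTTS v B ∧ (blockIntersectionGraph 2 B).IsBipartite ∧
    (blockIntersectionGraph 2 B).Connected ∧ ¬ (blockIntersectionGraph 2 B).IsHamiltonian

/-- The frame pair dictates `a, b, c`, so some block of the given system is relabelled to `{a, b,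
c}`. It may fall in either of the two Steiner systems, which are then interchanged if necessary. -/
theorem IsFramePair.hasNonHamiltonian {u : ℕ} {X : Type*} [Fintype X] [DecidableEq X]
    {F G : Fin (u + 1) → X → X} {T₁ T₂ : Finset (Finset X)} (hP : IsFramePair F G T₁ T₂)
    (hu : 2 ≤ u) (h : HasNonHamiltonian (u + 1)) :
    HasNonHamiltonian (u + 1 + Fintype.card X) := by
  obtain ⟨x, y, z, a, b, c, ha0, hal, hb0, hbl, hc0, hcl, hayz, hbxz, hcxy, hyz⟩ := hP.triangle
  obtain ⟨B, hB⟩ := h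
  have hbc : b ≠ c := fun h => hyz (by rw [← hcxy, ← h, hbxz])
  have hab : a ≠ b := by
    rintro rfl
    apply hP.left.ne c x
    rw [hcxy, ← hP.left.invol a y, hayz, ← hbxz, hP.left.invol]
  have hac : a ≠ c := by
    rintro rfl
    apply hP.left.ne b x
    rw [hbxz, ← hayz, ← hcxy, hP.left.invol]
  obtain ⟨S₁, S₂, h₁, -, -, rfl⟩ := hB.1.exists_isSTS_union hB.2.1
  obtain ⟨d, hd, -⟩ := h₁.exists_block a b hab
  obtain ⟨a', b', c', hab', hac', hbc', rfl⟩ := Finset.card_eq_three.1 (h₁.card_block d hd)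
  obtain ⟨σ, hσa, hσb, hσc⟩ := Equiv.Perm.exists_map_triple hab hac hbc hab' hac' hbc'
  have hmem : {a, b, c} ∈ relabel σ (S₁ ∪ S₂) := by
    refine mem_relabel.2 ⟨_, Finset.mem_union_left _ hd, ?_⟩
    simp [Finset.map_insert, hσa, hσb, hσc]
  have hR := relabel_properties σ hB
  obtain ⟨R₁, R₂, k₁, k₂, hdisj, hunion⟩ := hR.1.exists_isSTS_union hR.2.1
  rw [hunion] at hmem hR
  have key : ∃ B' : Finset (Finset (Fin (u + 1) ⊕ X)), IsTTS (u + 1 + Fintype.card X) B' ∧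
      (blockIntersectionGraph 2 B').IsBipartite ∧ (blockIntersectionGraph 2 B').Connected ∧
      ¬ (blockIntersectionGraph 2 B').IsHamiltonian := by
    rcases Finset.mem_union.1 hmem with hm | hm
    · exact hP.glue hu k₁ k₂ hdisj ha0 hal hb0 hbl hc0 hcl hayz hbxz hcxy hyz hm hR.2.2.1 hR.2.2.2
    · rw [Finset.union_comm] at hR
      exact hP.glue hu k₂ k₁ hdisj.symm ha0 hal hb0 hbl hc0 hcl hayz hbxz hcxy hyz hm hR.2.2.1
        hR.2.2.2
  obtain ⟨B', hB'⟩ := key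
  have e : Fin (u + 1) ⊕ X ≃ Fin (u + 1 + Fintype.card X) :=
    Fintype.equivFinOfCardEq (by simp)
  exact ⟨relabel e B', relabel_properties e hB'⟩

/-! ### Edge colourings, Kempe switches and Vizing's theorem. -/

namespace SimpleGraph

/-- `c` is a proper edge colouring of `H`, written as a function of the two ends of an edge. -/
structure IsEdgeColoring {V K : Type*} (H : SimpleGraph V) (c : V → V → K) : Prop where
  symm : ∀ x y, H.Adj x y → c x y = c y x
  proper : ∀ x y z, H.Adj x y → H.Adj x z → c x y = c x z → y = z

/-- The colour `i` does not occur at the vertex `x`. -/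
def IsMissing {V K : Type*} (H : SimpleGraph V) (c : V → V → K) (x : V) (i : K) : Prop :=
  ∀ y, H.Adj x y → c x y ≠ i

/-- A connected graph of maximum degree two has at most two ends. -/
theorem Connected.sum_two_sub_degree_le {V : Type*} [Fintype V] (G : SimpleGraph V)
    [DecidableRel G.Adj] (hG : G.Connected) (h2 : ∀ v, G.degree v ≤ 2) :
    ∑ v, (2 - G.degree v) ≤ 2 := by
  classical
  have h := hG.card_vert_le_card_edgeSet_add_one
  have hsum := G.sum_degrees_eq_twice_card_edges
  have h1 : ∑ v, (2 - G.degree v) + ∑ v, G.degree v = 2 * Fintype.card V := by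
    rw [← Finset.sum_add_distrib, Finset.sum_congr rfl fun v _ => Nat.sub_add_cancel (h2 v)]
    simp [mul_comm]
  rw [Nat.card_eq_fintype_card, Nat.card_eq_fintype_card, ← edgeFinset_card] at h
  omega

section Kempe

variable {V K : Type*} [Fintype V] [DecidableEq V] [DecidableEq K] {H : SimpleGraph V}
  {c : V → V → K}

/-- The subgraph of the edges coloured `i` or `j`. -/
def kempe (H : SimpleGraph V) (c : V → V → K) (hc : H.IsEdgeColoring c) (i j : K) :
    SimpleGraph V where
  Adj x y := H.Adj x y ∧ (c x y = i ∨ c x y = j)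
  symm := ⟨fun x y h => ⟨h.1.symm, by rw [← hc.symm x y h.1]; exact h.2⟩⟩
  loopless := ⟨fun x h => h.1.ne rfl⟩

/-- Among the vertices of a Kempe component, at most two miss one of the two colours. -/
theorem IsEdgeColoring.card_missing_le (hc : H.IsEdgeColoring c) {i j : K}
    (C : (kempe H c hc i j).ConnectedComponent) (A : Finset V) (hA : ∀ x ∈ A, x ∈ C.supp)
    (hm : ∀ x ∈ A, H.IsMissing c x i ∨ H.IsMissing c x j) : A.card ≤ 2 := by
  classical
  let Q := C.toSimpleGraph
  have hdeg : ∀ v, Q.degree v ≤ (({i, j} : Finset K).filter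
      fun k => ¬ H.IsMissing c v k).card := by
    intro v
    rw [← card_neighborFinset_eq_degree]
    refine Finset.card_le_card_of_injOn (fun w => c v w) ?_ ?_
    · intro w hw
      have hw' : (kempe H c hc i j).Adj v w := ((mem_neighborFinset Q _ _).1 (Finset.mem_coe.1 hw) : Q.Adj v w)
      simp only [Finset.coe_filter, Finset.mem_insert, Finset.mem_singleton, Set.mem_ofPred_eq]
      exact ⟨hw'.2, fun h => h w hw'.1 rfl⟩
    · intro w hw w' hw' h
      have h1 : (kempe H c hc i j).Adj v w := ((mem_neighborFinset Q _ _).1 (Finset.mem_coe.1 hw) : Q.Adj v w)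
      have h2 : (kempe H c hc i j).Adj v w' := ((mem_neighborFinset Q _ _).1 (Finset.mem_coe.1 hw') : Q.Adj v w')
      exact Subtype.ext (hc.proper _ _ _ h1.1 h2.1 h)
  have hle2 : ({i, j} : Finset K).card ≤ 2 := Finset.card_le_two
  have h2 : ∀ v, Q.degree v ≤ 2 := fun v =>
    (hdeg v).trans ((Finset.card_filter_le _ _).trans hle2)
  -- A vertex missing one of the two colours has degree at most one in the component, so it
  -- contributes at least one to this sum.
  have hsum := Connected.sum_two_sub_degree_le Q C.connected_toSimpleGraph h2
  refine le_trans ?_ hsum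
  have : A.card = (A.subtype (· ∈ C)).card := by
    rw [Finset.card_subtype, Finset.filter_true_of_mem (p := (· ∈ C)) hA]
  rw [this, Finset.card_eq_sum_ones]
  refine (Finset.sum_le_sum fun v hv => ?_).trans
    (Finset.sum_le_sum_of_subset (Finset.subset_univ _))
  have hvA : v.1 ∈ A := Finset.mem_subtype.1 hv
  have hlt : (({i, j} : Finset K).filter fun k => ¬ H.IsMissing c v.1 k).card < 2 := by
    refine lt_of_lt_of_le (Finset.card_lt_card ?_) hle2
    rw [Finset.filter_ssubset]
    rcases hm v.1 hvA with h | h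
    · exact ⟨i, by simp, by simpa using h⟩
    · exact ⟨j, by simp, by simpa using h⟩
  have := hdeg v
  omega

/-- Interchanging two colours along a Kempe component. -/
noncomputable def kempeSwitch (c : V → V → K) (i j : K) (s : Set V) : V → V → K :=
  open Classical in fun x y => if x ∈ s then Equiv.swap i j (c x y) else c x y

theorem IsEdgeColoring.kempeSwitch (hc : H.IsEdgeColoring c) {i j : K}
    (C : (kempe H c hc i j).ConnectedComponent) :
    H.IsEdgeColoring (kempeSwitch c i j C.supp) where
  symm x y hxy := by
    have hside : c x y = i ∨ c x y = j → (x ∈ C.supp ↔ y ∈ C.supp) := fun h =>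
      C.mem_supp_congr_adj (show (kempe H c hc i j).Adj x y from ⟨hxy, h⟩)
    have hs := hc.symm x y hxy
    unfold SimpleGraph.kempeSwitch
    by_cases h : c x y = i ∨ c x y = j
    · by_cases hx : x ∈ C.supp
      · rw [if_pos hx, if_pos ((hside h).1 hx), hs]
      · rw [if_neg hx, if_neg fun hy => hx ((hside h).2 hy), hs]
    · rw [not_or] at h
      rw [← hs, Equiv.swap_apply_of_ne_of_ne h.1 h.2]
      simp
  proper x y z hxy hxz h := by
    unfold SimpleGraph.kempeSwitch at h
    by_cases hx : x ∈ C.supp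
    · simp only [hx, if_true, EmbeddingLike.apply_eq_iff_eq] at h
      exact hc.proper x y z hxy hxz h
    · simp only [hx, if_false] at h
      exact hc.proper x y z hxy hxz h

theorem isMissing_kempeSwitch {i j : K} {s : Set V} {x : V} {l : K} :
    H.IsMissing (kempeSwitch c i j s) x l ↔
      (x ∈ s ∧ H.IsMissing c x (Equiv.swap i j l)) ∨ (x ∉ s ∧ H.IsMissing c x l) := by
  unfold IsMissing SimpleGraph.kempeSwitch
  by_cases hx : x ∈ s
  · simp [hx, Equiv.swap_apply_eq_iff]
  · simp [hx]

/-- If the vertices of `N` come with two missing colours from `L` each, except for one vertex which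
comes with a single one, then after Kempe switches some colour is used exactly once. -/
theorem IsEdgeColoring.exists_card_filter_eq_one (L : Finset K) (N : Finset V) (y₀ : V)
    (hy₀ : y₀ ∈ N) (hNL : N.card ≤ L.card) (e : ℕ) : ∀ (c : V → V → K), H.IsEdgeColoring c →
    ∀ A : V → Finset K, (L.filter fun i => ∀ y ∈ N, i ∉ A y).card = e →
    (∀ y ∈ N, A y ⊆ L) → (∀ y ∈ N, ∀ i ∈ A y, H.IsMissing c y i) →
    (∀ y ∈ N, (A y).card = if y = y₀ then 1 else 2) →
    ∃ c', H.IsEdgeColoring c' ∧ (∀ l ∉ L, ∀ y, H.IsMissing c y l → H.IsMissing c' y l) ∧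
      ∃ A' : V → Finset K, (∀ y ∈ N, A' y ⊆ L) ∧ (∀ y ∈ N, ∀ i ∈ A' y, H.IsMissing c' y i) ∧
        (∀ y ∈ N, (A' y).card = if y = y₀ then 1 else 2) ∧
        ∃ i ∈ L, (N.filter fun y => i ∈ A' y).card = 1 := by
  induction e using Nat.strong_induction_on with
  | _ e ih =>
  intro c hc A he hAL hAm hA
  by_cases h1 : ∃ i ∈ L, (N.filter fun y => i ∈ A y).card = 1
  · exact ⟨c, hc, fun _ _ _ h => h, A, hAL, hAm, hA, h1⟩
  -- The total `2 * N.card - 1` is below `2 * L.card`, so some colour is used at most once; it is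
  -- odd, so some colour is used an odd number of times. As no colour is used exactly once, these
  -- are an unused `i` and a `j` used at least three times.
  have hsum : ∑ i ∈ L, (N.filter fun y => i ∈ A y).card + 1 = 2 * N.card := by
    have hcomm : ∑ i ∈ L, (N.filter fun y => i ∈ A y).card = ∑ y ∈ N, (A y).card := by
      rw [Finset.sum_congr rfl fun i _ => Finset.card_filter _ _, Finset.sum_comm]
      refine Finset.sum_congr rfl fun y hy => ?_
      rw [← Finset.card_filter, Finset.filter_mem_eq_inter, Finset.inter_eq_right.2 (hAL y hy)]
    rw [hcomm, Finset.sum_congr rfl hA, ← Finset.add_sum_erase _ _ hy₀,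
      Finset.sum_congr rfl fun y hy => if_neg (Finset.ne_of_mem_erase hy)]
    have := Finset.card_erase_add_one hy₀
    simp
    omega
  obtain ⟨i, hiL, hi⟩ : ∃ i ∈ L, (N.filter fun y => i ∈ A y).card = 0 := by
    by_contra! hne
    have : ∑ i ∈ L, 2 ≤ ∑ i ∈ L, (N.filter fun y => i ∈ A y).card :=
      Finset.sum_le_sum fun i hi => by
        have := hne i hi
        have : (N.filter fun y => i ∈ A y).card ≠ 1 := fun h => h1 ⟨i, hi, h⟩
        omega
    simp at this
    omega
  obtain ⟨j, hjL, hj⟩ : ∃ j ∈ L, 3 ≤ (N.filter fun y => j ∈ A y).card := by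
    by_contra! hne
    have : Even (∑ i ∈ L, (N.filter fun y => i ∈ A y).card) := Finset.even_sum _ fun j hj => by
      have := hne j hj
      have h2 : (N.filter fun y => j ∈ A y).card ≠ 1 := fun h => h1 ⟨j, hj, h⟩
      interval_cases (N.filter fun y => j ∈ A y).card
      · simp
      · exact (h2 rfl).elim
      · exact even_two
    obtain ⟨r, hr⟩ := this
    omega
  have hi' : ∀ y ∈ N, i ∉ A y := by simpa [Finset.filter_eq_empty_iff] using hi
  obtain ⟨w, hw⟩ : (N.filter fun y => j ∈ A y).Nonempty := Finset.card_pos.1 (by omega)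
  obtain ⟨hwN, hwj⟩ := Finset.mem_filter.1 hw
  have hij : i ≠ j := fun h => hi' w hwN (h ▸ hwj)
  classical
  set C := (kempe H c hc i j).connectedComponentMk w
  have hwC : w ∈ C.supp := rfl
  -- At most two of the three or more users of `j` lie in one Kempe component.
  obtain ⟨v, hv, hvC⟩ : ∃ v ∈ N.filter fun y => j ∈ A y, v ∉ C.supp := by
    by_contra! hall
    have := hc.card_missing_le C _ hall fun x hx =>
      Or.inr (hAm x (Finset.mem_filter.1 hx).1 j (Finset.mem_filter.1 hx).2)
    omega
  obtain ⟨hvN, hvj⟩ := Finset.mem_filter.1 hv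
  let A' : V → Finset K := fun y => if y ∈ C.supp then (A y).image (Equiv.swap i j) else A y
  have hA'C : ∀ y ∈ C.supp, ∀ l, l ∈ A' y ↔ Equiv.swap i j l ∈ A y := by
    intro y hy l
    simp only [A', if_pos hy, Finset.mem_image]
    exact ⟨fun ⟨m, hm, h⟩ => by rw [← h, Equiv.swap_apply_self]; exact hm,
      fun h => ⟨_, h, Equiv.swap_apply_self _ _ _⟩⟩
  have hA'n : ∀ y ∉ C.supp, A' y = A y := fun y hy => if_neg hy
  have hswapL : ∀ l, Equiv.swap i j l ∈ L → l ∈ L := by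
    intro l hl
    rcases eq_or_ne l i with rfl | hli
    · exact hiL
    rcases eq_or_ne l j with rfl | hlj
    · exact hjL
    rwa [Equiv.swap_apply_of_ne_of_ne hli hlj] at hl
  -- After the switch `i` is used at `w`, and `j` is still used at `v` outside the component: fewer
  -- colours are unused.
  have hlt : (L.filter fun i => ∀ y ∈ N, i ∉ A' y).card < e := by
    rw [← he]
    refine Finset.card_lt_card ⟨fun l hl => ?_, fun hsub => ?_⟩
    · obtain ⟨hlL, hl⟩ := Finset.mem_filter.1 hl
      refine Finset.mem_filter.2 ⟨hlL, fun y hy hly => ?_⟩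
      have hli : l ≠ i := fun h => hi' y hy (h ▸ hly)
      have hlj : l ≠ j := by
        rintro rfl
        exact hl v hvN (by rw [hA'n v hvC]; exact hvj)
      by_cases hyC : y ∈ C.supp
      · exact hl y hy (by rw [hA'C y hyC, Equiv.swap_apply_of_ne_of_ne hli hlj]; exact hly)
      · exact hl y hy (by rw [hA'n y hyC]; exact hly)
    · have := hsub (Finset.mem_filter.2 ⟨hiL, hi'⟩)
      exact (Finset.mem_filter.1 this).2 w hwN (by rw [hA'C w hwC, Equiv.swap_apply_left]; exact hwj)
  have hA'L : ∀ y ∈ N, A' y ⊆ L := by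
    intro y hy l hl
    by_cases hyC : y ∈ C.supp
    · exact hswapL l (hAL y hy ((hA'C y hyC l).1 hl))
    · exact hAL y hy (by rwa [hA'n y hyC] at hl)
  have hA'm : ∀ y ∈ N, ∀ l ∈ A' y, H.IsMissing (SimpleGraph.kempeSwitch c i j C.supp) y l := by
    intro y hy l hl
    rw [isMissing_kempeSwitch]
    by_cases hyC : y ∈ C.supp
    · exact Or.inl ⟨hyC, hAm y hy _ ((hA'C y hyC l).1 hl)⟩
    · exact Or.inr ⟨hyC, hAm y hy _ (by rwa [hA'n y hyC] at hl)⟩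
  have hA'2 : ∀ y ∈ N, (A' y).card = if y = y₀ then 1 else 2 := by
    intro y hy
    rw [← hA y hy]
    by_cases hyC : y ∈ C.supp
    · simp only [A', if_pos hyC]
      exact Finset.card_image_of_injective _ (Equiv.injective _)
    · rw [hA'n y hyC]
  obtain ⟨c', hc', hmiss, h⟩ := ih _ hlt _ (hc.kempeSwitch C) A' rfl hA'L hA'm hA'2
  refine ⟨c', hc', fun l hl y hy => hmiss l hl y ?_, h⟩
  rw [isMissing_kempeSwitch, Equiv.swap_apply_of_ne_of_ne (by rintro rfl; exact hl hiL)
    (by rintro rfl; exact hl hjL)]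
  tauto

/-- Given a set of colours missing at each vertex of `N`, the colouring can be changed so that a
system of distinct missing colours exists. -/
theorem IsEdgeColoring.exists_injOn_isMissing (n : ℕ) : ∀ (c : V → V → K), H.IsEdgeColoring c →
    ∀ (L : Finset K) (N : Finset V) (A : V → Finset K), N.card = n → n ≤ L.card →
    (∀ y ∈ N, A y ⊆ L) → (∀ y ∈ N, ∀ i ∈ A y, H.IsMissing c y i) →
    (∃ y₀, ∀ y ∈ N, y ≠ y₀ → 2 ≤ (A y).card) → (∀ y ∈ N, 1 ≤ (A y).card) →
    ∃ c', H.IsEdgeColoring c' ∧ (∀ l ∉ L, ∀ y, H.IsMissing c y l → H.IsMissing c' y l) ∧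
      ∃ f : V → K, Set.InjOn f N ∧ ∀ y ∈ N, f y ∈ L ∧ H.IsMissing c' y (f y) := by
  classical
  induction n with
  | zero =>
    intro c hc L N A hN _ hAL hAm hA2 hA1
    rw [Finset.card_eq_zero] at hN
    subst hN
    refine ⟨c, hc, fun _ _ _ h => h, fun y => c y y, by simp, by simp⟩
  | succ n ih =>
    intro c hc L N A hN hNL hAL hAm ⟨y₁, hy₁⟩ hA1
    obtain ⟨y₀, hy₀N, hy₀⟩ : ∃ y₀ ∈ N, ∀ y ∈ N, y ≠ y₀ → 2 ≤ (A y).card := by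
      by_cases h : y₁ ∈ N
      · exact ⟨y₁, h, hy₁⟩
      · obtain ⟨y₂, hy₂⟩ := Finset.card_pos.1 (by omega : 0 < N.card)
        exact ⟨y₂, hy₂, fun y hy _ => hy₁ y hy fun he => h (he ▸ hy)⟩
    -- Trimming to exactly two colours, and one at `y₀`, produces the odd total.
    have hB : ∀ y, ∃ B : Finset K, y ∈ N → B ⊆ A y ∧ B.card = if y = y₀ then 1 else 2 := by
      intro y
      by_cases hy : y ∈ N
      · have : (if y = y₀ then 1 else 2) ≤ (A y).card := by
          split_ifs with h
          · exact hA1 y hy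
          · exact hy₀ y hy h
        obtain ⟨B, hB⟩ := Finset.exists_subset_card_eq this
        exact ⟨B, fun _ => hB⟩
      · exact ⟨∅, fun h => (hy h).elim⟩
    choose B hB using hB
    obtain ⟨c₁, hc₁, hm₁, A₁, hAL₁, hAm₁, hA₁, i, hiL, hi⟩ := hc.exists_card_filter_eq_one L N y₀
      hy₀N (hN ▸ hNL) _ _ B rfl (fun y hy => (hB y hy).1.trans (hAL y hy))
      (fun y hy k hk => hAm y hy k ((hB y hy).1 hk)) (fun y hy => (hB y hy).2)
    obtain ⟨w, hw⟩ := Finset.card_eq_one.1 hi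
    have hw' : ∀ y, y ∈ N ∧ i ∈ A₁ y ↔ y = w := fun y => by
      simpa using Finset.ext_iff.1 hw y
    obtain ⟨hwN, hwi⟩ := (hw' w).2 rfl
    -- The colour `i` is used by `w` alone, so it is given to `w`. Both are dropped, and later
    -- switches, confined to `L.erase i`, leave `i` missing at `w`.
    obtain ⟨c₂, hc₂, hm₂, f, hf, hf'⟩ := ih c₁ hc₁ (L.erase i) (N.erase w) A₁
      (by rw [Finset.card_erase_of_mem hwN, hN]; rfl)
      (by rw [Finset.card_erase_of_mem hiL]; omega)
      (fun y hy k hk => Finset.mem_erase.2 ⟨fun h => Finset.ne_of_mem_erase hy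
        ((hw' y).1 ⟨Finset.mem_of_mem_erase hy, h ▸ hk⟩), hAL₁ y (Finset.mem_of_mem_erase hy) hk⟩)
      (fun y hy => hAm₁ y (Finset.mem_of_mem_erase hy))
      ⟨y₀, fun y hy h => by rw [hA₁ y (Finset.mem_of_mem_erase hy), if_neg h]⟩
      (fun y hy => by rw [hA₁ y (Finset.mem_of_mem_erase hy)]; split_ifs <;> simp)
    refine ⟨c₂, hc₂, fun l hl y hy => hm₂ l (fun h => hl (Finset.mem_of_mem_erase h)) y
      (hm₁ l hl y hy), Function.update f w i, ?_, ?_⟩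
    · intro y hy z hz h
      by_cases hyw : y = w <;> by_cases hzw : z = w
      · rw [hyw, hzw]
      · subst hyw
        rw [Function.update_self, Function.update_of_ne hzw] at h
        exact (Finset.ne_of_mem_erase (hf' z (Finset.mem_erase.2 ⟨hzw, hz⟩)).1 h.symm).elim
      · subst hzw
        rw [Function.update_self, Function.update_of_ne hyw] at h
        exact (Finset.ne_of_mem_erase (hf' y (Finset.mem_erase.2 ⟨hyw, hy⟩)).1 h).elim
      · rw [Function.update_of_ne hyw, Function.update_of_ne hzw] at h
        exact hf (Finset.mem_coe.2 (Finset.mem_erase.2 ⟨hyw, hy⟩))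
          (Finset.mem_coe.2 (Finset.mem_erase.2 ⟨hzw, hz⟩)) h
    · intro y hy
      by_cases hyw : y = w
      · subst hyw
        rw [Function.update_self]
        exact ⟨hiL, hm₂ i (by simp) y (hAm₁ y hy i hwi)⟩
      · rw [Function.update_of_ne hyw]
        obtain ⟨h1, h2⟩ := hf' y (Finset.mem_erase.2 ⟨hyw, hy⟩)
        exact ⟨Finset.mem_of_mem_erase h1, h2⟩

end Kempe

/-- Vizing's theorem: a graph of maximum degree less than the number of colours has a proper edge
colouring. -/
theorem exists_isEdgeColoring {V K : Type*} [Fintype V] [Fintype K] (G : SimpleGraph V)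
    [DecidableRel G.Adj] (h : ∀ v, G.degree v < Fintype.card K) [Nonempty K] :
    ∃ c : V → V → K, G.IsEdgeColoring c := by
  classical
  let Q : Finset V → SimpleGraph V := fun s =>
    { Adj := fun x y => G.Adj x y ∧ x ∈ s ∧ y ∈ s
      symm := ⟨fun x y h => ⟨h.1.symm, h.2.2, h.2.1⟩⟩
      loopless := ⟨fun x h => h.1.ne rfl⟩ }
  suffices ∀ s, ∃ c : V → V → K, (Q s).IsEdgeColoring c by
    obtain ⟨c, hc⟩ := this Finset.univ
    exact ⟨c, fun x y hxy => hc.symm x y ⟨hxy, by simp, by simp⟩,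
      fun x y z hxy hxz => hc.proper x y z ⟨hxy, by simp, by simp⟩ ⟨hxz, by simp, by simp⟩⟩
  intro s
  induction s using Finset.induction_on with
  | empty =>
    exact ⟨fun _ _ => Classical.arbitrary K, fun _ _ _ => rfl, fun x y z hxy => by simp [Q] at hxy⟩
  | insert x s hxs ih =>
    obtain ⟨c, hc⟩ := ih
    let N := s.filter fun y => G.Adj x y
    let A : V → Finset K := fun y => Finset.univ.filter fun i => (Q s).IsMissing c y i
    have hNx : N ⊆ G.neighborFinset x := fun y hy => by
      simpa using (Finset.mem_filter.1 hy).2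
    have hN : N.card ≤ (Finset.univ : Finset K).card :=
      (Finset.card_le_card hNx).trans ((G.card_neighborFinset_eq_degree x).trans_le (h x).le)
    -- The degree of `y` is less than the number of colours, and the edge from `y` to the new vertex
    -- `x` is not yet coloured.
    have hA : ∀ y ∈ N, 2 ≤ (A y).card := by
      intro y hy
      have h1 : (Finset.univ.filter fun i => ¬ (Q s).IsMissing c y i).card ≤
          ((G.neighborFinset y).erase x).card := by
        refine (Finset.card_le_card fun i hi => ?_).trans
          (Finset.card_image_le (s := (G.neighborFinset y).erase x) (f := fun z => c y z))
        simp only [IsMissing, not_forall, not_not, Finset.mem_filter, Finset.mem_univ,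
          true_and] at hi
        obtain ⟨z, hz, rfl⟩ := hi
        exact Finset.mem_image.2 ⟨z, Finset.mem_erase.2 ⟨fun h => hxs (h ▸ hz.2.2),
          by simpa using hz.1⟩, rfl⟩
      have hx : x ∈ G.neighborFinset y := by simpa using (Finset.mem_filter.1 hy).2.symm
      rw [Finset.card_erase_of_mem hx, card_neighborFinset_eq_degree] at h1
      have h2 := Finset.card_filter_add_card_filter_not (s := (Finset.univ : Finset K))
        fun i => (Q s).IsMissing c y i
      have h3 := h y
      have h4 : 0 < G.degree y := (G.degree_pos_iff_exists_adj y).2 ⟨x, by simpa using hx⟩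
      rw [Finset.card_univ] at h2
      show 2 ≤ (Finset.univ.filter fun i => (Q s).IsMissing c y i).card
      omega
    obtain ⟨c', hc', -, f, hf, hf'⟩ := hc.exists_injOn_isMissing _ _ Finset.univ N A rfl hN
      (fun _ _ => Finset.subset_univ _) (fun y _ i hi => (Finset.mem_filter.1 hi).2)
      ⟨x, fun y hy _ => hA y hy⟩ (fun y hy => (hA y hy).trans' one_le_two)
    have hmemN : ∀ y, (Q (insert x s)).Adj x y → y ∈ N := fun y hy =>
      Finset.mem_filter.2 ⟨(Finset.mem_insert.1 hy.2.2).resolve_left hy.1.ne', hy.1⟩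
    have hadj : ∀ y z, (Q (insert x s)).Adj y z → y ≠ x → z ≠ x → (Q s).Adj y z :=
      fun y z h hy hz => ⟨h.1, (Finset.mem_insert.1 h.2.1).resolve_left hy,
        (Finset.mem_insert.1 h.2.2).resolve_left hz⟩
    refine ⟨fun y z => if y = x then f z else if z = x then f y else c' y z, ?_, ?_⟩
    · intro y z hyz
      by_cases hy : y = x <;> by_cases hz : z = x
      · simp [hy, hz]
      · simp [hy, hz]
      · simp [hy, hz]
      · simp only [hy, hz, if_false]
        exact hc'.symm y z (hadj y z hyz hy hz)
    · intro y z w hyz hyw hzw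
      by_cases hy : y = x
      · subst hy
        simp only [if_true] at hzw
        exact hf (hmemN z hyz) (hmemN w hyw) hzw
      have hyN : z = x ∨ w = x → y ∈ N := by
        rintro (rfl | rfl)
        · exact hmemN y hyz.symm
        · exact hmemN y hyw.symm
      by_cases hz : z = x <;> by_cases hw : w = x
      · rw [hz, hw]
      · simp only [hy, hz, hw, if_true, if_false] at hzw
        exact ((hf' y (hyN (Or.inl hz))).2 w (hadj y w hyw hy hw) hzw.symm).elim
      · simp only [hy, hz, hw, if_true, if_false] at hzw
        exact ((hf' y (hyN (Or.inr hw))).2 z (hadj y z hyz hy hz) hzw).elim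
      · simp only [hy, hz, hw, if_false] at hzw
        exact hc'.proper y z w (hadj y z hyz hy hz) (hadj y w hyw hy hw) hzw

end SimpleGraph

/-- A regular graph with a loop added at each vertex splits into involutions. -/
theorem SimpleGraph.exists_involutions {V K : Type*} [Fintype V] [Fintype K] (G : SimpleGraph V)
    [DecidableRel G.Adj] (h : ∀ v, G.degree v + 1 = Fintype.card K) [Nonempty K] :
    ∃ p : K → V → V, (∀ k x, p k (p k x) = x) ∧ (∀ k x, p k x ≠ x → G.Adj x (p k x)) ∧
      (∀ k l x, p k x = p l x → k = l) ∧ ∀ x y, (x = y ∨ G.Adj x y) → ∃ k, p k x = y := by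
  classical
  obtain ⟨c, hc⟩ := G.exists_isEdgeColoring (K := K) fun v => by have := h v; omega
  let p : K → V → V := fun k x => if h : ∃ y, G.Adj x y ∧ c x y = k then h.choose else x
  have hp : ∀ k x y, G.Adj x y → c x y = k → p k x = y := by
    intro k x y hxy hk
    have hex : ∃ y, G.Adj x y ∧ c x y = k := ⟨y, hxy, hk⟩
    simp only [p, dif_pos hex]
    exact hc.proper x _ _ hex.choose_spec.1 hxy (hex.choose_spec.2.trans hk.symm)
  have hp' : ∀ k x, G.IsMissing c x k → p k x = x := by
    intro k x hk
    simp only [p]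
    exact dif_neg fun ⟨y, hy⟩ => hk y hy.1 hy.2
  have hcase : ∀ k x, (G.IsMissing c x k ∧ p k x = x) ∨
      ∃ y, G.Adj x y ∧ c x y = k ∧ p k x = y := by
    intro k x
    by_cases hk : G.IsMissing c x k
    · exact Or.inl ⟨hk, hp' k x hk⟩
    · simp only [IsMissing, not_forall, not_not] at hk
      obtain ⟨y, hxy, hy⟩ := hk
      exact Or.inr ⟨y, hxy, hy, hp k x y hxy hy⟩
  have hused : ∀ x, ((G.neighborFinset x).image (c x)).card + 1 = Fintype.card K := by
    intro x
    rw [Finset.card_image_of_injOn, card_neighborFinset_eq_degree, h x]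
    intro y hy z hz hyz
    exact hc.proper x y z (by simpa using hy) (by simpa using hz) hyz
  -- With one colour more than the degree, exactly one colour is missing at `x`; the loop takes it.
  have hmiss : ∀ x, ∃ k, ∀ l, G.IsMissing c x l ↔ l = k := by
    intro x
    have : (((G.neighborFinset x).image (c x))ᶜ).card = 1 := by
      rw [Finset.card_compl, ← hused x]; omega
    obtain ⟨k, hk⟩ := Finset.card_eq_one.1 this
    refine ⟨k, fun l => ?_⟩
    rw [← Finset.mem_singleton, ← hk]
    simp [IsMissing]
  refine ⟨p, fun k x => ?_, fun k x hx => ?_, fun k l x hkl => ?_, ?_⟩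
  · rcases hcase k x with ⟨-, hx⟩ | ⟨y, hxy, hk, hy⟩
    · rw [hx, hx]
    · rw [hy]
      exact hp k y x hxy.symm (by rw [← hc.symm x y hxy, hk])
  · rcases hcase k x with ⟨-, h⟩ | ⟨y, hxy, hk, hy⟩
    · exact (hx h).elim
    · rwa [hy]
  · rcases hcase k x with ⟨hk, hx⟩ | ⟨y, hxy, hk, hy⟩ <;>
    rcases hcase l x with ⟨hl, hx'⟩ | ⟨z, hxz, hl, hz⟩
    · obtain ⟨m, hm⟩ := hmiss x
      rw [(hm k).1 hk, (hm l).1 hl]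
    · exact (hxz.ne (by rw [← hz, ← hkl, hx])).elim
    · exact (hxy.ne (by rw [← hy, hkl, hx'])).elim
    · rw [← hk, ← hl, ← hy, ← hz, hkl]
  · rintro x y (rfl | hxy)
    · obtain ⟨k, hk⟩ := hmiss x
      exact ⟨k, hp' k x ((hk k).2 rfl)⟩
    · exact ⟨_, hp _ x y hxy rfl⟩

theorem ZMod.natCast_inj_of_lt {m a b : ℕ} (ha : a < m) (hb : b < m)
    (h : (a : ZMod m) = (b : ZMod m)) : a = b := by
  rwa [ZMod.natCast_eq_natCast_iff', Nat.mod_eq_of_lt ha, Nat.mod_eq_of_lt hb] at h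

/-! ### Frame pairs on two copies of `ZMod h`. -/

namespace TwoGroups

/-- The two sums of points on opposite sides which occur in the triangles of type `(σ, j)`. -/
def crossSum (t s : ℕ) (σ : Bool) (j : ℕ) (r : Bool) : ℕ :=
  s + (if σ then 3 * t else t) + (if r then j else 0) - (if r then 0 else j + 1)

/-- For fixed `σ` the two sums spread symmetrically from the middle of an interval of length `2 *
t`, so their gap is the odd base difference. Over all types they fill `[s, s + 4 * t)` once. The
truncated subtraction is harmless for `j < t`. -/
theorem crossSum_true {t s : ℕ} {σ : Bool} {j : ℕ} (hj : j < t) :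
    crossSum t s σ j true = crossSum t s σ j false + (2 * j + 1) := by
  cases σ <;> simp [crossSum] <;> omega

theorem crossSum_succ {t s : ℕ} {σ r : Bool} {j : ℕ} (hj : j < t) :
    crossSum t (s + 1) σ j r = crossSum t s σ j r + 1 := by
  cases σ <;> cases r <;> simp [crossSum] <;> omega

theorem le_crossSum {t s : ℕ} {σ r : Bool} {j : ℕ} (hj : j < t) : s ≤ crossSum t s σ j r := by
  cases σ <;> cases r <;> simp [crossSum] <;> omega

theorem crossSum_lt {t s : ℕ} {σ r : Bool} {j : ℕ} (hj : j < t) :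
    crossSum t s σ j r < s + 4 * t := by
  cases σ <;> cases r <;> simp [crossSum] <;> omega

theorem crossSum_inj {t s : ℕ} {σ σ' r r' : Bool} {j j' : ℕ} (hj : j < t) (hj' : j' < t)
    (h : crossSum t s σ j r = crossSum t s σ' j' r') : σ = σ' ∧ j = j' ∧ r = r' := by
  cases σ <;> cases r <;> cases σ' <;> cases r' <;> simp [crossSum] at h ⊢ <;> omega

theorem exists_crossSum {t s n : ℕ} (h1 : s ≤ n) (h2 : n < s + 4 * t) :
    ∃ σ j r, j < t ∧ crossSum t s σ j r = n := by
  rcases lt_or_ge n (s + t) with h | h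
  · exact ⟨false, s + t - 1 - n, false, by omega, by simp [crossSum]; omega⟩
  rcases lt_or_ge n (s + 2 * t) with h' | h'
  · exact ⟨false, n - (s + t), true, by omega, by simp [crossSum]; omega⟩
  rcases lt_or_ge n (s + 3 * t) with h'' | h''
  · exact ⟨true, s + 3 * t - 1 - n, false, by omega, by simp [crossSum]; omega⟩
  · exact ⟨true, n - (s + 3 * t), true, by omega, by simp [crossSum]; omega⟩

/-- The triangle with base `(x, σ)`, `(x + (2 * j + 1), σ)` and apex on the other side. -/
def triangle (h t s : ℕ) (σ : Bool) (j : ℕ) (x : ZMod h) : Finset (ZMod h × Bool) :=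
  {(x, σ), (x + (2 * j + 1 : ℕ), σ), ((crossSum t s σ j false : ℕ) - x, !σ)}

variable {h t s : ℕ}

theorem mem_triangle {σ τ : Bool} {j : ℕ} {x y : ZMod h} : (y, τ) ∈ triangle h t s σ j x ↔
    (τ = σ ∧ (y = x ∨ y = x + (2 * j + 1 : ℕ))) ∨
      (τ = !σ ∧ y = (crossSum t s σ j false : ℕ) - x) := by
  simp only [triangle, Finset.mem_insert, Finset.mem_singleton, Prod.mk.injEq]
  tauto

theorem base_of_mem {σ τ : Bool} {j : ℕ} {x y z : ZMod h} (hyz : y ≠ z)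
    (hy : (y, τ) ∈ triangle h t s σ j x) (hz : (z, τ) ∈ triangle h t s σ j x) :
    τ = σ ∧ ((y = x ∧ z = x + (2 * j + 1 : ℕ)) ∨ (z = x ∧ y = x + (2 * j + 1 : ℕ))) := by
  rw [mem_triangle] at hy hz
  rcases hy with ⟨rfl, hy⟩ | ⟨rfl, hy⟩
  · refine ⟨rfl, ?_⟩
    rcases hz with ⟨-, hz⟩ | ⟨h, -⟩
    · rcases hy with rfl | rfl <;> rcases hz with rfl | rfl <;> simp_all
    · cases τ <;> simp at h
  · rcases hz with ⟨h, -⟩ | ⟨-, hz⟩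
    · cases σ <;> simp at h
    · exact (hyz (hy.trans hz.symm)).elim

/-- `r` tells which end of the base is used; the second equation lets the base point `x` be
recovered from the edge. -/
theorem cross_of_mem {σ τ : Bool} {j : ℕ} (hj : j < t) {x y z : ZMod h}
    (hy : (y, τ) ∈ triangle h t s σ j x) (hz : (z, !τ) ∈ triangle h t s σ j x) :
    ∃ r, y + z = (crossSum t s σ j r : ℕ) ∧
      (if τ = σ then y else z) = x + if r then ((2 * j + 1 : ℕ) : ZMod h) else 0 := by
  rw [mem_triangle] at hy hz
  have hne : ∀ b : Bool, ¬ (!b) = b := by decide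
  have hne' : ∀ b : Bool, ¬ b = !b := by decide
  rcases hy with ⟨rfl, hy⟩ | ⟨rfl, hy⟩
  · rcases hz with ⟨h, -⟩ | ⟨-, hz⟩
    · exact (hne _ h).elim
    · rcases hy with rfl | rfl
      · exact ⟨false, by rw [hz]; ring, by simp⟩
      · exact ⟨true, by rw [hz, crossSum_true hj]; push_cast; ring, by simp⟩
  · rcases hz with ⟨-, hz⟩ | ⟨h, -⟩
    · rcases hz with rfl | rfl
      · exact ⟨false, by rw [hy]; ring, by simp⟩
      · exact ⟨true, by rw [hy, crossSum_true hj]; push_cast; ring, by simp⟩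
    · exact (hne' _ h.symm).elim

theorem exists_triangle_of_cross {σ r : Bool} {j : ℕ} (hj : j < t) (τ : Bool) (y z : ZMod h)
    (hyz : y + z = (crossSum t s σ j r : ℕ)) :
    ∃ x, (y, τ) ∈ triangle h t s σ j x ∧ (z, !τ) ∈ triangle h t s σ j x := by
  refine ⟨(if τ = σ then y else z) - if r then ((2 * j + 1 : ℕ) : ZMod h) else 0, ?_⟩
  rw [mem_triangle, mem_triangle]
  have h1 : r = true → y + z = (crossSum t s σ j false : ℕ) + (2 * j + 1 : ℕ) := by
    rintro rfl
    rw [hyz, crossSum_true hj]; push_cast; ring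
  rcases eq_or_ne τ σ with rfl | hne
  · refine ⟨Or.inl ⟨rfl, ?_⟩, Or.inr ⟨rfl, ?_⟩⟩ <;> cases r <;> simp
    · rw [← hyz]; ring
    · have := h1 rfl
      push_cast at this
      linear_combination this
  · have hτ : τ = !σ := by cases τ <;> cases σ <;> simp_all
    subst hτ
    refine ⟨Or.inr ⟨rfl, ?_⟩, Or.inl ⟨by simp, ?_⟩⟩ <;> cases r <;> simp
    · rw [← hyz]; ring
    · have := h1 rfl
      push_cast at this
      linear_combination this

/-- All triangles of all types. -/
def triangles (h t s : ℕ) [NeZero h] : Finset (Finset (ZMod h × Bool)) :=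
  Finset.univ.image fun q : Bool × Fin t × ZMod h => triangle h t s q.1 q.2.1 q.2.2

theorem mem_triangles [NeZero h] {b : Finset (ZMod h × Bool)} :
    b ∈ triangles h t s ↔ ∃ σ j x, j < t ∧ b = triangle h t s σ j x := by
  simp only [triangles, Finset.mem_image, Finset.mem_univ, true_and, Prod.exists]
  exact ⟨fun ⟨σ, j, x, hb⟩ => ⟨σ, j, x, j.2, hb.symm⟩,
    fun ⟨σ, j, x, hj, hb⟩ => ⟨σ, ⟨j, hj⟩, x, hb.symm⟩⟩

/-- The differences of points on one side which do not occur in a triangle. -/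
def pureGraph (h t : ℕ) : SimpleGraph (ZMod h) where
  Adj x y := x ≠ y ∧ ∀ j < t, y ≠ x + (2 * j + 1 : ℕ) ∧ x ≠ y + (2 * j + 1 : ℕ)
  symm := ⟨fun _ _ hxy => ⟨hxy.1.symm, fun j hj => (hxy.2 j hj).symm⟩⟩
  loopless := ⟨fun _ hx => hx.1 rfl⟩

theorem pureGraph_adj_neg {x y : ZMod h} (hxy : (pureGraph h t).Adj x y) :
    (pureGraph h t).Adj (-x) (-y) :=
  ⟨fun e => hxy.1 (neg_injective e), fun j hj =>
    ⟨fun e => (hxy.2 j hj).2 (by linear_combination e),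
      fun e => (hxy.2 j hj).1 (by linear_combination e)⟩⟩

/-- The residues `±(2 * j + 1)` with `j < t` are `2 * t` distinct nonzero values, because sums of
two odd numbers below `2 * t` stay below `h`. -/
theorem pureGraph_degree [NeZero h] [DecidableRel (pureGraph h t).Adj] (hth : 4 * t + 3 ≤ h)
    (x : ZMod h) : (pureGraph h t).degree x + 1 = h - 2 * t := by
  let f : Option (Fin t × Bool) → ZMod h := fun o => o.elim x fun q =>
    if q.2 then x + (2 * q.1 + 1 : ℕ) else x - (2 * q.1 + 1 : ℕ)
  have hf : Function.Injective f := by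
    have h1 : ∀ j < t, ((2 * j + 1 : ℕ) : ZMod h) ≠ 0 := fun j hj e => by
      have := ZMod.natCast_inj_of_lt (b := 0) (by omega : 2 * j + 1 < h) (by omega) (by simpa using e)
      omega
    have h2 : ∀ j k, j < t → k < t → ((2 * j + 1 : ℕ) : ZMod h) = (2 * k + 1 : ℕ) → j = k :=
      fun j k hj hk e => by
        have := ZMod.natCast_inj_of_lt (by omega) (by omega) e
        omega
    have h3 : ∀ j k, j < t → k < t → ((2 * j + 1 : ℕ) : ZMod h) + (2 * k + 1 : ℕ) ≠ 0 :=
      fun j k hj hk e => by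
        have := ZMod.natCast_inj_of_lt (a := 2 * j + 1 + (2 * k + 1)) (b := 0) (m := h) (by omega)
          (by omega) (by rw [Nat.cast_add, e, Nat.cast_zero])
        omega
    rintro (_ | ⟨j, _ | _⟩) (_ | ⟨k, _ | _⟩) e <;> simp only [f, Option.elim, if_true] at e
    · rfl
    · exact (h1 k k.2 (by simp at e ⊢; linear_combination e)).elim
    · exact (h1 k k.2 (by linear_combination -e)).elim
    · exact (h1 j j.2 (by simp at e ⊢; linear_combination e)).elim
    · rw [Fin.ext (h2 j k j.2 k.2 (by simp at e ⊢; linear_combination e))]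
    · exact (h3 j k j.2 k.2 (by simp at e ⊢; linear_combination -e)).elim
    · exact (h1 j j.2 (by linear_combination e)).elim
    · exact (h3 j k j.2 k.2 (by simp at e ⊢; linear_combination e)).elim
    · rw [Fin.ext (h2 j k j.2 k.2 (by simp at e ⊢; linear_combination e))]
  have hN : (pureGraph h t).neighborFinset x = (Finset.univ.image f)ᶜ := by
    ext y
    simp only [SimpleGraph.mem_neighborFinset, Finset.mem_compl, Finset.mem_image, Finset.mem_univ,
      true_and, not_exists]
    constructor
    · rintro ⟨hxy, hy⟩ (_ | ⟨j, _ | _⟩) e <;> simp only [f, Option.elim, if_true] at e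
      · exact hxy e
      · exact (hy j j.2).2 (by simp at e ⊢; linear_combination e)
      · exact (hy j j.2).1 e.symm
    · intro hy
      refine ⟨fun e => hy none e, fun j hj => ⟨fun e => hy (some (⟨j, hj⟩, true)) ?_,
        fun e => hy (some (⟨j, hj⟩, false)) ?_⟩⟩ <;> simp only [f, Option.elim, if_true]
      · exact e.symm
      · simp at e ⊢; linear_combination e
  rw [← SimpleGraph.card_neighborFinset_eq_degree, hN, Finset.card_compl,
    Finset.card_image_of_injective _ hf]
  simp
  omega

/-- Reflection of the second copy of `ZMod h`. -/
def sgn {h : ℕ} (σ : Bool) (x : ZMod h) : ZMod h := if σ then -x else x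

@[simp] theorem sgn_sgn {h : ℕ} (σ : Bool) (x : ZMod h) : sgn σ (sgn σ x) = x := by
  cases σ <;> simp [sgn]

@[simp] theorem sgn_not_neg {h : ℕ} (σ : Bool) (x : ZMod h) : sgn (!σ) (-x) = sgn σ x := by
  cases σ <;> simp [sgn]

/-- The sum of matched points on opposite sides. -/
def level (t r : ℕ) {a : ℕ} : Option (Fin a) → ℕ
  | none => r
  | some i => 4 * t + 2 + i

/-- The perfect matchings: those between the two sides, and those in the prism over a graph on
`ZMod h`, which come from a decomposition `p` into involutions. -/
def matching {h a : ℕ} {K : Type*} (t r : ℕ) (p : K → ZMod h → ZMod h) :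
    Option (Fin a) ⊕ K → ZMod h × Bool → ZMod h × Bool
  | Sum.inl m, x => ((level t r m : ℕ) - x.1, !x.2)
  | Sum.inr k, x => if p k (sgn x.2 x.1) = sgn x.2 x.1 then (-x.1, !x.2)
      else (sgn x.2 (p k (sgn x.2 x.1)), x.2)

variable {h t s r : ℕ} {K : Type*} {p : K → ZMod h → ZMod h}

theorem matching_inr_cases (hp : ∀ k x, p k x ≠ x → (pureGraph h t).Adj x (p k x)) {a : ℕ}
    (k : K) (x : ZMod h × Bool) :
    (p k (sgn x.2 x.1) = sgn x.2 x.1 ∧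
      matching (a := a) t r p (Sum.inr k) x = (-x.1, !x.2)) ∨
    (p k (sgn x.2 x.1) ≠ sgn x.2 x.1 ∧ (pureGraph h t).Adj x.1 (sgn x.2 (p k (sgn x.2 x.1))) ∧
      matching (a := a) t r p (Sum.inr k) x = (sgn x.2 (p k (sgn x.2 x.1)), x.2)) := by
  by_cases h1 : p k (sgn x.2 x.1) = sgn x.2 x.1
  · exact Or.inl ⟨h1, by simp [matching, h1]⟩
  · refine Or.inr ⟨h1, ?_, by simp [matching, h1]⟩
    have := hp k _ h1
    obtain ⟨x, σ⟩ := x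
    cases σ
    · simpa [sgn] using this
    · simpa [sgn] using pureGraph_adj_neg this

/-- Cross edges are sorted by their sum: `[s, s + 4 * t)` belongs to the triangles, `0` to the rungs
of the prism, the rest to `level`. On one side, small odd differences belong to triangles and the
others to `p`. The reflection `sgn` lets both copies use the same `p`, with the rungs at its fixed
points. -/
theorem isFrame [NeZero h] {a : ℕ} (hth : 4 * t + 2 + a = h)
    (hs : (s = 1 ∧ r = 4 * t + 1) ∨ (s = 2 ∧ r = 1))
    (hp1 : ∀ k x, p k (p k x) = x) (hp2 : ∀ k x, p k x ≠ x → (pureGraph h t).Adj x (p k x))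
    (hp3 : ∀ k l x, p k x = p l x → k = l)
    (hp4 : ∀ x y, (x = y ∨ (pureGraph h t).Adj x y) → ∃ k, p k x = y) :
    IsFrame (matching (a := a) t r p) (triangles h t s) := by
  have hlev : ∀ m : Option (Fin a), level t r m < h ∧ level t r m ≠ 0 ∧
      (level t r m < s ∨ s + 4 * t ≤ level t r m) := by
    rintro (_ | i) <;> simp only [level] <;> omega
  have hlevinj : ∀ m n : Option (Fin a), level t r m = level t r n → m = n := by
    rintro (_ | i) (_ | j) <;> simp only [level] <;> intro hij
    · trivial
    · omega
    · omega
    · exact congrArg some (Fin.ext (by omega))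
  have hcast0 : ∀ n : ℕ, n < h → (n : ZMod h) = 0 → n = 0 := fun n hn e =>
    ZMod.natCast_inj_of_lt hn (by omega) (by simpa using e)
  have hlevex : ∀ n, n < h → n ≠ 0 → n < s ∨ s + 4 * t ≤ n →
      ∃ m : Option (Fin a), level t r m = n := by
    intro n hn h0 h1
    rcases eq_or_ne n r with rfl | hnr
    · exact ⟨none, rfl⟩
    · exact ⟨some ⟨n - (4 * t + 2), by omega⟩, by simp only [level]; omega⟩
  have hne : ∀ b : Bool, ¬ (!b) = b := by decide
  refine ⟨?_, ?_, ?_, ?_, ?_, ?_, ?_⟩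
  · rintro (m | k) ⟨x, σ⟩ e
    · exact hne _ (congrArg Prod.snd e)
    · rcases matching_inr_cases (r := r) (a := a) hp2 k (x, σ) with ⟨-, h1⟩ | ⟨-, h2, h1⟩
      · rw [h1] at e
        exact hne _ (congrArg Prod.snd e)
      · rw [h1] at e
        exact h2.ne (congrArg Prod.fst e).symm
  · rintro (m | k) ⟨x, σ⟩
    · simp [matching]
    · rcases matching_inr_cases (r := r) (a := a) hp2 k (x, σ) with ⟨h0, h1⟩ | ⟨h0, -, h1⟩
      · rw [h1]
        simp [matching, h0]
      · rw [h1]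
        simp only [matching, sgn_sgn, hp1]
        rw [if_neg (fun e => h0 e.symm)]
  · rintro (m | k) (n | l) ⟨x, σ⟩ e
    · simp only [matching, Prod.mk.injEq, sub_left_inj, and_true] at e
      rw [hlevinj m n (ZMod.natCast_inj_of_lt (hlev m).1 (hlev n).1 e)]
    · exfalso
      rcases matching_inr_cases (r := r) (a := a) hp2 l (x, σ) with ⟨-, h1⟩ | ⟨-, -, h1⟩ <;>
        rw [h1] at e <;> simp only [matching, Prod.mk.injEq] at e
      · exact (hlev m).2.1 (hcast0 _ (hlev m).1 (by linear_combination e.1))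
      · exact hne _ e.2
    · exfalso
      rcases matching_inr_cases (r := r) (a := a) hp2 k (x, σ) with ⟨-, h1⟩ | ⟨-, -, h1⟩ <;>
        rw [h1] at e <;> simp only [matching, Prod.mk.injEq] at e
      · exact (hlev n).2.1 (hcast0 _ (hlev n).1 (by linear_combination -e.1))
      · exact hne _ e.2.symm
    · refine congrArg _ (hp3 k l (sgn σ x) ?_)
      rcases matching_inr_cases (r := r) (a := a) hp2 k (x, σ) with ⟨h0, h1⟩ | ⟨-, -, h1⟩ <;>
      rcases matching_inr_cases (r := r) (a := a) hp2 l (x, σ) with ⟨h0', h1'⟩ | ⟨-, -, h1'⟩ <;>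
      rw [h1, h1'] at e <;> simp only [Prod.mk.injEq] at e
      · exact h0.trans h0'.symm
      · exact (hne _ e.2).elim
      · exact (hne _ e.2.symm).elim
      · have := congrArg (sgn σ) e.1
        simpa using this
  · intro b hb
    obtain ⟨σ, j, x, hj, rfl⟩ := mem_triangles.1 hb
    refine Finset.card_eq_three.2 ⟨_, _, _, ?_, ?_, ?_, rfl⟩
    · intro e
      have := hcast0 (2 * j + 1) (by omega) (by simpa using congrArg Prod.fst e)
      omega
    · exact fun e => hne _ (congrArg Prod.snd e).symm
    · exact fun e => hne _ (congrArg Prod.snd e).symm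
  · rintro ⟨x, σ⟩ ⟨y, τ⟩ hxy
    by_cases hστ : τ = σ
    · subst hστ
      have hxy' : x ≠ y := fun e => hxy (by rw [e])
      by_cases hadj : (pureGraph h t).Adj x y
      · left
        have hadj' : (pureGraph h t).Adj (sgn τ x) (sgn τ y) := by
          cases τ
          · simpa [sgn] using hadj
          · simpa [sgn] using pureGraph_adj_neg hadj
        obtain ⟨k, hk⟩ := hp4 _ _ (Or.inr hadj')
        exact ⟨Sum.inr k, by simp [matching, hk, hadj'.ne']⟩
      · right
        have : ∃ j < t, y = x + (2 * j + 1 : ℕ) ∨ x = y + (2 * j + 1 : ℕ) := by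
          by_contra! hcon
          exact hadj ⟨hxy', hcon⟩
        obtain ⟨j, hj, rfl | rfl⟩ := this
        · exact ⟨_, mem_triangles.2 ⟨τ, j, x, hj, rfl⟩, mem_triangle.2 (by simp),
            mem_triangle.2 (by simp)⟩
        · exact ⟨_, mem_triangles.2 ⟨τ, j, y, hj, rfl⟩, mem_triangle.2 (by simp),
            mem_triangle.2 (by simp)⟩
    · have hτ : τ = !σ := by cases τ <;> cases σ <;> simp_all
      subst hτ
      have hval : ((x + y).val : ZMod h) = x + y := ZMod.natCast_rightInverse _
      have hlt := ZMod.val_lt (x + y)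
      by_cases h0 : (x + y).val = 0
      · left
        obtain ⟨k, hk⟩ := hp4 (sgn σ x) (sgn σ x) (Or.inl rfl)
        have : y = -x := by
          rw [h0, Nat.cast_zero] at hval; linear_combination -hval
        exact ⟨Sum.inr k, by simp [matching, hk, this]⟩
      · by_cases h1 : (x + y).val < s ∨ s + 4 * t ≤ (x + y).val
        · left
          obtain ⟨m, hm⟩ := hlevex _ hlt h0 h1
          exact ⟨Sum.inl m, by simp [matching, hm, -ZMod.natCast_val, hval]⟩
        · right
          push Not at h1
          obtain ⟨σ', j, r, hj, hr⟩ := exists_crossSum h1.1 h1.2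
          obtain ⟨z, hz⟩ := exists_triangle_of_cross hj σ x y (by rw [hr, hval])
          exact ⟨_, mem_triangles.2 ⟨_, _, _, hj, rfl⟩, hz⟩
  · rintro ⟨y, τ⟩ ⟨z, τ'⟩ hyz b hb c hc h1 h2 h3 h4
    obtain ⟨σ, j, x, hj, rfl⟩ := mem_triangles.1 hb
    obtain ⟨σ', j', x', hj', rfl⟩ := mem_triangles.1 hc
    by_cases hτ : τ' = τ
    · subst hτ
      have hyz' : y ≠ z := fun e => hyz (by rw [e])
      obtain ⟨rfl, h5⟩ := base_of_mem hyz' h1 h2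
      obtain ⟨rfl, h6⟩ := base_of_mem hyz' h3 h4
      have key : ∀ y z : ZMod h, z = y + (2 * j + 1 : ℕ) → z = y + (2 * j' + 1 : ℕ) → j = j' := by
        intro y z e1 e2
        have := ZMod.natCast_inj_of_lt (by omega) (by omega)
          (add_left_cancel (e1.symm.trans e2))
        omega
      have key2 : ∀ y z : ZMod h, z = y + (2 * j + 1 : ℕ) → y = z + (2 * j' + 1 : ℕ) → False := by
        intro y z e1 e2
        have := hcast0 (2 * j + 1 + (2 * j' + 1)) (by omega) (by
          rw [Nat.cast_add]; linear_combination -e1 - e2)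
        omega
      rcases h5 with ⟨rfl, h5⟩ | ⟨rfl, h5⟩ <;> rcases h6 with ⟨rfl, h6⟩ | ⟨rfl, h6⟩
      · rw [key _ _ h5 h6]
      · exact (key2 _ _ h5 h6).elim
      · exact (key2 _ _ h5 h6).elim
      · rw [key _ _ h5 h6]
    · have hτ' : τ' = !τ := by cases τ <;> cases τ' <;> simp_all
      subst hτ'
      obtain ⟨ρ, h5, h6⟩ := cross_of_mem hj h1 h2
      obtain ⟨ρ', h7, h8⟩ := cross_of_mem hj' h3 h4
      have hl1 := crossSum_lt (s := s) (σ := σ) (r := ρ) hj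
      have hl2 := crossSum_lt (s := s) (σ := σ') (r := ρ') hj'
      obtain ⟨rfl, rfl, rfl⟩ := crossSum_inj hj hj'
        (ZMod.natCast_inj_of_lt (by omega) (by omega) (h5.symm.trans h7))
      rw [add_right_cancel (h6.symm.trans h8)]
  · intro b hb ⟨y, τ⟩ hy f hf
    obtain ⟨σ, j, x, hj, rfl⟩ := mem_triangles.1 hb
    have hcross : ∀ z, (z, !τ) ∈ triangle h t s σ j x → ∀ n < h, n < s ∨ s + 4 * t ≤ n →
        y + z = (n : ℕ) → False := by
      intro z hz n hn hn' hyz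
      obtain ⟨ρ, h5, -⟩ := cross_of_mem hj hy hz
      have hl1 := crossSum_lt (s := s) (σ := σ) (r := ρ) hj
      have hl2 := le_crossSum (s := s) (σ := σ) (r := ρ) hj
      have := ZMod.natCast_inj_of_lt (by omega) hn (h5.symm.trans hyz)
      omega
    rcases f with m | k
    · exact hcross _ hf _ (hlev m).1 (hlev m).2.2 (by ring)
    · rcases matching_inr_cases (r := r) (a := a) hp2 k (y, τ) with ⟨-, h1⟩ | ⟨-, h2, h1⟩ <;>
        rw [h1] at hf
      · exact hcross _ hf 0 (by omega) (by omega) (by simp)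
      · obtain ⟨-, ⟨rfl, h3⟩ | ⟨h3, h4⟩⟩ := base_of_mem h2.ne hy hf
        · exact (h2.2 j hj).1 h3
        · exact (h2.2 j hj).2 (by simp only at h3; rw [h3]; exact h4)

end TwoGroups

/-- Enumerations of a finite type with prescribed first and last element. -/
theorem Fin.exists_equiv_zero_last {J : Type*} [Fintype J] {u : ℕ}
    (hJ : Fintype.card J = u + 1) (x y : J) (hxy : x ≠ y) :
    ∃ e : Fin (u + 1) ≃ J, e 0 = x ∧ e (Fin.last u) = y := by
  classical
  have hu : u ≠ 0 := by
    rintro rfl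
    obtain ⟨z, hz⟩ := Fintype.card_eq_one_iff.1 hJ
    exact hxy ((hz x).trans (hz y).symm)
  obtain ⟨e⟩ : Nonempty (Fin (u + 1) ≃ J) := ⟨Fintype.equivOfCardEq (by simp [hJ])⟩
  let e₁ := e.trans (Equiv.swap (e 0) x)
  have h1 : e₁ 0 = x := by simp [e₁]
  refine ⟨e₁.trans (Equiv.swap (e₁ (Fin.last u)) y), ?_, by simp⟩
  rw [Equiv.trans_apply, h1]
  refine Equiv.swap_apply_of_ne_of_ne (fun h => ?_) hxy
  have := e₁.injective (h1.trans h)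
  exact hu (by simpa [Fin.ext_iff] using this.symm)

namespace TwoGroups

variable {h t a u : ℕ} {K : Type*} {p : K → ZMod h → ZMod h}

/-- Moving the interval of triangle sums from `[1, 4 * t]` to `[2, 4 * t + 1]` exchanges the free
sum `4 * t + 1` for `1`. Only the matching `none`, placed last, changes. -/
theorem isFramePair [NeZero h] (hth : 4 * t + 2 + a = h) (ha : a ≠ 0) (h5 : 5 ≤ h)
    (hp1 : ∀ k x, p k (p k x) = x) (hp2 : ∀ k x, p k x ≠ x → (pureGraph h t).Adj x (p k x))
    (hp3 : ∀ k l x, p k x = p l x → k = l)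
    (hp4 : ∀ x y, (x = y ∨ (pureGraph h t).Adj x y) → ∃ k, p k x = y)
    (e : Fin (u + 1) ≃ Option (Fin a) ⊕ K) (h0 : e 0 = Sum.inl (some ⟨0, Nat.pos_of_ne_zero ha⟩))
    (hl : e (Fin.last u) = Sum.inl none) :
    IsFramePair (fun s => matching t (4 * t + 1) p (e s)) (fun s => matching t 1 p (e s))
      (triangles h t 1) (triangles h t 2) := by
  have hcast0 : ∀ n : ℕ, n < h → (n : ZMod h) = 0 → n = 0 := fun n hn e =>
    ZMod.natCast_inj_of_lt hn (by omega) (by simpa using e)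
  have hne : ∀ b : Bool, ¬ (!b) = b := by decide
  have hbase : ∀ s σ j (x : ZMod h), (x, σ) ∈ triangle h t s σ j x ∧
      (x + (2 * j + 1 : ℕ), σ) ∈ triangle h t s σ j x ∧
      ((crossSum t s σ j false : ℕ) - x, !σ) ∈ triangle h t s σ j x := fun s σ j x => by
    simp [triangle]
  have hbase_ne : ∀ j < t, ∀ x : ZMod h, x ≠ x + (2 * j + 1 : ℕ) := fun j hj x e => by
    have := hcast0 (2 * j + 1) (by omega) (by linear_combination -e)
    omega
  have hshare : ∀ s s' σ j (x : ZMod h), j < t →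
      SharePair (triangle h t s σ j x) (triangle h t s' σ j x) := fun s s' σ j x hj =>
    ⟨_, _, fun e => hbase_ne j hj x (congrArg Prod.fst e), (hbase s σ j x).1, (hbase s σ j x).2.1,
      (hbase s' σ j x).1, (hbase s' σ j x).2.1⟩
  have hcommon : ∀ f : Option (Fin a) ⊕ K, f ≠ Sum.inl none →
      matching t (4 * t + 1) p f = matching t 1 p f := by
    rintro ((_ | i) | k) hf
    · exact (hf rfl).elim
    · rfl
    · rfl
  refine ⟨(isFrame hth (Or.inl ⟨rfl, rfl⟩) hp1 hp2 hp3 hp4).reindex e,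
    (isFrame hth (Or.inr ⟨rfl, rfl⟩) hp1 hp2 hp3 hp4).reindex e, ?_, ?_, ?_, ?_, ?_, ?_, ?_, ?_⟩
  · rw [Finset.disjoint_left]
    intro b hb hb'
    obtain ⟨σ, j, x, hj, rfl⟩ := mem_triangles.1 hb
    obtain ⟨σ', j', x', hj', heq⟩ := mem_triangles.1 hb'
    obtain ⟨h1, h2, h3⟩ := hbase 1 σ j x
    rw [heq] at h1 h2 h3
    obtain ⟨rfl, h4⟩ := base_of_mem (hbase_ne j hj x) h1 h2
    obtain ⟨ρ, h6, h7⟩ := cross_of_mem hj' h1 h3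
    have hlt1 := crossSum_lt (s := 1) (σ := σ) (r := false) hj
    have hlt2 := crossSum_lt (s := 2) (σ := σ) (r := ρ) hj'
    have h8 := ZMod.natCast_inj_of_lt (by omega) (by omega) ((add_sub_cancel _ _).symm.trans h6)
    have hjj : j = j' ∧ x = x' := by
      rcases h4 with ⟨rfl, h4⟩ | ⟨h4, h4'⟩
      · have := ZMod.natCast_inj_of_lt (by omega) (by omega) (add_left_cancel h4)
        exact ⟨by omega, rfl⟩
      · have := hcast0 (2 * j + 1 + (2 * j' + 1)) (by omega) (by
          rw [Nat.cast_add]; linear_combination h4 - h4')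
        omega
    obtain ⟨rfl, rfl⟩ := hjj
    cases ρ
    · have h9 : crossSum t 2 σ j false = _ := crossSum_succ (s := 1) hj
      omega
    · simp only [if_true] at h7
      exact hbase_ne j hj _ h7
  · intro s hs0 hsl
    exact hcommon _ fun hs => hsl (e.injective (hs.trans hl.symm))
  · intro x hx
    simp only [h0, hl, matching, level, Prod.mk.injEq, and_true] at hx
    have := ZMod.natCast_inj_of_lt (by omega) (by omega) (sub_left_injective hx)
    omega
  · intro x
    refine ⟨x, Or.inl rfl, Or.inl ?_⟩
    simp only [h0]
    rfl
  · have hR : Equivalence (Relation.EqvGen fun x y : ZMod h × Bool =>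
        ∃ s, s ≠ Fin.last u ∧ y = matching t 1 p (e s) x) := Relation.EqvGen.is_equivalence _
    set R := Relation.EqvGen fun x y : ZMod h × Bool =>
        ∃ s, s ≠ Fin.last u ∧ y = matching t 1 p (e s) x
    have hlink : ∀ f, f ≠ Sum.inl none → ∀ x, R x (matching t 1 p f x) := fun f hf x =>
      Relation.EqvGen.rel _ _ ⟨e.symm f, fun h => hf (by rw [← hl, ← h, e.apply_symm_apply]),
        by rw [e.apply_symm_apply]⟩
    have hneg : ∀ x σ, R (x, σ) (-x, !σ) := by
      intro x σ
      obtain ⟨k, hk⟩ := hp4 (sgn σ x) (sgn σ x) (Or.inl rfl)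
      have := hlink (Sum.inr k) (by simp) (x, σ)
      simpa [matching, hk] using this
    -- The matchings of sum `0` and of sum `-1` compose to a translation by `-1`.
    have hstep : ∀ x σ, R (x, σ) (x - 1, σ) := by
      intro x σ
      refine hR.trans (hneg x σ) ?_
      have h2 := hlink (Sum.inl (some ⟨a - 1, by omega⟩)) (by simp) (-x, !σ)
      have h3 : ((4 * t + 2 + (a - 1) : ℕ) : ZMod h) = -1 := by
        rw [eq_neg_iff_add_eq_zero, ← Nat.cast_add_one,
          show 4 * t + 2 + (a - 1) + 1 = h by omega, ZMod.natCast_self]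
      simp only [matching, level, Bool.not_not, h3] at h2
      convert h2 using 2
      ring
    have hwalk : ∀ (n : ℕ) x σ, R (x, σ) (x - n, σ) := by
      intro n x σ
      induction n with
      | zero => simpa using hR.refl _
      | succ n ih =>
        refine hR.trans ih ?_
        have := hstep (x - n) σ
        rwa [sub_sub, ← Nat.cast_add_one] at this
    have hsame : ∀ x y σ, R (x, σ) (y, σ) := by
      intro x y σ
      have := hwalk (x - y).val x σ
      rwa [ZMod.natCast_rightInverse, sub_sub_cancel] at this
    rintro ⟨x, σ⟩ ⟨y, τ⟩
    by_cases hστ : τ = σ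
    · subst hστ
      exact hsame x y τ
    · have : τ = !σ := by cases τ <;> cases σ <;> simp_all
      subst this
      exact hR.trans (hneg x σ) (hsame _ _ _)
  · intro P hP1 hP2
    -- Sum `1` is the last matching of `G`. An edge of sum `n ≥ 2` also lies in a triangle of `T₂`;
    -- the triangle of `T₁` on the same base has its lower sum at most `n - 1`.
    have hmain : ∀ n σ j (x : ZMod h), j < t → crossSum t 1 σ j false = n →
        P (triangle h t 1 σ j x) := by
      intro n
      induction n using Nat.strong_induction_on with
      | _ n ih =>
      intro σ j x hj hn
      obtain ⟨h1, h2, h3⟩ := hbase 1 σ j x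
      rcases Nat.lt_or_ge n 2 with hn1 | hn2
      · have hge := le_crossSum (s := 1) (σ := σ) (r := false) hj
        have hn1 : crossSum t 1 σ j false = 1 := by omega
        refine hP1 _ (mem_triangles.2 ⟨σ, j, x, hj, rfl⟩) _ h1 (Fin.last u) ?_
        simp only [hl, matching, level]
        rwa [hn1] at h3
      · have hlt := crossSum_lt (s := 1) (σ := σ) (r := false) hj
        obtain ⟨σ', j', ρ, hj', hn'⟩ := exists_crossSum (t := t) (s := 2) (n := n) hn2 (by omega)
        obtain ⟨x', h4, h5⟩ := exists_triangle_of_cross hj' σ x ((crossSum t 1 σ j false : ℕ) - x)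
          (by rw [hn', hn]; ring)
        refine hP2 _ (mem_triangles.2 ⟨σ, j, x, hj, rfl⟩) _
          (mem_triangles.2 ⟨σ', j', x', hj', rfl⟩) _ (mem_triangles.2 ⟨σ', j', x', hj', rfl⟩)
          ⟨_, _, fun e => hne _ (congrArg Prod.snd e).symm, h1, h3, h4, h5⟩ (hshare _ _ _ _ _ hj') ?_
        refine ih _ ?_ σ' j' x' hj' rfl
        have h6 : crossSum t 2 σ' j' false = _ := crossSum_succ (s := 1) hj'
        cases ρ
        · omega
        · rw [crossSum_true hj'] at hn'
          omega
    intro b hb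
    obtain ⟨σ, j, x, hj, rfl⟩ := mem_triangles.1 hb
    exact hmain _ σ j x hj rfl
  · intro c hc
    obtain ⟨σ, j, x, hj, rfl⟩ := mem_triangles.1 hc
    exact ⟨_, mem_triangles.2 ⟨σ, j, x, hj, rfl⟩, hshare _ _ _ _ _ hj⟩
  -- The Pasch configuration uses the points `0, 2, 4` of one side, whose even differences are free
  -- of triangles.
  · have hadj : ∀ m n : ℕ, m < n → n ≤ 4 → Even (n - m) → ∃ s, s ≠ 0 ∧ s ≠ Fin.last u ∧
        matching t (4 * t + 1) p (e s) ((m : ZMod h), false) = ((n : ZMod h), false) := by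
      intro m n hmn hn4 hev
      obtain ⟨q, hq⟩ := hev
      have hadj : (pureGraph h t).Adj (m : ZMod h) (n : ZMod h) := by
        refine ⟨fun e => ?_, fun j hj => ⟨fun e => ?_, fun e => ?_⟩⟩
        · have := ZMod.natCast_inj_of_lt (by omega) (by omega) e
          omega
        · rw [← Nat.cast_add] at e
          have := ZMod.natCast_inj_of_lt (by omega) (by omega) e
          omega
        · have h1 : n + (2 * j + 1) < h + m := by omega
          have h2 := hcast0 (n + (2 * j + 1) - m) (by omega) (by
            rw [Nat.cast_sub (by omega), Nat.cast_add, ← e, sub_self])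
          omega
      obtain ⟨k, hk⟩ := hp4 _ _ (Or.inr hadj)
      refine ⟨e.symm (Sum.inr k), fun h => ?_, fun h => ?_, ?_⟩
      · rw [Equiv.symm_apply_eq, h0] at h
        cases h
      · rw [Equiv.symm_apply_eq, hl] at h
        cases h
      · rw [e.apply_symm_apply]
        simp [matching, sgn, hk, hadj.ne']
    obtain ⟨a₁, ha0, hal, ha⟩ := hadj 2 4 (by omega) (by omega) (by decide)
    obtain ⟨b₁, hb0, hbl, hb⟩ := hadj 0 4 (by omega) (by omega) (by decide)
    obtain ⟨c₁, hc0, hcl, hc⟩ := hadj 0 2 (by omega) (by omega) (by decide)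
    refine ⟨_, _, _, a₁, b₁, c₁, ha0, hal, hb0, hbl, hc0, hcl, ha, hb, hc, fun e => ?_⟩
    have := ZMod.natCast_inj_of_lt (by omega) (by omega) (congrArg Prod.fst e)
    omega

/-- Each point lies in `3 * t` triangles, so `2 * h - 1 - 6 * t` matchings remain, one for each old
point. The bound `4 * t + 3 ≤ h` leaves at least one `level` of the form `some i`, needed at index
`0`. -/
theorem hasNonHamiltonian (hth : 4 * t + 3 ≤ h) (h5 : 5 ≤ h) (hu : u + 1 + 6 * t + 1 = 2 * h)
    (hu2 : 2 ≤ u) (hH : HasNonHamiltonian (u + 1)) : HasNonHamiltonian (u + 1 + 2 * h) := by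
  classical
  have : NeZero h := ⟨by omega⟩
  have : NeZero (h - 2 * t) := ⟨by omega⟩
  obtain ⟨p, hp1, hp2, hp3, hp4⟩ := (pureGraph h t).exists_involutions (K := Fin (h - 2 * t))
    fun v => by rw [pureGraph_degree hth, Fintype.card_fin]
  obtain ⟨a, ha⟩ : ∃ a, h = 4 * t + 2 + a := ⟨h - (4 * t + 2), by omega⟩
  have ha0 : a ≠ 0 := by omega
  obtain ⟨e, h0, hl⟩ := Fin.exists_equiv_zero_last (J := Option (Fin a) ⊕ Fin (h - 2 * t)) (u := u)
    (by simp; omega) (Sum.inl (some ⟨0, Nat.pos_of_ne_zero ha0⟩)) (Sum.inl none) (by simp)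
  have := (isFramePair ha.symm ha0 h5 hp1 hp2 hp3 hp4 e h0 hl).hasNonHamiltonian hu2 hH
  rwa [Fintype.card_prod, ZMod.card, Fintype.card_bool, mul_comm h 2] at this

end TwoGroups

/-! ### One-factorizations of complete graphs. -/

/-- `K` is a one-factorization of the complete graph on `V`. -/
structure IsOneFactorization {J V : Type*} (K : J → V → V) : Prop where
  ne : ∀ k x, K k x ≠ x
  invol : ∀ k x, K k (K k x) = x
  inj : ∀ k l x, K k x = K l x → k = l
  cover : ∀ x y, x ≠ y → ∃ k, K k x = y

/-- Complete graphs of even order have a one-factorization. -/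
theorem exists_isOneFactorization {J V : Type*} [Fintype J] [Fintype V] (hV : Even (Fintype.card V))
    (hJ : Fintype.card J + 1 = Fintype.card V) : ∃ K : J → V → V, IsOneFactorization K := by
  classical
  obtain ⟨q, hq⟩ := hV
  obtain ⟨q, rfl⟩ : ∃ n, q = n + 1 := ⟨q - 1, by omega⟩
  set A := ZMod (2 * q + 1) with hA
  have h2 : (2 : A) * ((q + 1 : ℕ) : A) = 1 := by
    have : ((2 * (q + 1) : ℕ) : A) = 1 := by
      rw [show 2 * (q + 1) = (2 * q + 1) + 1 by ring, Nat.cast_add, ZMod.natCast_self]; simp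
    rwa [Nat.cast_mul] at this
  have hcancel : ∀ x y : A, 2 * x = 2 * y → x = y := fun x y e => by
    linear_combination ((q + 1 : ℕ) : A) * e - (x - y) * h2
  obtain ⟨e⟩ : Nonempty (V ≃ Option A) := ⟨Fintype.equivOfCardEq (by simp [A]; omega)⟩
  obtain ⟨f⟩ : Nonempty (J ≃ A) := ⟨Fintype.equivOfCardEq (by simp [A]; omega)⟩
  -- The round-robin schedule: reflection in `k`, whose fixed point `k` is paired with the extra
  -- point. It needs `2` to be invertible, with inverse `q + 1`.
  let K : A → Option A → Option A := fun k x =>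
    x.elim (some k) fun x => if x = k then none else some (2 * k - x)
  have hnone : ∀ k, K k none = some k := fun _ => rfl
  have hsome : ∀ k x, K k (some x) = if x = k then none else some (2 * k - x) := fun _ _ => rfl
  have hK : IsOneFactorization K := by
    refine ⟨?_, ?_, ?_, ?_⟩
    · rintro k (_ | x)
      · simp [hnone]
      · rw [hsome]
        split_ifs with h
        · simp
        · intro e
          exact h (hcancel _ _ (by linear_combination -Option.some.inj e))
    · rintro k (_ | x)
      · simp [hnone, hsome]
      · rw [hsome]
        split_ifs with h
        · rw [h, hnone]
        · rw [hsome, if_neg fun e => h (by linear_combination -e)]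
          congr 1
          ring
    · rintro k l (_ | x) e
      · exact Option.some.inj e
      · rw [hsome, hsome] at e
        split_ifs at e with h h' h'
        · exact h.symm.trans h'
        · exact hcancel _ _ (by linear_combination Option.some.inj e)
    · rintro (_ | x) (_ | y) hxy
      · exact (hxy rfl).elim
      · exact ⟨y, rfl⟩
      · exact ⟨x, by simp [hsome]⟩
      · refine ⟨((q + 1 : ℕ) : A) * (x + y), ?_⟩
        rw [hsome, if_neg]
        · congr 1
          linear_combination (x + y) * h2
        · intro h
          exact hxy (congrArg some (by linear_combination 2 * h + (x + y) * h2))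
  refine ⟨fun j x => e.symm (K (f j) (e x)), fun j x h => ?_, fun j x => ?_, fun j l x h => ?_,
    fun x y hxy => ?_⟩
  · exact hK.ne (f j) (e x) (e.symm_apply_eq.1 h)
  · simp [hK.invol]
  · exact f.injective (hK.inj _ _ _ (e.symm.injective h))
  · obtain ⟨k, hk⟩ := hK.cover (e x) (e y) fun h => hxy (e.injective h)
    exact ⟨f.symm k, by simp [hk]⟩

/-! ### Frame pairs on three copies of `ZMod m`. -/

namespace ThreeGroups

variable {m t r : ℕ} {L : Type*}

/-- The transversal triangle with offsets `P 0 i`, `P 1 i`, `P 2 i`. -/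
def triangle (P : Fin 3 → Fin t → ZMod m) (i : Fin t) (y : ZMod m) : Finset (ZMod m × Fin 3) :=
  Finset.univ.image fun g => (P g i + y, g)

variable {P : Fin 3 → Fin t → ZMod m} {C : Fin 3 → Fin r → ZMod m}
  {K : Fin r ⊕ L → ZMod m → ZMod m}

theorem mem_triangle {i : Fin t} {y z : ZMod m} {g : Fin 3} :
    (z, g) ∈ triangle P i y ↔ z = P g i + y := by
  simp [triangle, eq_comm]

/-- All translates of the triangles. -/
def triangles [NeZero m] (P : Fin 3 → Fin t → ZMod m) : Finset (Finset (ZMod m × Fin 3)) :=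
  Finset.univ.image fun q : Fin t × ZMod m => triangle P q.1 q.2

theorem mem_triangles [NeZero m] {b : Finset (ZMod m × Fin 3)} :
    b ∈ triangles P ↔ ∃ i y, b = triangle P i y := by
  simp [triangles, eq_comm]

/-- The perfect matchings: those which join the groups `g + 1` and `g + 2` by a difference class
and split the group `g` by a factor of `K`, and those which split all groups. -/
def matching (C : Fin 3 → Fin r → ZMod m) (K : Fin r ⊕ L → ZMod m → ZMod m) :
    (Fin 3 × Fin r) ⊕ L → ZMod m × Fin 3 → ZMod m × Fin 3
  | Sum.inl f, x => if x.2 = f.1 then (K (Sum.inl f.2) x.1, x.2)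
      else if x.2 = f.1 + 1 then (x.1 + C f.1 f.2, f.1 + 2) else (x.1 - C f.1 f.2, f.1 + 1)
  | Sum.inr l, x => (K (Sum.inr l) x.1, x.2)

theorem matching_self (g : Fin 3) (l : Fin r) (z : ZMod m) :
    matching C K (Sum.inl (g, l)) (z, g) = (K (Sum.inl l) z, g) := by
  simp [matching]

theorem matching_add_one (g : Fin 3) (l : Fin r) (z : ZMod m) :
    matching C K (Sum.inl (g, l)) (z, g + 1) = (z + C g l, g + 2) := by
  have : ¬ g + 1 = g := by decide +revert
  simp [matching]

theorem matching_add_two (g : Fin 3) (l : Fin r) (z : ZMod m) :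
    matching C K (Sum.inl (g, l)) (z, g + 2) = (z - C g l, g + 1) := by
  simp [matching]

theorem fin_three_cases (g k : Fin 3) : k = g ∨ k = g + 1 ∨ k = g + 2 := by decide +revert

theorem fin_three_ne {k k' : Fin 3} (h : k ≠ k') :
    ∃ g, (k = g + 1 ∧ k' = g + 2) ∨ (k = g + 2 ∧ k' = g + 1) := by decide +revert

/-- Between two groups every difference belongs to exactly one triangle class or one class of `C`;
inside a group every edge belongs to exactly one factor of `K`. -/
theorem isFrame [NeZero m] (hK : IsOneFactorization K)
    (hP : ∀ g i j, P (g + 2) i - P (g + 1) i = P (g + 2) j - P (g + 1) j → i = j)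
    (hC : ∀ g, Function.Injective (C g)) (hPC : ∀ g i l, P (g + 2) i - P (g + 1) i ≠ C g l)
    (hcov : ∀ g δ, (∃ i, P (g + 2) i - P (g + 1) i = δ) ∨ ∃ l, C g l = δ) :
    IsFrame (matching C K) (triangles P) := by
  have h1 : ∀ g : Fin 3, g + 1 ≠ g ∧ g + 2 ≠ g ∧ g + 1 ≠ g + 2 := by decide
  have hdiff : ∀ {i : Fin t} {y z w : ZMod m} {g : Fin 3}, (z, g + 1) ∈ triangle P i y →
      (w, g + 2) ∈ triangle P i y → P (g + 2) i - P (g + 1) i = w - z := by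
    intro i y z w g hz hw
    rw [mem_triangle] at hz hw
    rw [hz, hw]; ring
  refine ⟨?_, ?_, ?_, ?_, ?_, ?_, ?_⟩
  · rintro (⟨g, l⟩ | l) ⟨z, k⟩ e
    · rcases fin_three_cases g k with rfl | rfl | rfl
      · rw [matching_self] at e
        exact hK.ne _ _ (congrArg Prod.fst e)
      · rw [matching_add_one] at e
        exact (h1 g).2.2 (congrArg Prod.snd e).symm
      · rw [matching_add_two] at e
        exact (h1 g).2.2 (congrArg Prod.snd e)
    · exact hK.ne _ _ (congrArg Prod.fst e)
  · rintro (⟨g, l⟩ | l) ⟨z, k⟩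
    · rcases fin_three_cases g k with rfl | rfl | rfl
      · rw [matching_self, matching_self, hK.invol]
      · rw [matching_add_one, matching_add_two]; simp
      · rw [matching_add_two, matching_add_one]; simp
    · simp only [matching, hK.invol]
  · have hmix : ∀ g l l' z k, matching C K (Sum.inl (g, l)) (z, k) =
        matching C K (Sum.inr l') (z, k) → False := by
      intro g l l' z k e
      rcases fin_three_cases g k with rfl | rfl | rfl
      · rw [matching_self] at e
        cases hK.inj _ _ _ (congrArg Prod.fst e)
      · rw [matching_add_one] at e
        exact (h1 g).2.2 (congrArg Prod.snd e).symm
      · rw [matching_add_two] at e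
        exact (h1 g).2.2 (congrArg Prod.snd e)
    have hsnd : ∀ g l z, (matching C K (Sum.inl (g, l)) (z, g)).2 = g ∧
        (matching C K (Sum.inl (g, l)) (z, g + 1)).2 = g + 2 ∧
        (matching C K (Sum.inl (g, l)) (z, g + 2)).2 = g + 1 := fun g l z => by
      rw [matching_self, matching_add_one, matching_add_two]; exact ⟨rfl, rfl, rfl⟩
    rintro (⟨g, l⟩ | l) (⟨g', l'⟩ | l') ⟨z, k⟩ e
    · have hg : g = g' := by
        -- On group labels a matching of class `g` acts as the reflection `k ↦ 2 * g - k`, from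
        -- which `g` can be read off.
        have hval : ∀ g l k, (matching C K (Sum.inl (g, l)) (z, k)).2 = 2 * g - k := by
          intro g l k
          rcases fin_three_cases g k with rfl | rfl | rfl
          · rw [(hsnd k l z).1]; exact (by decide : ∀ k : Fin 3, k = 2 * k - k) k
          · rw [(hsnd g l z).2.1]; exact (by decide : ∀ g : Fin 3, g + 2 = 2 * g - (g + 1)) g
          · rw [(hsnd g l z).2.2]; exact (by decide : ∀ g : Fin 3, g + 1 = 2 * g - (g + 2)) g
        have := congrArg Prod.snd e
        rw [hval, hval] at this
        revert this
        exact (by decide : ∀ g g' k : Fin 3, 2 * g - k = 2 * g' - k → g = g') g g' k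
      subst hg
      rcases fin_three_cases g k with rfl | rfl | rfl
      · rw [matching_self, matching_self] at e
        rw [Sum.inl.inj (hK.inj _ _ _ (congrArg Prod.fst e))]
      · rw [matching_add_one, matching_add_one] at e
        rw [hC g (add_left_cancel (congrArg Prod.fst e))]
      · rw [matching_add_two, matching_add_two] at e
        rw [hC g (sub_right_injective (congrArg Prod.fst e))]
    · exact (hmix _ _ _ _ _ e).elim
    · exact (hmix _ _ _ _ _ e.symm).elim
    · rw [Sum.inr.inj (hK.inj _ _ _ (congrArg Prod.fst e))]
  · intro b hb
    obtain ⟨i, y, rfl⟩ := mem_triangles.1 hb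
    rw [triangle, Finset.card_image_of_injective _ fun g g' e => congrArg Prod.snd e]
    rfl
  · rintro ⟨z, k⟩ ⟨w, k'⟩ hne
    by_cases hk : k = k'
    · subst hk
      left
      obtain ⟨l | l, hl⟩ := hK.cover z w fun e => hne (by rw [e])
      · exact ⟨Sum.inl (k, l), by rw [matching_self, hl]⟩
      · exact ⟨Sum.inr l, by simp only [matching, hl]⟩
    · obtain ⟨g, ⟨rfl, rfl⟩ | ⟨rfl, rfl⟩⟩ := fin_three_ne hk
      · rcases hcov g (w - z) with ⟨i, hi⟩ | ⟨l, hl⟩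
        · exact Or.inr ⟨_, mem_triangles.2 ⟨i, z - P (g + 1) i, rfl⟩, mem_triangle.2 (by ring),
            mem_triangle.2 (by linear_combination -hi)⟩
        · exact Or.inl ⟨Sum.inl (g, l), by rw [matching_add_one, hl]; simp⟩
      · rcases hcov g (z - w) with ⟨i, hi⟩ | ⟨l, hl⟩
        · exact Or.inr ⟨_, mem_triangles.2 ⟨i, w - P (g + 1) i, rfl⟩,
            mem_triangle.2 (by linear_combination -hi), mem_triangle.2 (by ring)⟩
        · exact Or.inl ⟨Sum.inl (g, l), by rw [matching_add_two, hl]; simp⟩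
  · have key : ∀ g z w i y i' y', (z, g + 1) ∈ triangle P i y → (w, g + 2) ∈ triangle P i y →
        (z, g + 1) ∈ triangle P i' y' → (w, g + 2) ∈ triangle P i' y' →
        triangle P i y = triangle P i' y' := by
      intro g z w i y i' y' h1 h2 h3 h4
      obtain rfl := hP g i i' ((hdiff h1 h2).trans (hdiff h3 h4).symm)
      rw [mem_triangle] at h1 h3
      rw [add_left_cancel (h1.symm.trans h3)]
    rintro ⟨z, k⟩ ⟨w, k'⟩ hne b hb c hc h1 h2 h3 h4
    obtain ⟨i, y, rfl⟩ := mem_triangles.1 hb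
    obtain ⟨i', y', rfl⟩ := mem_triangles.1 hc
    by_cases hk : k = k'
    · subst hk
      rw [mem_triangle] at h1 h2
      exact (hne (by rw [h1, h2])).elim
    · obtain ⟨g, ⟨rfl, rfl⟩ | ⟨rfl, rfl⟩⟩ := fin_three_ne hk
      · exact key _ _ _ _ _ _ _ h1 h2 h3 h4
      · exact key _ _ _ _ _ _ _ h2 h1 h4 h3
  · rintro b hb ⟨z, k⟩ hz f hf
    obtain ⟨i, y, rfl⟩ := mem_triangles.1 hb
    have hsame : ∀ l, (K l z, k) ∈ triangle P i y → False := fun l h => by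
      rw [mem_triangle] at hz h
      exact hK.ne l z (h.trans hz.symm)
    rcases f with ⟨g, l⟩ | l
    · rcases fin_three_cases g k with rfl | rfl | rfl
      · rw [matching_self] at hf
        exact hsame _ hf
      · rw [matching_add_one] at hf
        exact hPC g i l (by rw [hdiff hz hf]; ring)
      · rw [matching_add_two] at hf
        exact hPC g i l (by rw [hdiff hf hz]; ring)
    · exact hsame _ hf

variable {m t r u : ℕ} {L : Type*}

/-- The offsets of the triangles. -/
def offset (d : Fin t → ZMod m) (s : ℕ) : Fin 3 → Fin t → ZMod m :=
  ![fun i => -d i, fun _ => 0, fun i => (i + s : ℕ)]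

/-- The differences outside the interval `[s, s + t)`. -/
def gap (t s l : ℕ) : ℕ := if s = 1 ∧ l = 0 then 0 else t + l

/-- The difference classes of the matchings. -/
def gaps (t s : ℕ) (δ : Fin r → ZMod m) : Fin 3 → Fin r → ZMod m :=
  ![fun l => (gap t s l : ℕ), fun l => -(gap t s l : ℕ), δ]

variable {d : Fin t → ZMod m} {δ : Fin r → ZMod m} {K : Fin r ⊕ L → ZMod m → ZMod m}
  {σ : Equiv.Perm (Fin t)}

/-- The triangle differences are `[s, s + t)`, its negative (permuted by `σ`), and the values of
`d`. `gap` enumerates the complement of the interval, and `δ` that of the values of `d`. -/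
theorem isFrame_offset [NeZero m] (hm : t + r = m) {s : ℕ} (hs : s = 0 ∨ s = 1) (hr : r ≠ 0)
    (hd : Function.Injective d) (hσ : ∀ i, d i + (i : ℕ) = (σ i : ℕ)) (hδ : Function.Injective δ)
    (hdδ : ∀ i l, d i ≠ δ l) (hcov : ∀ x, (∃ i, d i = x) ∨ ∃ l, δ l = x)
    (hK : IsOneFactorization K) :
    IsFrame (matching (gaps t s δ) K) (triangles (offset d s)) := by
  have h0 : ∀ i, offset d s (0 + 2) i - offset d s (0 + 1) i = ((i + s : ℕ) : ZMod m) := fun i => by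
    simp [offset]
  have h1 : ∀ i, offset d s (1 + 2) i - offset d s (1 + 1) i = -((σ i + s : ℕ) : ZMod m) :=
    fun i => by
      have := hσ i
      simp [offset]
      linear_combination -this
  have h2 : ∀ i, offset d s (2 + 2) i - offset d s (2 + 1) i = d i := fun i => by
    simp [offset]
  have hgap : ∀ l : Fin r, gap t s l < m ∧ (gap t s l < s ∨ s + t ≤ gap t s l) := by
    intro l
    unfold gap
    split_ifs with h <;> omega
  have hgapinj : ∀ l l' : Fin r, ((gap t s l : ℕ) : ZMod m) = (gap t s l' : ℕ) → l = l' := by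
    intro l l' h
    have := ZMod.natCast_inj_of_lt (hgap l).1 (hgap l').1 h
    unfold gap at this
    ext
    split_ifs at this <;> omega
  have hlt : ∀ n < t, n + s < m := fun n hn => by omega
  have hne : ∀ n < t, ∀ l : Fin r, ((n + s : ℕ) : ZMod m) ≠ (gap t s l : ℕ) := by
    intro n hn l h
    have := ZMod.natCast_inj_of_lt (hlt n hn) (hgap l).1 h
    have := (hgap l).2
    omega
  have hex : ∀ x : ZMod m, (∃ i : Fin t, ((i + s : ℕ) : ZMod m) = x) ∨
      ∃ l : Fin r, ((gap t s l : ℕ) : ZMod m) = x := by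
    intro x
    obtain ⟨n, hn, rfl⟩ : ∃ n < m, (n : ZMod m) = x :=
      ⟨x.val, ZMod.val_lt x, ZMod.natCast_rightInverse x⟩
    by_cases hlow : n < s
    · exact Or.inr ⟨⟨0, by omega⟩, congrArg _ (by
        unfold gap; rw [if_pos ⟨by omega, rfl⟩]; omega)⟩
    by_cases hhigh : s + t ≤ n
    · exact Or.inr ⟨⟨n - t, by omega⟩, congrArg _ (by
        unfold gap; rw [if_neg (by simp only; omega)]; simp only; omega)⟩
    · exact Or.inl ⟨⟨n - s, by omega⟩, congrArg _ (by simp only; omega)⟩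
  refine isFrame hK ?_ ?_ ?_ ?_
  · intro g i j h
    fin_cases g
    · have h := (h0 i).symm.trans (h.trans (h0 j))
      have := ZMod.natCast_inj_of_lt (hlt i i.2) (hlt j j.2) h
      ext
      omega
    · have h := neg_injective ((h1 i).symm.trans (h.trans (h1 j)))
      have := ZMod.natCast_inj_of_lt (hlt _ (σ i).2) (hlt _ (σ j).2) h
      refine σ.injective ?_
      ext
      omega
    · exact hd ((h2 i).symm.trans (h.trans (h2 j)))
  · intro g l l' h
    fin_cases g
    · exact hgapinj l l' h
    · exact hgapinj l l' (neg_injective h)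
    · exact hδ h
  · intro g i l h
    fin_cases g
    · exact hne i i.2 l ((h0 i).symm.trans h)
    · exact hne _ (σ i).2 l (neg_injective ((h1 i).symm.trans h))
    · exact hdδ i l ((h2 i).symm.trans h)
  · intro g x
    fin_cases g
    · exact (hex x).imp (fun ⟨i, hi⟩ => ⟨i, (h0 i).trans hi⟩) id
    · exact (hex (-x)).imp
        (fun ⟨i, hi⟩ => ⟨σ.symm i, (h1 _).trans (by rw [σ.apply_symm_apply, hi, neg_neg])⟩)
        fun ⟨l, hl⟩ => ⟨l, by simp [gaps, hl]⟩
    · exact (hcov x).imp (fun ⟨i, hi⟩ => ⟨i, (h2 i).trans hi⟩) id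

/-- Moving the interval from `[0, t)` to `[1, t]` frees `0` in place of `t`, which changes the
matchings `(0, 0)` and `(1, 0)` only. They are put at the two ends of the index range. -/
theorem isFramePair [NeZero m] (hm : t + r = m) (hr : r ≠ 0) (hm3 : 3 ≤ m)
    (hd : Function.Injective d) (hσ : ∀ i, d i + (i : ℕ) = (σ i : ℕ)) (hδ : Function.Injective δ)
    (hdδ : ∀ i l, d i ≠ δ l) (hcov : ∀ x, (∃ i, d i = x) ∨ ∃ l, δ l = x)
    (hK : IsOneFactorization K) (e : Fin (u + 1) ≃ (Fin 3 × Fin r) ⊕ L)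
    (he0 : e 0 = Sum.inl (1, ⟨0, Nat.pos_of_ne_zero hr⟩))
    (hel : e (Fin.last u) = Sum.inl (0, ⟨0, Nat.pos_of_ne_zero hr⟩)) :
    IsFramePair (fun s => matching (gaps t 0 δ) K (e s)) (fun s => matching (gaps t 1 δ) K (e s))
      (triangles (offset d 0)) (triangles (offset d 1)) := by
  set o : Fin r := ⟨0, Nat.pos_of_ne_zero hr⟩
  have hgap : ∀ l : Fin r, l ≠ o → gap t 0 l = gap t 1 l := by
    intro l hl
    have : (l : ℕ) ≠ 0 := fun h => hl (Fin.ext h)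
    simp [gap, this]
  have hcommon : ∀ f : (Fin 3 × Fin r) ⊕ L, f ≠ Sum.inl (1, o) → f ≠ Sum.inl (0, o) →
      matching (gaps t 0 δ) K f = matching (gaps t 1 δ) K f := by
    rintro (⟨g, l⟩ | l) h1 h0
    · have : gaps t 0 δ g l = gaps t 1 δ g l := by
        fin_cases g
        · simp only [gaps]
          exact congrArg _ (hgap l fun h => h0 (by rw [h]; rfl))
        · simp only [gaps]
          exact congrArg (fun n : ℕ => -(n : ZMod m)) (hgap l fun h => h1 (by rw [h]; rfl))
        · rfl
      funext x
      simp only [matching, this]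
    · rfl
  have hself : ∀ s g l z, matching (gaps t s δ) K (Sum.inl (g, l)) (z, g) = (K (Sum.inl l) z, g) :=
    fun s g l z => matching_self g l z
  have hmem : ∀ s i (y : ZMod m), (-d i + y, 0) ∈ triangle (offset d s) i y ∧
      (y, 1) ∈ triangle (offset d s) i y ∧
      (((i + s : ℕ) : ZMod m) + y, 2) ∈ triangle (offset d s) i y := fun s i y => by
    refine ⟨mem_triangle.2 ?_, mem_triangle.2 ?_, mem_triangle.2 ?_⟩ <;> simp [offset]
  have hshare : ∀ s s' i (y : ZMod m),
      SharePair (triangle (offset d s) i y) (triangle (offset d s') i y) := fun s s' i y =>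
    ⟨(-d i + y, 0), (y, 1), by simp, (hmem s i y).1, (hmem s i y).2.1, (hmem s' i y).1,
      (hmem s' i y).2.1⟩
  have h2cases : ∀ g : Fin 3, g = 0 ∨ g = 1 ∨ g = 2 := by decide
  refine ⟨(isFrame_offset hm (Or.inl rfl) hr hd hσ hδ hdδ hcov hK).reindex e,
    (isFrame_offset hm (Or.inr rfl) hr hd hσ hδ hdδ hcov hK).reindex e, ?_, ?_, ?_, ?_, ?_, ?_, ?_,
    ?_⟩
  · rw [Finset.disjoint_left]
    intro b hb hb'
    obtain ⟨i, y, rfl⟩ := mem_triangles.1 hb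
    obtain ⟨i', y', heq⟩ := mem_triangles.1 hb'
    obtain ⟨h1, h2, h3⟩ := hmem 0 i y
    rw [heq, mem_triangle] at h1 h2 h3
    simp only [offset, Matrix.cons_val] at h1 h2 h3
    obtain rfl : y = y' := by simpa using h2
    obtain rfl := hd (neg_injective (add_right_cancel h1))
    have := ZMod.natCast_inj_of_lt (by omega) (by omega) (add_right_cancel h3)
    omega
  · intro s h0 hl
    exact hcommon _ (fun h => h0 (e.injective (h.trans he0.symm)))
      fun h => hl (e.injective (h.trans hel.symm))
  · rintro ⟨z, g⟩ h
    simp only [he0, hel] at h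
    have := congrArg Prod.snd h
    rcases h2cases g with rfl | rfl | rfl <;> simp [matching] at this
  -- The end matchings keep their factor of `K` on group `0` (last index) and group `1` (first
  -- index); a point of group `2` is first sent to group `0` by `F 0`.
  · have hzero : ∀ z, ∃ w, matching (gaps t 0 δ) K (Sum.inl (1, o)) (z, 2) = (w, 0) := fun z =>
      ⟨_, matching_add_one (C := gaps t 0 δ) (K := K) 1 o z⟩
    rintro ⟨z, g⟩
    simp only [he0, hel]
    rcases h2cases g with rfl | rfl | rfl
    · exact ⟨_, Or.inl rfl, Or.inr (by rw [hself, hself])⟩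
    · exact ⟨_, Or.inl rfl, Or.inl (by rw [hself, hself])⟩
    · obtain ⟨w, hw⟩ := hzero z
      exact ⟨_, Or.inr (Or.inl hw.symm), Or.inr (by rw [hself, hself])⟩
  · have hR : Equivalence (Relation.EqvGen fun x y : ZMod m × Fin 3 =>
        ∃ s, s ≠ Fin.last u ∧ y = matching (gaps t 1 δ) K (e s) x) :=
      Relation.EqvGen.is_equivalence _
    set R := Relation.EqvGen fun x y : ZMod m × Fin 3 =>
        ∃ s, s ≠ Fin.last u ∧ y = matching (gaps t 1 δ) K (e s) x
    have hlink : ∀ f, f ≠ Sum.inl (0, o) → ∀ x, R x (matching (gaps t 1 δ) K f x) := fun f hf x =>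
      Relation.EqvGen.rel _ _ ⟨e.symm f, fun h => hf (by rw [← hel, ← h, e.apply_symm_apply]),
        by rw [e.apply_symm_apply]⟩
    have h11 : ∀ z w, R (z, 1) (w, 1) := by
      intro z w
      by_cases hzw : z = w
      · rw [hzw]
        exact hR.refl _
      obtain ⟨l | l, rfl⟩ := hK.cover z w hzw
      · have := hlink (Sum.inl (1, l)) (by simp) (z, 1)
        rwa [hself] at this
      · exact hlink (Sum.inr l) (by simp) (z, 1)
    have h0 : ∀ z, R (z, 0) (0, 1) := fun z =>
      hR.trans (hlink (Sum.inl (2, o)) (by simp) (z, 0)) (h11 _ _)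
    have h1 : ∀ x, R x (0, 1) := by
      rintro ⟨z, g⟩
      rcases h2cases g with rfl | rfl | rfl
      · exact h0 z
      · exact h11 _ _
      · exact hR.trans (hlink (Sum.inl (1, o)) (by simp) (z, 2)) (h0 _)
    exact fun x y => hR.trans (h1 x) (hR.symm (h1 y))
  · intro p hp1 hp2
    -- The difference `n + 1` between groups `1` and `2` is that of triangle `n` in the shifted
    -- family, which shares a pair with triangle `n` of the first. Difference `0` is the last
    -- matching of `G`.
    have hmain : ∀ (n : ℕ) (hn : n < t) (y : ZMod m), p (triangle (offset d 0) ⟨n, hn⟩ y) := by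
      intro n
      induction n with
      | zero =>
        intro hn y
        refine hp1 _ (mem_triangles.2 ⟨_, _, rfl⟩) _ (hmem 0 ⟨0, hn⟩ y).2.1 (Fin.last u) ?_
        have h1 := matching_add_one (C := gaps t 1 δ) (K := K) 0 o y
        have h2 : gaps t 1 δ 0 o = 0 := by simp [gaps, gap, o]
        simp only [hel]
        rw [h2] at h1
        have h3 := (hmem 0 ⟨0, hn⟩ y).2.2
        simp only [add_zero, Nat.cast_zero, zero_add] at h1 h3
        exact h1 ▸ h3
      | succ n ih =>
        intro hn y
        refine hp2 _ (mem_triangles.2 ⟨_, _, rfl⟩) _ (mem_triangles.2 ⟨⟨n, by omega⟩, y, rfl⟩) _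
          (mem_triangles.2 ⟨⟨n, by omega⟩, y, rfl⟩) ⟨(y, 1), (((n + 1 : ℕ) : ZMod m) + y, 2), by simp,
          (hmem 0 ⟨n + 1, hn⟩ y).2.1, (hmem 0 ⟨n + 1, hn⟩ y).2.2, (hmem 1 ⟨n, by omega⟩ y).2.1,
          (hmem 1 ⟨n, by omega⟩ y).2.2⟩ (hshare _ _ _ _) (ih (by omega) y)
    intro b hb
    obtain ⟨i, y, rfl⟩ := mem_triangles.1 hb
    exact hmain i i.2 y
  · intro c hc
    obtain ⟨i, y, rfl⟩ := mem_triangles.1 hc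
    exact ⟨_, mem_triangles.2 ⟨i, y, rfl⟩, hshare _ _ _ _⟩
  · have hne : ∀ a b : ℕ, a < b → b < 3 → (a : ZMod m) ≠ (b : ZMod m) := fun a b hab hb h => by
      have := ZMod.natCast_inj_of_lt (by omega) (by omega) h
      omega
    have hcol : ∀ a b : ℕ, a < b → b < 3 → ∃ s, s ≠ 0 ∧ s ≠ Fin.last u ∧
        matching (gaps t 0 δ) K (e s) ((a : ZMod m), 2) = ((b : ZMod m), 2) := by
      intro a b hab hb
      have hf : ∃ f : (Fin 3 × Fin r) ⊕ L, f ≠ Sum.inl (1, o) ∧ f ≠ Sum.inl (0, o) ∧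
          matching (gaps t 0 δ) K f ((a : ZMod m), 2) = ((b : ZMod m), 2) := by
        obtain ⟨l | l, hl⟩ := hK.cover _ _ (hne a b hab hb)
        · exact ⟨Sum.inl (2, l), by simp, by simp, by rw [hself, hl]⟩
        · exact ⟨Sum.inr l, by simp, by simp, by simp only [matching, hl]⟩
      obtain ⟨f, h1, h2, h3⟩ := hf
      refine ⟨e.symm f, fun h => h1 ?_, fun h => h2 ?_, by rw [e.apply_symm_apply, h3]⟩
      · rw [← he0, ← h, e.apply_symm_apply]
      · rw [← hel, ← h, e.apply_symm_apply]
    obtain ⟨a₁, ha0, hal, ha⟩ := hcol 1 2 (by omega) (by omega)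
    obtain ⟨b₁, hb0, hbl, hb⟩ := hcol 0 2 (by omega) (by omega)
    obtain ⟨c₁, hc0, hcl, hc⟩ := hcol 0 1 (by omega) (by omega)
    exact ⟨_, _, _, a₁, b₁, c₁, ha0, hal, hb0, hbl, hc0, hcl, ha, hb, hc, fun h =>
      hne 1 2 (by omega) (by omega) (congrArg Prod.fst h)⟩

theorem intCast_inj_of_lt {m : ℕ} {a b : ℤ} (h1 : a - b < m) (h2 : b - a < m)
    (h : (a : ZMod m) = (b : ZMod m)) : a = b := by
  have := Int.eq_zero_of_abs_lt_dvd ((ZMod.intCast_eq_intCast_iff_dvd_sub a b m).1 h)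
    (abs_lt.2 ⟨by omega, h2⟩)
  omega

/-- Distinct residues which become a permutation of `[0, t)` when the identity is added. -/
theorem exists_orthomorphism (ht : t < m) : ∃ (d : Fin t → ZMod m) (σ : Equiv.Perm (Fin t)),
    Function.Injective d ∧ ∀ i, d i + (i : ℕ) = (σ i : ℕ) := by
  let d : ℕ → ℤ := fun i => if 2 * i < t then i + 1 - (t % 2 : ℕ) else i - t
  -- The first half of the indices gives the numbers of the parity of `t - 1`, the second half those
  -- of the parity of `t`. The values of `d` span at most `t < m`, so they stay distinct modulo `m`.
  let σ : Fin t → Fin t := fun i =>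
    ⟨if 2 * i.1 < t then 2 * i + 1 - t % 2 else 2 * i - t, by split_ifs <;> omega⟩
  have hσ : Function.Injective σ := by
    intro i j h
    have := congrArg Fin.val h
    simp only [σ] at this
    ext
    split_ifs at this <;> omega
  refine ⟨fun i => d i, Equiv.ofBijective σ (Finite.injective_iff_bijective.1 hσ), ?_, ?_⟩
  · intro i j h
    have h1 : d i = d j := by
      refine intCast_inj_of_lt ?_ ?_ h <;> simp only [d] <;> split_ifs <;> omega
    simp only [d] at h1
    ext
    split_ifs at h1 <;> omega
  · intro i
    have : d i + (i : ℕ) = ((σ i : ℕ) : ℤ) := by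
      simp only [d, σ]
      split_ifs <;> omega
    simp only [Equiv.ofBijective_apply]
    exact_mod_cast congrArg (Int.cast : ℤ → ZMod m) this

/-- Each point lies in `t` triangles, leaving `3 * m - 1 - 2 * t` matchings: `3 * r` of mixed type,
and `t - 1` from the remaining factors of `K`. -/
theorem hasNonHamiltonian (hm : Even m) (hm3 : 3 ≤ m) (ht0 : t ≠ 0) (ht : t < m)
    (hu : u + 2 + 2 * t = 3 * m) (hu2 : 2 ≤ u) (hH : HasNonHamiltonian (u + 1)) :
    HasNonHamiltonian (u + 1 + 3 * m) := by
  classical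
  have : NeZero m := ⟨by omega⟩
  obtain ⟨r, rfl⟩ : ∃ r, m = t + r := ⟨m - t, by omega⟩
  have hr : r ≠ 0 := by omega
  obtain ⟨d, σ, hd, hσ⟩ := exists_orthomorphism ht
  obtain ⟨f⟩ : Nonempty (Fin r ≃ {x // x ∉ Set.range d}) := by
    refine ⟨Fintype.equivOfCardEq ?_⟩
    have h1 : Fintype.card {x // x ∈ Set.range d} = t :=
      (Set.card_range_of_injective hd).trans (Fintype.card_fin t)
    rw [Fintype.card_subtype_compl, ZMod.card, h1]
    simp
  obtain ⟨K, hK⟩ := exists_isOneFactorization (J := Fin r ⊕ Fin (t - 1)) (V := ZMod (t + r))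
    (by rwa [ZMod.card]) (by simp [ZMod.card]; omega)
  obtain ⟨e, h0, hl⟩ := Fin.exists_equiv_zero_last (J := (Fin 3 × Fin r) ⊕ Fin (t - 1)) (u := u)
    (by simp; omega) (Sum.inl (1, ⟨0, Nat.pos_of_ne_zero hr⟩))
    (Sum.inl (0, ⟨0, Nat.pos_of_ne_zero hr⟩)) (by simp)
  have := (isFramePair (δ := fun l => (f l).1) rfl hr hm3 hd hσ
    (Subtype.val_injective.comp f.injective) (fun i l h => (f l).2 ⟨i, h⟩)
    (fun x => by
      by_cases hx : x ∈ Set.range d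
      · exact Or.inl hx
      · exact Or.inr ⟨f.symm ⟨x, hx⟩, by simp⟩) hK e h0 hl).hasNonHamiltonian hu2 hH
  rwa [Fintype.card_prod, ZMod.card, Fintype.card_fin, mul_comm (t + r) 3] at this

end ThreeGroups

/-! ### Choice of parameters and iteration. -/

/-- If `6` divides `v - u`, three groups of even size are used and `v ≤ 4 * u + 2` amounts to `t <
m`. Otherwise `6` divides `v - 2 * u - 1` and two groups are used; there `4 * t + 3 ≤ h` amounts to
`v ≤ 5 * u - 14`, met with equality at `u = 15`, `v = 61`. -/
theorem HasNonHamiltonian.of_le {u v : ℕ} (hu : Admissible u) (hv : Admissible v)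
    (huv : 2 * u < v) (hvu : v ≤ 4 * u + 2) (hu13 : 13 < u) (h : HasNonHamiltonian u) :
    HasNonHamiltonian v := by
  obtain ⟨w, rfl⟩ : ∃ w, u = w + 1 := ⟨u - 1, by omega⟩
  unfold Admissible at hu hv
  by_cases h6 : (v - (w + 1)) % 6 = 0
  · have := ThreeGroups.hasNonHamiltonian (m := (v - (w + 1)) / 3) (t := (v - 2 * (w + 1) - 1) / 2)
      (Nat.even_iff.2 (by omega)) (by omega) (by omega) (by omega) (by omega) (by omega) h
    rwa [show w + 1 + 3 * ((v - (w + 1)) / 3) = v by omega] at this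
  · have := TwoGroups.hasNonHamiltonian (h := (v - (w + 1)) / 2) (t := (v - 2 * (w + 1) - 1) / 6)
      (by omega) (by omega) (by omega) (by omega) h
    rwa [show w + 1 + 2 * ((v - (w + 1)) / 2) = v by omega] at this

/-- While `v > 4 * u + 2`, the order `u` may be replaced by the admissible order `2 * u + 1`, which
is still less than half of `v`; `n` bounds `v - u`. -/
theorem HasNonHamiltonian.of_lt (v : ℕ) (hv : Admissible v) (n : ℕ) : ∀ u, v ≤ u + n →
    Admissible u → 2 * u < v → 13 < u → HasNonHamiltonian u → HasNonHamiltonian v := by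
  induction n with
  | zero => intro u h1 _ h2 _ _; omega
  | succ n ih =>
    intro u h1 hu huv hu13 h
    rcases Nat.lt_or_ge (4 * u + 2) v with hlt | hle
    · have hu' : Admissible (2 * u + 1) := by
        unfold Admissible at hu ⊢
        omega
      exact ih (2 * u + 1) (by omega) hu' (by omega) (by omega)
        (h.of_le hu hu' (by omega) (by omega) hu13)
    · exact h.of_le hu hv huv hle hu13

theorem theorem2 (u v : ℕ) (hu : Admissible u) (hv : Admissible v)
    (huv : 2 * u < v) (hu13 : 13 < u)
    (h : ∃ B : Finset (Finset (Fin u)), IsTTS u B ∧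
      (blockIntersectionGraph 2 B).IsBipartite ∧
      (blockIntersectionGraph 2 B).Connected ∧
      ¬ (blockIntersectionGraph 2 B).IsHamiltonian) :
    ∃ B : Finset (Finset (Fin v)), IsTTS v B ∧
      (blockIntersectionGraph 2 B).IsBipartite ∧
      (blockIntersectionGraph 2 B).Connected ∧
      ¬ (blockIntersectionGraph 2 B).IsHamiltonian :=
  HasNonHamiltonian.of_lt v hv v u (by omega) hu huv hu13 h
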